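/- **Setting.** Let $N\ge 1$ be an integer and $q\in(0,N^{1/2}]$. Let $H=(H_{ij})$ be a real symmetric random $N\times N$ matrix such that (i) the entries $(H_{ij})_{1\le i\le j\le N}$ are independent; (ii) $\mathbb E H_{ij}=0$ for all $i,j$, $\mathbb E H_{ij}^2=1/N$ for $i\ne j$, and $|\mathbb E H_{ii}^2-1/N|\le K/N$ for some constant $K$; (iii) $\mathbb E|H_{ij}|^k\le 1/(Nq^{k-2})$ for all $i,j$ and all integers $k\ge 3$. Let $0\le f\le q$, $\mathbf e=N^{-1/2}(1,\dots,1)^*$, $A=H+f\,\mathbf e\mathbf e^*$, and $G(z)=(A-z)^{-1}$. Let $$m(z)=\int\frac{\varrho(\mathrm dx)}{x-z},\qquad \varrho(\mathrm dx)=\frac1{2\pi}\sqrt{(4-x^2)_+}\,\mathrm dx,\qquad \mathbf S=\{E+\mathrm i\eta\in\mathbb C: N^{-1}<\eta\le 1\},$$ and, for $z=E+\mathrm i\eta\in\mathbf S$, $$\zeta=\zeta(N,r,q,\eta,f)=\Big(\frac r{q^2}\Big)^{1/4}+\frac r{(N\eta)^{1/6}}+\frac r{(\log\eta+\log N)\,q}+\frac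 f{(N\eta)^{1/4}} .$$ **Theorem 2.2 (Local law).** Put $C_*=1000$, and let $z=E+\mathrm i\eta\in\mathbf S$. 1. For all real $r\ge 10$, $1\le q\le N^{1/2}$ and $t>0$ with $t\zeta\le 1$, $$\mathbb P\Big(\max_{i,j}|G_{ij}(z)-m(z)\delta_{ij}|>t\zeta\Big)\le N^5\Big(\frac{C_*}{t}\Big)^r .$$ 2. For $D>0$ and $\delta\in(0,1)$ set $$C(\delta,D)=\Big(\frac{4C_*\mathrm e^{5+D}}{\delta}\Big)^2,\qquad N_0(\delta,D)=\exp\Big[\Big(\mathrm e^{10}\log\frac{4C_*\mathrm e^{5+D}}{\delta}\Big)^2\Big].$$ If $N\ge N_0(\delta,D)$, $C(\delta,D)\sqrt{\log N}\le q\le(\log N)^{10}$ and $\eta\ge N^{-1+(\log N)^{-1/2}}$, then $$\mathbb P\Big(\max_{i,j}|G_{ij}(z)-m(z)\delta_{ij}|\le\delta\Big)\ge 1-N^{-D}.$$ -/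

import Mathlib

open MeasureTheory ProbabilityTheory

noncomputable section

namespace SparseLocalLaw

/-- `H` is a sparse random `N × N` matrix with sparsity parameter `q ∈ (0, N^{1/2}]`.
The number `K` is the implicit constant in `𝔼 H_{ij}² = (1 + O(δ_{ij})) / N`: it only concerns the
diagonal entries. -/
structure IsSparseMatrix {Ω : Type*} [MeasurableSpace Ω] (P : Measure Ω) (N : ℕ) (q K : ℝ)
    (H : Ω → Matrix (Fin N) (Fin N) ℝ) : Prop where
  q_pos : 0 < q
  q_le : q ≤ Real.sqrt N
  measurable : ∀ i j, Measurable fun ω => H ω i j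
  symm : ∀ ω, (H ω).IsSymm
  /-- The entries on and above the diagonal are (jointly) independent. -/
  indep : iIndepFun
    (fun (p : {p : Fin N × Fin N // p.1 ≤ p.2}) (ω : Ω) => H ω p.1.1 p.1.2) P
  mean : ∀ i j, ∫ ω, H ω i j ∂P = 0
  variance_offDiag : ∀ i j, i ≠ j → ∫ ω, H ω i j ^ 2 ∂P = 1 / N
  variance_diag : ∀ i, |∫ ω, H ω i i ^ 2 ∂P - 1 / N| ≤ K / N
  integrable : ∀ k : ℕ, 3 ≤ k → ∀ i j, Integrable (fun ω => |H ω i j| ^ k) P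
  moment : ∀ k : ℕ, 3 ≤ k → ∀ i j, ∫ ω, |H ω i j| ^ k ∂P ≤ 1 / (N * q ^ (k - 2))

/-- The unit vector `e = N^{-1/2} (1, …, 1)`. -/
def flatVector (N : ℕ) : Fin N → ℝ := fun _ => 1 / Real.sqrt N

/-- The matrix `A = H + f e e^*`. -/
def adjacency {N : ℕ} (f : ℝ) (H : Matrix (Fin N) (Fin N) ℝ) : Matrix (Fin N) (Fin N) ℝ :=
  H + f • Matrix.vecMulVec (flatVector N) (flatVector N)

/-- The Green function `G(z) = (A - z)⁻¹` of a real matrix `A`. -/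
def green {N : ℕ} (A : Matrix (Fin N) (Fin N) ℝ) (z : ℂ) : Matrix (Fin N) (Fin N) ℂ :=
  (A.map (fun x : ℝ => (x : ℂ)) - z • (1 : Matrix (Fin N) (Fin N) ℂ))⁻¹

/-- The density of the semicircle law, `(2π)⁻¹ √((4 - x²)₊)`. -/
def semicircleDensity (x : ℝ) : ℝ := 1 / (2 * Real.pi) * Real.sqrt (max (4 - x ^ 2) 0)

/-- The Stieltjes transform `m(z) = ∫ ϱ(dx) / (x - z)` of the semicircle law. -/
def semicircleStieltjes (z : ℂ) : ℂ := ∫ x : ℝ, (semicircleDensity x : ℂ) / ((x : ℂ) - z)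

/-- The spectral domain `S = {E + iη : N⁻¹ < η ≤ 1}`. -/
def spectralDomain (N : ℕ) : Set ℂ := {z | (N : ℝ)⁻¹ < z.im ∧ z.im ≤ 1}

/-- The error parameter `ζ(N, r, q, η, f)`. -/
def zeta (N : ℕ) (r q η f : ℝ) : ℝ :=
  (r / q ^ 2) ^ (1 / 4 : ℝ) + r / (N * η) ^ (1 / 6 : ℝ)
    + r / ((Real.log η + Real.log N) * q) + f / (N * η) ^ (1 / 4 : ℝ)

/-- `max_{i,j} |G_{ij}(z) - m(z) δ_{ij}|` for the Green function `G` of `A`. -/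
def maxError {N : ℕ} (A : Matrix (Fin N) (Fin N) ℝ) (z : ℂ) : ℝ :=
  ⨆ p : Fin N × Fin N,
    ‖green A z p.1 p.2 - semicircleStieltjes z * (if p.1 = p.2 then 1 else 0)‖

/-- The universal constant `C_*`. -/
def Cstar : ℝ := 1000

/-- The constant `C(δ, D) = (4 C_* e^{5+D} / δ)²`. -/
def constC (δ D : ℝ) : ℝ := (4 * Cstar * Real.exp (5 + D) / δ) ^ 2

/-- The constant `N₀(δ, D) = exp[(e^{10} log (4 C_* e^{5+D} / δ))²]`. -/
def constN0 (δ D : ℝ) : ℝ :=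
  Real.exp ((Real.exp 10 * Real.log (4 * Cstar * Real.exp (5 + D) / δ)) ^ 2)

end SparseLocalLaw

end

/-! The Schur complement formula expresses `1 / G i i` through the entry `A i i`, the spectral
parameter and a quadratic form of row `i` in the Green function of the minor, and the off-diagonal
part of row `i` of `H` is independent of that minor. If the linear and quadratic forms of the row
are close to their means, then `1 + G i i * (z + s)` is small, with `s` the normalized trace;
averaging over `i` gives `s ^ 2 + z * s + 1 ≈ 0`. The semicircle transform `m` is the root of this
equation in the open unit disc. Near the edges `±2` the two roots merge, and an error `δ ^ 2` in the
equation only yields `|s - m| ≤ 4 * δ` (`stability`). This is why quadratic forms are controlled at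
scale `T ^ 2` and linear forms at scale `T`.

Concentration comes from high moments. Expanding a `2m`-th moment gives a sum over labellings;
centring kills those that attain a value only once, and each remaining one has weight `c ^ (number
of values)` with, for the entries, `c = q ^ 2 / N`. `sum_fibreWeight_mul_prod_le` sums these weights
by removing one fibre at a time and produces a bound `(A * R) ^ n`, where `R` is any positive
solution of `c * y * (exp (p / R) - 1) ≤ R`. This single inequality covers both Gaussian behaviour
(`R` of order the square root of `c * y * p`) and Poisson behaviour (`R` of order `p` over a
logarithm). Quadratic forms are first decoupled into bipartite ones, to which the same estimate
applies twice.

The forms can be estimated only when the minors obey a priori bounds. These are trivial at height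
`Im z = 3`. Row bounds turn a priori bounds into strictly better ones at the same parameter
(`improve_bounds`), and Lipschitz continuity carries these to a priori bounds at the next point of a
grid of `N ^ 2 + 1` parameters (`ImprovedBounds.step`). A union bound over grid points and rows
gives the tail estimate; the second assertion is the case `r = log N`, `t = C_* exp (5 + D)`. -/

noncomputable section

/-! ### Weighted sums over labellings without singleton fibres -/

namespace SparseLocalLaw

/-- Every value of `l` is attained at least twice. -/
def NoSingleton {E V : Type*} (l : E → V) : Prop := ∀ e, ∃ e', e' ≠ e ∧ l e' = l e

open Classical in
/-- The weight `c ^ (number of values of l)` of a labelling without singleton fibres. -/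
def fibreWeight {E V : Type*} [Fintype E] (c : ℝ) (l : E → V) : ℝ :=
  if NoSingleton l then c ^ (Finset.univ.image l).card else 0

theorem fibreWeight_nonneg {E V : Type*} [Fintype E] {c : ℝ} (hc : 0 ≤ c) (l : E → V) :
    0 ≤ fibreWeight c l := by
  unfold fibreWeight
  split_ifs <;> positivity

/-- Two factors of the block are spent on the `ℓ²` bound through `2ab ≤ a² + b²`; all others are
replaced by their supremum. -/
theorem sum_prod_le_pow_card {E V : Type*} [Fintype V] {A y : ℝ} (hA : 0 ≤ A) (α : E → V → ℝ)
    (h0 : ∀ e v, 0 ≤ α e v) (h1 : ∀ e v, α e v ≤ A) (h2 : ∀ e, ∑ v, α e v ^ 2 ≤ A ^ 2 * y)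
    (B : Finset E) (hB : 2 ≤ B.card) : ∑ v, ∏ e ∈ B, α e v ≤ A ^ B.card * y := by
  classical
  obtain ⟨a, ha, b, hb, hab⟩ := Finset.one_lt_card.1 hB
  have hb' : b ∈ B.erase a := Finset.mem_erase.2 ⟨hab.symm, hb⟩
  have hcard : ((B.erase a).erase b).card + 2 = B.card := by
    rw [Finset.card_erase_of_mem hb', Finset.card_erase_of_mem ha]; omega
  have key : ∀ v, ∏ e ∈ B, α e v ≤
      A ^ ((B.erase a).erase b).card * ((α a v ^ 2 + α b v ^ 2) / 2) := by
    intro v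
    rw [← Finset.mul_prod_erase B _ ha, ← Finset.mul_prod_erase (B.erase a) _ hb']
    have h3 : ∏ e ∈ (B.erase a).erase b, α e v ≤ A ^ ((B.erase a).erase b).card := by
      refine (Finset.prod_le_prod (fun e _ => h0 e v) (fun e _ => h1 e v)).trans ?_
      simp
    have h4 : α a v * α b v ≤ (α a v ^ 2 + α b v ^ 2) / 2 := by
      nlinarith [sq_nonneg (α a v - α b v)]
    calc α a v * (α b v * ∏ e ∈ (B.erase a).erase b, α e v)
        = (∏ e ∈ (B.erase a).erase b, α e v) * (α a v * α b v) := by ring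
      _ ≤ _ := mul_le_mul h3 h4 (mul_nonneg (h0 _ _) (h0 _ _)) (by positivity)
  refine (Finset.sum_le_sum fun v _ => key v).trans ?_
  rw [← Finset.mul_sum, ← Finset.sum_div, Finset.sum_add_distrib, ← hcard, pow_add]
  have := h2 a
  have := h2 b
  have hp : 0 ≤ A ^ ((B.erase a).erase b).card := by positivity
  rw [mul_assoc]
  exact mul_le_mul_of_nonneg_left (by linarith) hp

/-- Deleting a whole fibre leaves the other fibres intact, so no singleton is created and exactly
one value, hence one factor `c`, is lost. This is the induction step of the next estimate. -/
theorem fibreWeight_mul_prod_le {E V : Type*} [Fintype E] [DecidableEq E] {c : ℝ} (hc : 0 ≤ c)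
    (α : E → V → ℝ) (h0 : ∀ e v, 0 ≤ α e v) (e₀ : E) (l : E → V) (B : Finset E)
    (hB : ∀ e, e ∈ B ↔ l e = l e₀) :
    fibreWeight c l * ∏ e, α e (l e) ≤
      c * (∏ e ∈ B, α e (l e₀)) *
        (fibreWeight c (fun e : {e // e ∉ B} => l e) * ∏ e : {e // e ∉ B}, α e (l e)) := by
  classical
  have hprod : ∏ e, α e (l e) = (∏ e ∈ B, α e (l e₀)) * ∏ e : {e // e ∉ B}, α e (l e) := by
    rw [← Finset.prod_mul_prod_compl B]
    congr 1
    · exact Finset.prod_congr rfl fun e he => by rw [(hB e).1 he]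
    · rw [Finset.prod_subtype (Bᶜ) (p := fun e => e ∉ B) (by simp)]
  have hw : fibreWeight c l ≤ c * fibreWeight c (fun e : {e // e ∉ B} => l e) := by
    by_cases hl : NoSingleton l
    · have hl' : NoSingleton (fun e : {e // e ∉ B} => l e) := by
        intro e
        obtain ⟨e', h1, h2⟩ := hl e
        refine ⟨⟨e', fun h => e.2 ?_⟩, fun h => h1 (by simpa using congrArg Subtype.val h), h2⟩
        rw [hB] at h ⊢
        rw [← h2, h]
      have himg : Finset.univ.image l =
          insert (l e₀) (Finset.univ.image (fun e : {e // e ∉ B} => l e)) := by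
        ext v
        simp only [Finset.mem_image, Finset.mem_univ, true_and, Finset.mem_insert, Subtype.exists]
        constructor
        · rintro ⟨e, rfl⟩
          by_cases he : e ∈ B
          · exact Or.inl ((hB e).1 he)
          · exact Or.inr ⟨e, he, rfl⟩
        · rintro (rfl | ⟨e, _, rfl⟩)
          · exact ⟨_, rfl⟩
          · exact ⟨_, rfl⟩
      have hnot : l e₀ ∉ Finset.univ.image (fun e : {e // e ∉ B} => l e) := by
        simp only [Finset.mem_image, Finset.mem_univ, true_and, Subtype.exists, not_exists]
        intro e he h
        exact he ((hB e).2 h)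
      unfold fibreWeight
      rw [if_pos hl, if_pos hl', himg, Finset.card_insert_of_notMem hnot, pow_succ']
    · have : fibreWeight c l = 0 := by unfold fibreWeight; rw [if_neg hl]
      rw [this]
      exact mul_nonneg hc (fibreWeight_nonneg hc _)
  rw [hprod]
  have hP : 0 ≤ (∏ e ∈ B, α e (l e₀)) * ∏ e : {e // e ∉ B}, α e (l e) :=
    mul_nonneg (Finset.prod_nonneg fun _ _ => h0 _ _) (Finset.prod_nonneg fun _ _ => h0 _ _)
  calc _ ≤ c * fibreWeight c (fun e : {e // e ∉ B} => l e) * _ :=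
        mul_le_mul_of_nonneg_right hw hP
    _ = _ := by ring

/-- Induction on `n`: sum first over the fibre of a chosen element and its label, then over the
remaining labelling. The parameter `p ≥ n` keeps the condition on `R` unchanged while `n` decreases.
-/
theorem sum_fibreWeight_mul_prod_le {V : Type*} [Fintype V] {c A y R p : ℝ} (hc : 0 ≤ c)
    (hA : 0 ≤ A) (hy : 0 ≤ y) (hR : 0 < R) (h : c * y * (Real.exp (p / R) - 1) ≤ R) (n : ℕ) :
    ∀ (E : Type) [Fintype E] [DecidableEq E], Fintype.card E = n → (n : ℝ) ≤ p → ∀ α : E → V → ℝ,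
      (∀ e v, 0 ≤ α e v) → (∀ e v, α e v ≤ A) → (∀ e, ∑ v, α e v ^ 2 ≤ A ^ 2 * y) →
      ∑ l : E → V, fibreWeight c l * ∏ e, α e (l e) ≤ (A * R) ^ n := by
  classical
  induction n using Nat.strong_induction_on with
  | _ n ih =>
  intro E _ _ hE hnp α h0 h1 h2
  rcases Nat.eq_zero_or_pos n with hn | hn
  · subst hn
    have : IsEmpty E := Fintype.card_eq_zero_iff.1 hE
    rw [Fintype.sum_unique]
    unfold fibreWeight
    split_ifs <;> simp
  obtain ⟨e₀⟩ : Nonempty E := Fintype.card_pos_iff.1 (by omega)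
  set S : Finset E := Finset.univ.erase e₀ with hS
  have hScard : S.card = n - 1 := by rw [hS, Finset.card_erase_of_mem (Finset.mem_univ _)]; simp [hE]
  -- Labellings are classified by the fibre of `e₀` (without `e₀`) and its label.
  let κ : (E → V) → Finset E × V := fun l => (S.filter fun e => l e = l e₀, l e₀)
  have hκ : ∀ l ∈ (Finset.univ : Finset (E → V)), κ l ∈ S.powerset ×ˢ (Finset.univ : Finset V) := by
    intro l _
    simp [κ]
  rw [← Finset.sum_fiberwise_of_maps_to hκ, Finset.sum_product]
  have hterm : ∀ B ∈ S.powerset, ∀ v : V,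
      ∑ l ∈ Finset.univ.filter (fun l => κ l = (B, v)), fibreWeight c l * ∏ e, α e (l e) ≤
        if B = ∅ then 0 else c * (∏ e ∈ insert e₀ B, α e v) * (A * R) ^ (n - 1 - B.card) := by
    intro B hB v
    split_ifs with hB0
    · subst hB0
      refine le_of_eq (Finset.sum_eq_zero fun l hl => ?_)
      have hl' : NoSingleton l → False := by
        intro hs
        obtain ⟨e', he', hle⟩ := hs e₀
        have : e' ∈ S.filter fun e => l e = l e₀ := by simp [hS, he', hle]
        have h3 := (Finset.mem_filter.1 hl).2
        simp only [κ, Prod.mk.injEq] at h3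
        rw [h3.1] at this
        simp at this
      unfold fibreWeight
      rw [if_neg hl', zero_mul]
    · have hBS := Finset.mem_powerset.1 hB
      have he₀B : e₀ ∉ B := fun h => by simpa [hS] using hBS h
      have hcardT : Fintype.card {e // e ∉ insert e₀ B} = n - 1 - B.card := by
        rw [Fintype.card_subtype_compl, hE, Fintype.card_coe, Finset.card_insert_of_notMem he₀B]
        omega
      have hBn : B.card ≤ n - 1 := hScard ▸ Finset.card_le_card hBS
      have ih' := ih (n - 1 - B.card) (by omega) {e // e ∉ insert e₀ B} hcardT
        (le_trans (by exact_mod_cast (by omega : n - 1 - B.card ≤ n)) hnp) (fun e => α e)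
        (fun _ _ => h0 _ _) (fun _ _ => h1 _ _) (fun _ => h2 _)
      have hmem : ∀ l ∈ Finset.univ.filter (fun l => κ l = (B, v)),
          l e₀ = v ∧ ∀ e, e ∈ insert e₀ B ↔ l e = l e₀ := by
        intro l hl
        have h3 := (Finset.mem_filter.1 hl).2
        simp only [κ, Prod.mk.injEq] at h3
        refine ⟨h3.2, fun e => ?_⟩
        rw [← h3.1]
        by_cases he : e = e₀ <;> simp [he, hS]
      calc _ ≤ ∑ l ∈ Finset.univ.filter (fun l => κ l = (B, v)),
            c * (∏ e ∈ insert e₀ B, α e v) *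
              (fibreWeight c (fun e : {e // e ∉ insert e₀ B} => l e) *
                ∏ e : {e // e ∉ insert e₀ B}, α e (l e)) := by
            refine Finset.sum_le_sum fun l hl => ?_
            obtain ⟨h4, h5⟩ := hmem l hl
            have := fibreWeight_mul_prod_le hc α h0 e₀ l (insert e₀ B) h5
            rwa [h4] at this
        _ = c * (∏ e ∈ insert e₀ B, α e v) * ∑ l ∈ Finset.univ.filter (fun l => κ l = (B, v)),
              (fibreWeight c (fun e : {e // e ∉ insert e₀ B} => l e) *
                ∏ e : {e // e ∉ insert e₀ B}, α e (l e)) := by rw [Finset.mul_sum]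
        _ ≤ c * (∏ e ∈ insert e₀ B, α e v) * (A * R) ^ (n - 1 - B.card) := by
            refine mul_le_mul_of_nonneg_left (le_trans ?_ ih')
              (mul_nonneg hc (Finset.prod_nonneg fun _ _ => h0 _ _))
            -- Within one class a labelling is determined by its restriction off the fibre, so the
            -- sum embeds into the sum over all labellings of the smaller set.
            let ρ : (E → V) → ({e // e ∉ insert e₀ B} → V) := fun l e => l e
            have hinj : Set.InjOn ρ
                (Finset.univ.filter (fun l => κ l = (B, v)) : Finset (E → V)) := by
              intro l hl l' hl' hll
              obtain ⟨h4, h5⟩ := hmem l hl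
              obtain ⟨h4', h5'⟩ := hmem l' hl'
              funext e
              by_cases he : e ∈ insert e₀ B
              · rw [(h5 e).1 he, (h5' e).1 he, h4, h4']
              · exact congrFun hll ⟨e, he⟩
            have := Finset.sum_image (g := ρ) (s := Finset.univ.filter (fun l => κ l = (B, v)))
              (f := fun l' => fibreWeight c l' * ∏ e : {e // e ∉ insert e₀ B}, α e (l' e))
              hinj
            rw [← this]
            exact Finset.sum_le_sum_of_subset_of_nonneg (Finset.subset_univ _) fun l' _ _ =>
              mul_nonneg (fibreWeight_nonneg hc _) (Finset.prod_nonneg fun _ _ => h0 _ _)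
  have hB : ∀ B ∈ S.powerset, ∑ v : V,
      ∑ l ∈ Finset.univ.filter (fun l => κ l = (B, v)), fibreWeight c l * ∏ e, α e (l e) ≤
        if B = ∅ then 0 else A ^ n * (c * y) * R ^ (n - 1 - B.card) := by
    intro B hB
    refine (Finset.sum_le_sum fun v _ => hterm B hB v).trans ?_
    split_ifs with hB0
    · simp
    · have hBS := Finset.mem_powerset.1 hB
      have he₀B : e₀ ∉ B := fun h => by simpa [hS] using hBS h
      have hBn : B.card ≤ n - 1 := hScard ▸ Finset.card_le_card hBS
      have hBp : 0 < B.card := Finset.card_pos.2 (Finset.nonempty_iff_ne_empty.2 hB0)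
      rw [← Finset.sum_mul, ← Finset.mul_sum]
      have h6 := sum_prod_le_pow_card hA α h0 h1 h2 (insert e₀ B)
        (by rw [Finset.card_insert_of_notMem he₀B]; omega)
      rw [Finset.card_insert_of_notMem he₀B] at h6
      calc _ ≤ c * (A ^ (B.card + 1) * y) * (A * R) ^ (n - 1 - B.card) := by gcongr
        _ = A ^ ((B.card + 1) + (n - 1 - B.card)) * (c * y) * R ^ (n - 1 - B.card) := by
            rw [mul_pow, pow_add]; ring
        _ = _ := by congr 3; omega
  refine (Finset.sum_le_sum hB).trans ?_
  -- The binomial theorem sums over `B`. The term `B = ∅`, where `e₀` would be a singleton, is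
  -- absent, hence the subtraction of `R ^ (n - 1)`.
  have hsum := Finset.sum_pow_mul_eq_add_pow 1 R S
  have h7 : ∑ B ∈ S.powerset, (if B = ∅ then 0 else A ^ n * (c * y) * R ^ (n - 1 - B.card)) =
      A ^ n * (c * y) * ((1 + R) ^ (n - 1) - R ^ (n - 1)) := by
    rw [← hScard, ← hsum, ← Finset.sum_erase_add _ _ (Finset.empty_mem_powerset S),
      ← Finset.sum_erase_add (f := fun t : Finset E => (1 : ℝ) ^ t.card * R ^ (S.card - t.card)) _
        (Finset.empty_mem_powerset S)]
    simp only [if_true, add_zero, Finset.card_empty, Nat.sub_zero, pow_zero, one_mul,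
      add_sub_cancel_right, one_pow, Finset.mul_sum]
    refine Finset.sum_congr rfl fun B hB => ?_
    rw [if_neg (Finset.ne_of_mem_erase hB)]
  rw [h7, mul_pow, mul_assoc]
  refine mul_le_mul_of_nonneg_left ?_ (by positivity)
  have h8 : (1 + R) ^ (n - 1) ≤ R ^ (n - 1) * Real.exp (p / R) := by
    have h9 : 1 + R ≤ R * Real.exp (1 / R) := by
      have := Real.add_one_le_exp (1 / R)
      calc 1 + R = R * (1 / R + 1) := by field_simp
        _ ≤ _ := by gcongr
    calc (1 + R) ^ (n - 1) ≤ (R * Real.exp (1 / R)) ^ (n - 1) := by gcongr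
      _ = R ^ (n - 1) * Real.exp ((n - 1 : ℕ) * (1 / R)) := by rw [mul_pow, Real.exp_nat_mul]
      _ ≤ _ := by
        gcongr
        rw [mul_one_div]
        gcongr
        exact le_trans (by exact_mod_cast Nat.sub_le n 1) hnp
  calc c * y * ((1 + R) ^ (n - 1) - R ^ (n - 1))
      ≤ c * y * (R ^ (n - 1) * Real.exp (p / R) - R ^ (n - 1)) := by gcongr
    _ = R ^ (n - 1) * (c * y * (Real.exp (p / R) - 1)) := by ring
    _ ≤ R ^ (n - 1) * R := by gcongr
    _ = R ^ n := by rw [← pow_succ]; congr 1; omega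

end SparseLocalLaw

/-! ### Moments of linear forms in independent centred variables -/

namespace SparseLocalLaw

/-- Independent centred random variables whose moments are bounded by `c * τ ^ k`. -/
structure CenteredFamily {Ω V : Type*} [MeasurableSpace Ω] (P : Measure Ω)
    (X : V → Ω → ℝ) (c τ : ℝ) : Prop where
  c_nonneg : 0 ≤ c
  τ_nonneg : 0 ≤ τ
  indep : iIndepFun X P
  measurable : ∀ v, Measurable (X v)
  integrable_pow : ∀ v (k : ℕ), Integrable (fun ω => X v ω ^ k) P
  mean : ∀ v, ∫ ω, X v ω ∂P = 0
  moment : ∀ v (k : ℕ), 2 ≤ k → |∫ ω, X v ω ^ k ∂P| ≤ c * τ ^ k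

theorem prod_abs_le_sum_abs_pow {E : Type*} [Fintype E] [Nonempty E] (x : E → ℝ) :
    ∏ e, |x e| ≤ ∑ e, |x e| ^ Fintype.card E := by
  obtain ⟨e, _, he⟩ := Finset.exists_max_image Finset.univ (fun e => |x e|) Finset.univ_nonempty
  calc ∏ e, |x e| ≤ ∏ _e' : E, |x e| :=
        Finset.prod_le_prod (fun _ _ => abs_nonneg _) (fun e' h => he e' h)
    _ = |x e| ^ Fintype.card E := by simp
    _ ≤ _ := Finset.single_le_sum (f := fun e => |x e| ^ Fintype.card E)
        (fun _ _ => by positivity) (Finset.mem_univ e)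

namespace CenteredFamily

variable {Ω V : Type*} [MeasurableSpace Ω] {P : Measure Ω} [IsProbabilityMeasure P]
  {X : V → Ω → ℝ} {c τ : ℝ}

theorem integrable_prod (h : CenteredFamily P X c τ) {E : Type*} [Fintype E] (l : E → V) :
    Integrable (fun ω => ∏ e, X (l e) ω) P := by
  rcases isEmpty_or_nonempty E with hE | hE
  · simp
  · have hi : Integrable (fun ω => ∑ e, |X (l e) ω| ^ Fintype.card E) P :=
      integrable_finsetSum _ fun e _ => by
        simpa [abs_pow] using (h.integrable_pow (l e) (Fintype.card E)).abs
    refine hi.mono' (Finset.measurable_fun_prod _ fun e _ => h.measurable _).aestronglyMeasurable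
      (ae_of_all _ fun ω => ?_)
    rw [Real.norm_eq_abs, Finset.abs_prod]
    exact prod_abs_le_sum_abs_pow _

/-- Grouping equal labels and using independence, the expectation factors over values. A value
attained once contributes a vanishing mean; one attained `d ≥ 2` times contributes at most `c * τ ^
d`, and the exponents `d` add up to the number of factors. -/
theorem abs_integral_prod_le [Fintype V] (h : CenteredFamily P X c τ) {E : Type*} [Fintype E]
    (l : E → V) :
    |∫ ω, ∏ e, X (l e) ω ∂P| ≤ τ ^ Fintype.card E * fibreWeight c l := by
  classical
  set d : V → ℕ := fun v => (Finset.univ.filter fun e => l e = v).card with hd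
  have h1 : ∀ ω, ∏ e, X (l e) ω = ∏ v, X v ω ^ d v := by
    intro ω
    rw [← Finset.prod_fiberwise' Finset.univ l (fun v => X v ω)]
    simp [hd]
  simp_rw [h1]
  have h2 : ∫ ω, ∏ v, X v ω ^ d v ∂P = ∏ v, ∫ ω, X v ω ^ d v ∂P :=
    h.indep.integral_fun_prod_comp (f := fun v x => x ^ d v)
      (fun v => (h.measurable v).aemeasurable) (fun v => by fun_prop)
  rw [h2, Finset.abs_prod]
  by_cases hl : NoSingleton l
  · have hle : ∀ v, |∫ ω, X v ω ^ d v ∂P| ≤ τ ^ d v * if v ∈ Finset.univ.image l then c else 1 := by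
      intro v
      split_ifs with hv
      · have h2 : 2 ≤ d v := by
          obtain ⟨e, _, rfl⟩ := Finset.mem_image.1 hv
          obtain ⟨e', he', hle⟩ := hl e
          exact Finset.one_lt_card.2 ⟨e, by simp, e', by simp [hle], he'.symm⟩
        rw [mul_comm]
        exact h.moment v _ h2
      · have : d v = 0 := by
          simp only [hd, Finset.card_eq_zero, Finset.filter_eq_empty_iff]
          intro e _ he
          exact hv (Finset.mem_image.2 ⟨e, Finset.mem_univ _, he⟩)
        simp [this]
    refine (Finset.prod_le_prod (fun _ _ => abs_nonneg _) fun v _ => hle v).trans (le_of_eq ?_)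
    rw [Finset.prod_mul_distrib, Finset.prod_pow_eq_pow_sum, Finset.prod_ite, fibreWeight,
      if_pos hl]
    congr 2
    · exact (Finset.card_eq_sum_card_fiberwise (f := l) (s := Finset.univ) (t := Finset.univ)
        (fun _ _ => Finset.mem_univ _)).symm
    · simp
  · have : ∃ v, d v = 1 := by
      unfold NoSingleton at hl
      push Not at hl
      obtain ⟨e, he⟩ := hl
      refine ⟨l e, Finset.card_eq_one.2 ⟨e, ?_⟩⟩
      ext e'
      simp only [Finset.mem_filter, Finset.mem_univ, true_and, Finset.mem_singleton]
      constructor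
      · intro h'
        by_contra hne
        exact he e' hne h'
      · rintro rfl; rfl
    obtain ⟨v, hv⟩ := this
    rw [Finset.prod_eq_zero (Finset.mem_univ v) (by rw [hv]; simp [h.mean v])]
    rw [fibreWeight, if_neg hl, mul_zero]

/-- The moment of a product of linear forms. -/
theorem norm_integral_prod_linear_le [Fintype V] (h : CenteredFamily P X c τ) {E : Type*}
    [Fintype E] {F : Type*} [Fintype F] (α : F → ℂ) (l : F → E → V) :
    Integrable (fun ω => ∑ κ, α κ * ∏ e, (X (l κ e) ω : ℂ)) P ∧
    ‖∫ ω, ∑ κ, α κ * ∏ e, (X (l κ e) ω : ℂ) ∂P‖ ≤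
      τ ^ Fintype.card E * ∑ κ, fibreWeight c (l κ) * ‖α κ‖ := by
  have hint : ∀ κ, Integrable (fun ω => α κ * ∏ e, (X (l κ e) ω : ℂ)) P := by
    intro κ
    have := (h.integrable_prod (l κ)).ofReal (𝕜 := ℂ)
    simpa using this.const_mul (α κ)
  refine ⟨integrable_finsetSum _ fun κ _ => hint κ, ?_⟩
  rw [integral_finsetSum _ fun κ _ => hint κ, Finset.mul_sum]
  refine norm_sum_le_of_le _ fun κ _ => ?_
  have : ∫ ω, α κ * ∏ e, (X (l κ e) ω : ℂ) ∂P = α κ * ((∫ ω, ∏ e, X (l κ e) ω ∂P : ℝ) : ℂ) := by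
    rw [integral_const_mul, ← integral_complex_ofReal]
    simp
  rw [this, norm_mul, Complex.norm_real, Real.norm_eq_abs]
  calc ‖α κ‖ * _ ≤ ‖α κ‖ * (τ ^ Fintype.card E * fibreWeight c (l κ)) := by
        gcongr
        exact h.abs_integral_prod_le _
    _ = _ := by ring

end CenteredFamily

theorem integrable_and_integral_le_of_ofReal {Ω : Type*} [MeasurableSpace Ω] {P : Measure Ω}
    {g : Ω → ℝ} {B : ℝ} (hi : Integrable (fun ω => (g ω : ℂ)) P)
    (hb : ‖∫ ω, (g ω : ℂ) ∂P‖ ≤ B) : Integrable g P ∧ ∫ ω, g ω ∂P ≤ B := by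
  refine ⟨hi.re, ?_⟩
  rw [integral_complex_ofReal, Complex.norm_real] at hb
  exact (le_abs_self _).trans hb

/-- The `2m`-th absolute moment as the integral of a product of `2m` factors. -/
theorem norm_pow_eq_prod (m : ℕ) (w : ℂ) :
    ((‖w‖ ^ (2 * m) : ℝ) : ℂ) =
      ∏ e : Fin m ⊕ Fin m, Sum.elim (fun _ => w) (fun _ => (starRingEnd ℂ) w) e := by
  rw [Fintype.prod_sum_type]
  simp only [Sum.elim_inl, Sum.elim_inr, Finset.prod_const, Finset.card_univ, Fintype.card_fin]
  rw [← mul_pow, Complex.mul_conj, Complex.normSq_eq_norm_sq]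
  push_cast
  ring

namespace CenteredFamily

variable {Ω V : Type*} [MeasurableSpace Ω] {P : Measure Ω} [IsProbabilityMeasure P]
  {X : V → Ω → ℝ} {c τ : ℝ}

/-- Moments of a linear form. -/
theorem integral_norm_pow_linear_le [Fintype V] (h : CenteredFamily P X c τ) {A y R : ℝ}
    (hA : 0 ≤ A) (hy : 0 ≤ y) (hR : 0 < R) (m : ℕ)
    (hxR : c * y * (Real.exp ((2 * m : ℕ) / R) - 1) ≤ R) (a : V → ℂ) (h1 : ∀ v, ‖a v‖ ≤ A)
    (h2 : ∑ v, ‖a v‖ ^ 2 ≤ A ^ 2 * y) :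
    Integrable (fun ω => ‖∑ v, a v * (X v ω : ℂ)‖ ^ (2 * m)) P ∧
    ∫ ω, ‖∑ v, a v * (X v ω : ℂ)‖ ^ (2 * m) ∂P ≤ (A * τ * R) ^ (2 * m) := by
  classical
  -- The two halves of the index set carry the coefficients and their conjugates, whose norms agree.
  set α : Fin m ⊕ Fin m → V → ℂ := Sum.elim (fun _ => a) (fun _ v => (starRingEnd ℂ) (a v)) with hα
  have hαn : ∀ e v, ‖α e v‖ = ‖a v‖ := by rintro (e | e) v <;> simp [hα]
  have hexp : ∀ ω, ((‖∑ v, a v * (X v ω : ℂ)‖ ^ (2 * m) : ℝ) : ℂ) =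
      ∑ l : Fin m ⊕ Fin m → V, (∏ e, α e (l e)) * ∏ e, (X (l e) ω : ℂ) := by
    intro ω
    rw [norm_pow_eq_prod]
    simp_rw [← Finset.prod_mul_distrib]
    rw [← Fintype.piFinset_univ, ← Finset.prod_univ_sum (fun _ => Finset.univ)
      (fun e v => α e v * (X v ω : ℂ))]
    refine Finset.prod_congr rfl fun e _ => ?_
    rcases e with e | e <;> simp [hα]
  obtain ⟨hi, hb⟩ := h.norm_integral_prod_linear_le
    (fun l : Fin m ⊕ Fin m → V => ∏ e, α e (l e)) id
  simp only [id] at hi hb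
  simp_rw [← hexp] at hi hb
  have hcard : Fintype.card (Fin m ⊕ Fin m) = 2 * m := by simp; ring
  obtain ⟨hi, hb⟩ := integrable_and_integral_le_of_ofReal hi hb
  refine ⟨hi, hb.trans ?_⟩
  have hs := sum_fibreWeight_mul_prod_le h.c_nonneg hA hy hR hxR (2 * m) (Fin m ⊕ Fin m)
    hcard le_rfl (fun e v => ‖α e v‖) (fun _ _ => norm_nonneg _)
    (fun e v => by rw [hαn]; exact h1 v) (fun e => by simp_rw [hαn]; exact h2)
  simp_rw [norm_prod]
  have := h.τ_nonneg
  rw [hcard, mul_right_comm, mul_pow, mul_comm]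
  exact mul_le_mul_of_nonneg_right hs (by positivity)

end CenteredFamily

end SparseLocalLaw

/-! ### Moments of off-diagonal quadratic forms -/

namespace SparseLocalLaw

/-- The free parameter `u` shifts weight between two label families; symmetrizing costs nothing
because `x + 1/x ≥ 2`. -/
theorem pow_add_le_mul_pow_add {c u : ℝ} (hc : 0 ≤ c) (hu : 0 < u) (i j : ℕ) :
    c ^ (i + j) ≤ ((c * u) ^ i * (c / u) ^ j + (c / u) ^ i * (c * u) ^ j) / 2 := by
  have h1 : (c * u) ^ i * (c / u) ^ j + (c / u) ^ i * (c * u) ^ j =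
      c ^ (i + j) * (u ^ i / u ^ j + u ^ j / u ^ i) := by
    rw [mul_pow, mul_pow, div_pow, div_pow, pow_add]
    ring
  have h2 : 2 ≤ u ^ i / u ^ j + u ^ j / u ^ i := by
    have hi : 0 < u ^ i := by positivity
    have hj : 0 < u ^ j := by positivity
    rw [div_add_div _ _ hj.ne' hi.ne', le_div_iff₀ (by positivity)]
    nlinarith [sq_nonneg (u ^ i - u ^ j)]
  rw [h1]
  have : 0 ≤ c ^ (i + j) := by positivity
  nlinarith

/-- For disjoint ranges the two labellings have no singletons separately and their numbers of values
add, so the weight splits. -/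
theorem fibreWeight_sumElim_le {E V : Type*} [Fintype E] {c u : ℝ} (hc : 0 ≤ c) (hu : 0 < u)
    (k l : E → V) (hkl : ∀ e e', k e ≠ l e') :
    fibreWeight c (Sum.elim k l) ≤
      (fibreWeight (c * u) k * fibreWeight (c / u) l +
        fibreWeight (c / u) k * fibreWeight (c * u) l) / 2 := by
  classical
  by_cases h : NoSingleton (Sum.elim k l)
  · have hk : NoSingleton k := by
      intro e
      obtain ⟨e' | e', h1, h2⟩ := h (Sum.inl e)
      · exact ⟨e', fun h => h1 (by rw [h]), h2⟩
      · exact absurd h2.symm (hkl e e')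
    have hl : NoSingleton l := by
      intro e
      obtain ⟨e' | e', h1, h2⟩ := h (Sum.inr e)
      · exact absurd h2 (hkl e' e)
      · exact ⟨e', fun h => h1 (by rw [h]), h2⟩
    have hcard : (Finset.univ.image (Sum.elim k l)).card =
        (Finset.univ.image k).card + (Finset.univ.image l).card := by
      rw [← Finset.card_union_of_disjoint]
      · congr 1
        ext v
        simp
      · rw [Finset.disjoint_left]
        intro v h1 h2
        obtain ⟨e, _, rfl⟩ := Finset.mem_image.1 h1
        obtain ⟨e', _, h3⟩ := Finset.mem_image.1 h2
        exact hkl e e' h3.symm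
    unfold fibreWeight
    rw [if_pos h, if_pos hk, if_pos hl, if_pos hk, if_pos hl, hcard]
    exact pow_add_le_mul_pow_add hc hu _ _
  · have : fibreWeight c (Sum.elim k l) = 0 := by unfold fibreWeight; rw [if_neg h]
    rw [this]
    have h1 : 0 ≤ c * u := by positivity
    have h2 : 0 ≤ c / u := by positivity
    have := fibreWeight_nonneg h1 k
    have := fibreWeight_nonneg h1 l
    have := fibreWeight_nonneg h2 k
    have := fibreWeight_nonneg h2 l
    positivity

/-- The inner sum over `l` has weight `c / u` and `ℓ²` gain `|V| * u ^ 2`; the outer sum over `k`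
has weight `c * u` and no gain, so `y = |V|`. The split is chosen so that both sums impose the same
condition, with `c * |V| * u`. -/
theorem sum_fibreWeight_mul_fibreWeight_mul_prod_le {V : Type*} [Fintype V] {E : Type} [Fintype E]
    [DecidableEq E] {c A u R : ℝ} (hc : 0 ≤ c) (hA : 0 ≤ A) (hu : 0 < u) (hR : 0 < R)
    (hxR : c * Fintype.card V * u * (Real.exp (Fintype.card E / R) - 1) ≤ R)
    (b : V → V → ℝ) (h0 : ∀ k l, 0 ≤ b k l) (h1 : ∀ k l, b k l ≤ A)
    (h2 : ∀ k, ∑ l, b k l ^ 2 ≤ A ^ 2 * (Fintype.card V * u ^ 2)) :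
    ∑ k : E → V, ∑ l : E → V, fibreWeight (c * u) k * fibreWeight (c / u) l * ∏ e, b (k e) (l e) ≤
      (A * R ^ 2) ^ Fintype.card E := by
  classical
  have hinner : ∀ k : E → V, ∑ l : E → V, fibreWeight (c / u) l * ∏ e, b (k e) (l e) ≤
      (A * R) ^ Fintype.card E := by
    intro k
    refine sum_fibreWeight_mul_prod_le (c := c / u) (A := A) (y := Fintype.card V * u ^ 2)
      (R := R) (p := Fintype.card E) (by positivity) hA (by positivity) hR ?_ _ E rfl le_rfl
      (fun e l => b (k e) l) (fun _ _ => h0 _ _) (fun _ _ => h1 _ _) (fun e => h2 _)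
    convert hxR using 2
    field_simp
  have houter : ∑ k : E → V, fibreWeight (c * u) k ≤ R ^ Fintype.card E := by
    have := sum_fibreWeight_mul_prod_le (V := V) (c := c * u) (A := 1) (y := Fintype.card V)
      (R := R) (p := Fintype.card E) (by positivity) zero_le_one (by positivity) hR
      (by convert hxR using 2; ring) _ E rfl le_rfl (fun _ _ => 1) (fun _ _ => zero_le_one)
      (fun _ _ => le_rfl) (fun e => by simp)
    simpa using this
  calc _ = ∑ k : E → V, fibreWeight (c * u) k *
        ∑ l : E → V, fibreWeight (c / u) l * ∏ e, b (k e) (l e) := by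
        simp_rw [Finset.mul_sum, mul_assoc]
    _ ≤ ∑ k : E → V, fibreWeight (c * u) k * (A * R) ^ Fintype.card E :=
        Finset.sum_le_sum fun k _ => mul_le_mul_of_nonneg_left (hinner k)
          (fibreWeight_nonneg (by positivity) _)
    _ = (∑ k : E → V, fibreWeight (c * u) k) * (A * R) ^ Fintype.card E := by
        rw [Finset.sum_mul]
    _ ≤ R ^ Fintype.card E * (A * R) ^ Fintype.card E := by gcongr
    _ = _ := by rw [← mul_pow]; congr 1; ring

namespace CenteredFamily

variable {Ω V : Type*} [MeasurableSpace Ω] {P : Measure Ω} [IsProbabilityMeasure P]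
  {X : V → Ω → ℝ} {c τ : ℝ}

/-- Moments of a quadratic form without interaction inside `I` and inside its complement. -/
theorem integral_norm_pow_bipartite_le [Fintype V] (h : CenteredFamily P X c τ) {A u R : ℝ}
    (hA : 0 ≤ A) (hu : 0 < u) (hR : 0 < R) (m : ℕ)
    (hxR : c * Fintype.card V * u * (Real.exp ((2 * m : ℕ) / R) - 1) ≤ R) (a : V → V → ℂ)
    (I : Set V) (hI : ∀ k l, a k l ≠ 0 → k ∈ I ∧ l ∉ I) (h1 : ∀ k l, ‖a k l‖ ≤ A)
    (h2 : ∀ k, ∑ l, ‖a k l‖ ^ 2 ≤ A ^ 2 * (Fintype.card V * u ^ 2))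
    (h3 : ∀ l, ∑ k, ‖a k l‖ ^ 2 ≤ A ^ 2 * (Fintype.card V * u ^ 2)) :
    Integrable (fun ω => ‖∑ k, ∑ l, a k l * X k ω * X l ω‖ ^ (2 * m)) P ∧
    ∫ ω, ‖∑ k, ∑ l, a k l * X k ω * X l ω‖ ^ (2 * m) ∂P ≤ (A * τ ^ 2 * R ^ 2) ^ (2 * m) := by
  classical
  set α : Fin m ⊕ Fin m → V × V → ℂ :=
    Sum.elim (fun _ p => a p.1 p.2) (fun _ p => (starRingEnd ℂ) (a p.1 p.2)) with hα
  have hαn : ∀ e p, ‖α e p‖ = ‖a p.1 p.2‖ := by rintro (e | e) p <;> simp [hα]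
  set L : (Fin m ⊕ Fin m → V × V) → ((Fin m ⊕ Fin m) ⊕ (Fin m ⊕ Fin m)) → V :=
    fun κ => Sum.elim (fun e => (κ e).1) (fun e => (κ e).2) with hL
  have hexp : ∀ ω, ((‖∑ k, ∑ l, a k l * X k ω * X l ω‖ ^ (2 * m) : ℝ) : ℂ) =
      ∑ κ : Fin m ⊕ Fin m → V × V, (∏ e, α e (κ e)) * ∏ e, (X (L κ e) ω : ℂ) := by
    intro ω
    rw [norm_pow_eq_prod]
    have h4 : ∀ κ : Fin m ⊕ Fin m → V × V, (∏ e, α e (κ e)) * ∏ e, (X (L κ e) ω : ℂ) =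
        ∏ e, (α e (κ e) * X (κ e).1 ω * X (κ e).2 ω) := by
      intro κ
      rw [Fintype.prod_sum_type (fun e => (X (L κ e) ω : ℂ)), Finset.prod_mul_distrib,
        Finset.prod_mul_distrib]
      simp only [hL, Sum.elim_inl, Sum.elim_inr]
      ring
    simp_rw [h4]
    rw [← Fintype.piFinset_univ, ← Finset.prod_univ_sum (fun _ => Finset.univ)
      (fun e (p : V × V) => α e p * X p.1 ω * X p.2 ω)]
    refine Finset.prod_congr rfl fun e _ => ?_
    rw [Fintype.sum_prod_type]
    rcases e with e | e <;> simp [hα]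
  obtain ⟨hi, hb⟩ := h.norm_integral_prod_linear_le
    (fun κ : Fin m ⊕ Fin m → V × V => ∏ e, α e (κ e)) L
  simp_rw [← hexp] at hi hb
  have hcard : Fintype.card (Fin m ⊕ Fin m) = 2 * m := by simp; ring
  obtain ⟨hi, hb⟩ := integrable_and_integral_le_of_ofReal hi hb
  refine ⟨hi, hb.trans ?_⟩
  have hc := h.c_nonneg
  have hτ := h.τ_nonneg
  set S₁ := ∑ k : Fin m ⊕ Fin m → V, ∑ l : Fin m ⊕ Fin m → V,
    fibreWeight (c * u) k * fibreWeight (c / u) l * ∏ e, ‖a (k e) (l e)‖ with hS₁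
  set S₂ := ∑ k : Fin m ⊕ Fin m → V, ∑ l : Fin m ⊕ Fin m → V,
    fibreWeight (c / u) k * fibreWeight (c * u) l * ∏ e, ‖a (k e) (l e)‖ with hS₂
  have hxR' : c * Fintype.card V * u * (Real.exp ((Fintype.card (Fin m ⊕ Fin m) : ℕ) / R) - 1) ≤ R := by
    rwa [hcard]
  have hS₁le : S₁ ≤ (A * R ^ 2) ^ (2 * m) := by
    have := sum_fibreWeight_mul_fibreWeight_mul_prod_le (E := Fin m ⊕ Fin m) hc hA hu hR hxR'
      (fun k l => ‖a k l‖) (fun _ _ => norm_nonneg _) h1 h2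
    rwa [hcard] at this
  have hS₂le : S₂ ≤ (A * R ^ 2) ^ (2 * m) := by
    have := sum_fibreWeight_mul_fibreWeight_mul_prod_le (E := Fin m ⊕ Fin m) hc hA hu hR hxR'
      (fun k l => ‖a l k‖) (fun _ _ => norm_nonneg _) (fun _ _ => h1 _ _) h3
    rw [hcard, Finset.sum_comm] at this
    refine le_trans (le_of_eq ?_) this
    refine Finset.sum_congr rfl fun k _ => Finset.sum_congr rfl fun l _ => by ring
  have hsum : ∑ κ, fibreWeight c (L κ) * ‖∏ e, α e (κ e)‖ ≤ (S₁ + S₂) / 2 := by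
    have hS : (S₁ + S₂) / 2 = ∑ κ : Fin m ⊕ Fin m → V × V,
        (fibreWeight (c * u) (fun e => (κ e).1) * fibreWeight (c / u) (fun e => (κ e).2) +
          fibreWeight (c / u) (fun e => (κ e).1) * fibreWeight (c * u) (fun e => (κ e).2)) / 2 *
        ∏ e, ‖a (κ e).1 (κ e).2‖ := by
      rw [hS₁, hS₂, ← Fintype.sum_prod_type', ← Fintype.sum_prod_type', ← Finset.sum_add_distrib,
        Finset.sum_div]
      refine Fintype.sum_equiv (Equiv.arrowProdEquivProdArrow _ _ _).symm _ _ fun p => ?_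
      simp only [Equiv.arrowProdEquivProdArrow, Equiv.coe_fn_symm_mk]
      ring
    rw [hS]
    refine Finset.sum_le_sum fun κ _ => ?_
    rw [norm_prod]
    simp_rw [hαn]
    by_cases hz : ∃ e, a (κ e).1 (κ e).2 = 0
    · obtain ⟨e, he⟩ := hz
      rw [Finset.prod_eq_zero (Finset.mem_univ e) (by rw [he, norm_zero])]
      simp
    · push Not at hz
      -- When no coefficient vanishes, all first indices lie in `I` and all second ones outside, so
      -- the two ranges are disjoint.
      refine mul_le_mul_of_nonneg_right (fibreWeight_sumElim_le hc hu _ _ fun e e' heq => ?_)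
        (Finset.prod_nonneg fun _ _ => norm_nonneg _)
      exact (hI _ _ (hz e')).2 (heq ▸ (hI _ _ (hz e)).1)
  have hcard' : Fintype.card ((Fin m ⊕ Fin m) ⊕ (Fin m ⊕ Fin m)) = 2 * (2 * m) := by
    rw [Fintype.card_sum, hcard]; ring
  rw [hcard', pow_mul]
  calc (τ ^ 2) ^ (2 * m) * _ ≤ (τ ^ 2) ^ (2 * m) * (A * R ^ 2) ^ (2 * m) := by
        gcongr
        exact hsum.trans (by linarith)
    _ = _ := by rw [← mul_pow]; congr 1; ring

end CenteredFamily

/-- Decoupling: the off-diagonal quadratic form is four times an average of bipartite ones. -/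
theorem sum_sum_bool_decoupling {V : Type*} [Fintype V] [DecidableEq V] (b : V → V → ℂ)
    (hb : ∀ k, b k k = 0) :
    ∑ σ : V → Bool, ∑ k, ∑ l, (if σ k = true ∧ σ l = false then b k l else 0) * 4 =
      2 ^ Fintype.card V * ∑ k, ∑ l, b k l := by
  have key : ∀ k l, k ≠ l →
      ∑ σ : V → Bool, (if σ k = true ∧ σ l = false then (4 : ℂ) else 0) = 2 ^ Fintype.card V := by
    intro k l hkl
    -- The indicator, multiplied by `4`, is a product over vertices whose local sums are all `2`: a
    -- uniformly random `σ` separates a pair in the given direction with probability `1/4`.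
    set f : V → Bool → ℂ := fun v β =>
      if v = k then (if β = true then 2 else 0) else if v = l then (if β = false then 2 else 0) else 1
      with hf
    have h1 : ∀ σ : V → Bool, (if σ k = true ∧ σ l = false then (4 : ℂ) else 0) = ∏ v, f v (σ v) := by
      intro σ
      rw [← Finset.mul_prod_erase _ _ (Finset.mem_univ k),
        ← Finset.mul_prod_erase _ _ (Finset.mem_erase.2 ⟨hkl.symm, Finset.mem_univ l⟩),
        Finset.prod_eq_one]
      · simp only [hf, if_true, if_neg hkl.symm, mul_one]
        cases σ k <;> cases σ l <;> norm_num
      · intro v hv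
        simp only [Finset.mem_erase, Finset.mem_univ, and_true] at hv
        simp [hf, hv.1, hv.2]
    simp_rw [h1]
    rw [← Fintype.piFinset_univ, ← Finset.prod_univ_sum (fun _ => Finset.univ) f]
    have h2 : ∀ v, ∑ β, f v β = 2 := by
      intro v
      simp only [hf, Fintype.sum_bool]
      split_ifs <;> (simp_all; try norm_num)
    rw [Finset.prod_congr rfl fun v _ => h2 v]
    simp
  rw [Finset.sum_comm, Finset.mul_sum]
  refine Finset.sum_congr rfl fun k _ => ?_
  rw [Finset.sum_comm, Finset.mul_sum]
  refine Finset.sum_congr rfl fun l _ => ?_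
  by_cases hkl : k = l
  · subst hkl
    simp [hb]
  · rw [← key k l hkl, Finset.sum_mul]
    refine Finset.sum_congr rfl fun σ _ => ?_
    split_ifs <;> ring

namespace CenteredFamily

variable {Ω V : Type*} [MeasurableSpace Ω] {P : Measure Ω} [IsProbabilityMeasure P]
  {X : V → Ω → ℝ} {c τ : ℝ}

/-- Moments of an off-diagonal quadratic form. -/
theorem integral_norm_pow_quadratic_le [Fintype V] (h : CenteredFamily P X c τ) {A u R : ℝ}
    (hA : 0 ≤ A) (hu : 0 < u) (hR : 0 < R) {m : ℕ} (hm : 0 < m)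
    (hxR : c * Fintype.card V * u * (Real.exp ((2 * m : ℕ) / R) - 1) ≤ R) (a : V → V → ℂ)
    (h0 : ∀ k, a k k = 0) (h1 : ∀ k l, ‖a k l‖ ≤ A)
    (h2 : ∀ k, ∑ l, ‖a k l‖ ^ 2 ≤ A ^ 2 * (Fintype.card V * u ^ 2))
    (h3 : ∀ l, ∑ k, ‖a k l‖ ^ 2 ≤ A ^ 2 * (Fintype.card V * u ^ 2)) :
    Integrable (fun ω => ‖∑ k, ∑ l, a k l * X k ω * X l ω‖ ^ (2 * m)) P ∧
    ∫ ω, ‖∑ k, ∑ l, a k l * X k ω * X l ω‖ ^ (2 * m) ∂P ≤ (4 * A * τ ^ 2 * R ^ 2) ^ (2 * m) := by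
  classical
  set aσ : (V → Bool) → V → V → ℂ := fun σ k l => if σ k = true ∧ σ l = false then a k l else 0
    with haσ
  have hle : ∀ σ k l, ‖aσ σ k l‖ ≤ ‖a k l‖ := by
    intro σ k l
    simp only [haσ]
    split_ifs <;> simp
  have hσ : ∀ σ, _ := fun σ => h.integral_norm_pow_bipartite_le hA hu hR m hxR (aσ σ)
    {v | σ v = true} (fun k l hne => by
      simp only [haσ, ne_eq, ite_eq_right_iff, Classical.not_imp] at hne
      simp [hne.1.1, hne.1.2]) (fun k l => (hle σ k l).trans (h1 k l))
    (fun k => (Finset.sum_le_sum fun l _ => by gcongr; exact hle σ k l).trans (h2 k))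
    (fun l => (Finset.sum_le_sum fun k _ => by gcongr; exact hle σ k l).trans (h3 l))
  set Q : (V → Bool) → Ω → ℂ := fun σ ω => ∑ k, ∑ l, aσ σ k l * X k ω * X l ω with hQ
  have hcard : ((Finset.univ : Finset (V → Bool)).card : ℝ) = 2 ^ Fintype.card V := by simp
  have hpt : ∀ ω, ‖∑ k, ∑ l, a k l * X k ω * X l ω‖ ^ (2 * m) ≤
      4 ^ (2 * m) * ((∑ σ, ‖Q σ ω‖ ^ (2 * m)) / 2 ^ Fintype.card V) := by
    intro ω
    have hd := sum_sum_bool_decoupling (fun k l => a k l * X k ω * X l ω) (fun k => by simp [h0])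
    have hd' : ∑ σ : V → Bool, Q σ ω * 4 =
        2 ^ Fintype.card V * ∑ k, ∑ l, a k l * X k ω * X l ω := by
      rw [← hd]
      refine Finset.sum_congr rfl fun σ _ => ?_
      simp only [hQ, haσ, Finset.sum_mul]
      refine Finset.sum_congr rfl fun k _ => Finset.sum_congr rfl fun l _ => ?_
      split_ifs <;> ring
    have hnorm : 2 ^ Fintype.card V * ‖∑ k, ∑ l, a k l * X k ω * X l ω‖ ≤ 4 * ∑ σ, ‖Q σ ω‖ := by
      have := congrArg norm hd'
      rw [norm_mul, norm_pow, Complex.norm_ofNat] at this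
      rw [← this, ← Finset.sum_mul, norm_mul, Complex.norm_ofNat, mul_comm]
      gcongr
      exact norm_sum_le _ _
    -- Jensen's inequality moves the power inside the average over `σ`, at the sole cost of the
    -- factor `4 ^ (2 * m)`.
    have hjensen := pow_sum_div_card_le_sum_pow (s := (Finset.univ : Finset (V → Bool)))
      (f := fun σ => ‖Q σ ω‖) (fun _ _ => norm_nonneg _) (2 * m - 1)
    rw [Nat.sub_add_cancel (by omega), hcard] at hjensen
    set K : ℝ := 2 ^ Fintype.card V with hK
    have hKpos : 0 < K := by positivity
    have h5 : ‖∑ k, ∑ l, a k l * X k ω * X l ω‖ ≤ 4 * (∑ σ, ‖Q σ ω‖) / K := by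
      rw [le_div_iff₀ hKpos]; linarith
    calc _ ≤ (4 * (∑ σ, ‖Q σ ω‖) / K) ^ (2 * m) := by gcongr
      _ = 4 ^ (2 * m) * ((∑ σ, ‖Q σ ω‖) ^ (2 * m) / K ^ (2 * m - 1) / K) := by
          rw [div_pow, mul_pow, div_div, ← pow_succ, Nat.sub_add_cancel (by omega), mul_div_assoc]
      _ ≤ _ := by gcongr
  have hint : Integrable (fun ω => 4 ^ (2 * m) * ((∑ σ, ‖Q σ ω‖ ^ (2 * m)) / 2 ^ Fintype.card V)) P :=
    ((integrable_finsetSum _ fun σ _ => (hσ σ).1).div_const _).const_mul _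
  have hmeas : Measurable fun ω => ‖∑ k, ∑ l, a k l * X k ω * X l ω‖ ^ (2 * m) := by
    have := h.measurable
    fun_prop
  have hint' : Integrable (fun ω => ‖∑ k, ∑ l, a k l * X k ω * X l ω‖ ^ (2 * m)) P :=
    hint.mono' hmeas.aestronglyMeasurable (ae_of_all _ fun ω => by
      rw [Real.norm_of_nonneg (by positivity)]
      exact hpt ω)
  refine ⟨hint', (integral_mono hint' hint hpt).trans ?_⟩
  rw [integral_const_mul, integral_div, integral_finsetSum _ fun σ _ => (hσ σ).1]
  calc _ ≤ (4 : ℝ) ^ (2 * m) *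
        ((∑ _σ : V → Bool, (A * τ ^ 2 * R ^ 2) ^ (2 * m)) / 2 ^ Fintype.card V) := by
        gcongr with σ
        exact (hσ σ).2
    _ = _ := by
        rw [Finset.sum_const, nsmul_eq_mul, hcard, mul_div_cancel_left₀ _ (by positivity),
          ← mul_pow]
        congr 1; ring

end CenteredFamily

end SparseLocalLaw

/-! ### Resolvent identities and minors -/

namespace SparseLocalLaw

variable {N : ℕ}

/-- The matrix `A - z`. -/
def shifted (A : Matrix (Fin N) (Fin N) ℝ) (z : ℂ) : Matrix (Fin N) (Fin N) ℂ :=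
  A.map (fun x : ℝ => (x : ℂ)) - z • (1 : Matrix (Fin N) (Fin N) ℂ)

theorem green_eq (A : Matrix (Fin N) (Fin N) ℝ) (z : ℂ) : green A z = (shifted A z)⁻¹ := rfl

theorem shifted_transpose {A : Matrix (Fin N) (Fin N) ℝ} (hA : A.IsSymm) (z : ℂ) :
    (shifted A z).transpose = shifted A z := by
  ext i j
  simp [shifted, Matrix.one_apply, hA.apply, eq_comm]

theorem shifted_conjTranspose {A : Matrix (Fin N) (Fin N) ℝ} (hA : A.IsSymm) (z : ℂ) :
    (shifted A z).conjTranspose = shifted A ((starRingEnd ℂ) z) := by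
  ext i j
  simp [shifted, Matrix.one_apply, hA.apply, eq_comm, apply_ite (starRingEnd ℂ)]

/-- A kernel vector would be an eigenvector of a Hermitian matrix with non-real eigenvalue `z`. -/
theorem isUnit_det_shifted {A : Matrix (Fin N) (Fin N) ℝ} (hA : A.IsSymm) {z : ℂ}
    (hz : z.im ≠ 0) : IsUnit (shifted A z).det := by
  rw [isUnit_iff_ne_zero]
  intro hdet
  obtain ⟨v, hv, hMv⟩ := Matrix.exists_mulVec_eq_zero_iff.2 hdet
  have hH : (A.map (fun x : ℝ => (x : ℂ))).IsHermitian := by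
    ext i j
    simp [hA.apply]
  have h1 := hH.im_star_dotProduct_mulVec_self v
  have h2 : (A.map (fun x : ℝ => (x : ℂ))).mulVec v = z • v := by
    rw [shifted, Matrix.sub_mulVec, Matrix.smul_mulVec, Matrix.one_mulVec, sub_eq_zero] at hMv
    exact hMv
  rw [h2, dotProduct_smul] at h1
  have h3 : star v ⬝ᵥ v = ((∑ i, ‖v i‖ ^ 2 : ℝ) : ℂ) := by
    simp [dotProduct, Complex.conj_mul']
  rw [h3] at h1
  simp only [smul_eq_mul, RCLike.im_to_complex, Complex.im_mul_ofReal, mul_eq_zero, hz,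
    false_or] at h1
  apply hv
  funext i
  have := (Finset.sum_eq_zero_iff_of_nonneg (fun i _ => by positivity)).1 h1 i (Finset.mem_univ i)
  simpa using this

theorem green_mul_shifted {A : Matrix (Fin N) (Fin N) ℝ} (hA : A.IsSymm) {z : ℂ}
    (hz : z.im ≠ 0) : green A z * shifted A z = 1 :=
  Matrix.nonsing_inv_mul _ (isUnit_det_shifted hA hz)

theorem shifted_mul_green {A : Matrix (Fin N) (Fin N) ℝ} (hA : A.IsSymm) {z : ℂ}
    (hz : z.im ≠ 0) : shifted A z * green A z = 1 :=
  Matrix.mul_nonsing_inv _ (isUnit_det_shifted hA hz)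

theorem green_symm {A : Matrix (Fin N) (Fin N) ℝ} (hA : A.IsSymm) (z : ℂ) (i j : Fin N) :
    green A z i j = green A z j i := by
  have : (green A z).transpose = green A z := by
    rw [green_eq, Matrix.transpose_nonsing_inv, shifted_transpose hA]
  conv_lhs => rw [← this]
  rfl

theorem green_sub_green {A : Matrix (Fin N) (Fin N) ℝ} (hA : A.IsSymm) {z w : ℂ}
    (hz : z.im ≠ 0) (hw : w.im ≠ 0) :
    green A z - green A w = (z - w) • (green A z * green A w) := by
  have h : shifted A w - shifted A z = (z - w) • (1 : Matrix (Fin N) (Fin N) ℂ) := by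
    simp only [shifted, sub_smul]
    abel
  calc green A z - green A w = green A z * (shifted A w - shifted A z) * green A w := by
        rw [mul_sub, sub_mul, green_mul_shifted hA hz, mul_assoc, shifted_mul_green hA hw]
        simp
    _ = _ := by rw [h]; simp

theorem conj_green {A : Matrix (Fin N) (Fin N) ℝ} (hA : A.IsSymm) (z : ℂ) (i j : Fin N) :
    (starRingEnd ℂ) (green A z i j) = green A ((starRingEnd ℂ) z) j i := by
  have : (green A z).conjTranspose = green A ((starRingEnd ℂ) z) := by
    rw [green_eq, Matrix.conjTranspose_nonsing_inv, shifted_conjTranspose hA, green_eq]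
  rw [← this]
  rfl

/-- The Ward identity. -/
theorem sum_norm_green_sq {A : Matrix (Fin N) (Fin N) ℝ} (hA : A.IsSymm) {z : ℂ}
    (hz : 0 < z.im) (k : Fin N) :
    ∑ l, ‖green A z k l‖ ^ 2 = (green A z k k).im / z.im := by
  have hz' : ((starRingEnd ℂ) z).im ≠ 0 := by simpa using hz.ne'
  have h := congrFun (congrFun (green_sub_green hA hz.ne' hz') k) k
  rw [Matrix.sub_apply, Matrix.smul_apply, ← conj_green hA, Matrix.mul_apply] at h
  simp_rw [← conj_green hA, Complex.mul_conj, Complex.normSq_eq_norm_sq] at h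
  rw [← Complex.ofReal_sum, smul_eq_mul] at h
  have h2 := congrArg Complex.im h
  rw [Complex.im_mul_ofReal] at h2
  simp only [Complex.sub_im, Complex.conj_im] at h2
  field_simp
  linarith

/-- The Ward identity gives `|G k k|² ≤ |G k k| / Im z`, which settles the diagonal; one more use of
it bounds the whole row. -/
theorem norm_green_le_inv {A : Matrix (Fin N) (Fin N) ℝ} (hA : A.IsSymm) {z : ℂ}
    (hz : 0 < z.im) (k l : Fin N) : ‖green A z k l‖ ≤ 1 / z.im := by
  have hd : ∀ k, ‖green A z k k‖ ≤ 1 / z.im := by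
    intro k
    have h1 : ‖green A z k k‖ ^ 2 ≤ ‖green A z k k‖ / z.im :=
      calc ‖green A z k k‖ ^ 2 ≤ ∑ l, ‖green A z k l‖ ^ 2 :=
            Finset.single_le_sum (f := fun l => ‖green A z k l‖ ^ 2)
              (fun _ _ => by positivity) (Finset.mem_univ k)
        _ = _ := sum_norm_green_sq hA hz k
        _ ≤ _ := by gcongr; exact (le_abs_self _).trans (Complex.abs_im_le_norm _)
    by_contra! hlt
    have hpos : 0 < ‖green A z k k‖ := lt_trans (by positivity) hlt
    have : ‖green A z k k‖ ≤ 1 / z.im := by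
      rw [le_div_iff₀ hz] at *
      rw [sq] at h1
      nlinarith
    exact absurd this (not_le.2 hlt)
  have h2 : ‖green A z k l‖ ^ 2 ≤ (1 / z.im) ^ 2 :=
    calc ‖green A z k l‖ ^ 2 ≤ ∑ l, ‖green A z k l‖ ^ 2 :=
          Finset.single_le_sum (f := fun l => ‖green A z k l‖ ^ 2)
            (fun _ _ => by positivity) (Finset.mem_univ l)
      _ = _ := sum_norm_green_sq hA hz k
      _ ≤ (1 / z.im) / z.im := by
          gcongr
          exact ((le_abs_self _).trans (Complex.abs_im_le_norm _)).trans (hd k)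
      _ = _ := by ring
  exact le_of_sq_le_sq h2 (by positivity)

theorem sum_norm_green_sq_le {A : Matrix (Fin N) (Fin N) ℝ} (hA : A.IsSymm) {z : ℂ}
    (hz : 0 < z.im) (k : Fin N) :
    ∑ l, ‖green A z k l‖ ^ 2 ≤ ‖green A z k k‖ / z.im := by
  rw [sum_norm_green_sq hA hz]
  gcongr
  exact (le_abs_self _).trans (Complex.abs_im_le_norm _)

/-- Resolvent identity, then Cauchy–Schwarz with rows of `ℓ²` norm at most `1 / η`. -/
theorem norm_green_sub_green_le {A : Matrix (Fin N) (Fin N) ℝ} (hA : A.IsSymm) {z w : ℂ} {η : ℝ}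
    (hη : 0 < η) (hz : η ≤ z.im) (hw : η ≤ w.im) (k l : Fin N) :
    ‖green A z k l - green A w k l‖ ≤ ‖z - w‖ / η ^ 2 := by
  have hz0 : 0 < z.im := hη.trans_le hz
  have hw0 : 0 < w.im := hη.trans_le hw
  have hsq : ∀ {u : ℂ}, η ≤ u.im → ∀ k, ∑ l, ‖green A u k l‖ ^ 2 ≤ (1 / η) ^ 2 := by
    intro u hu k
    have hu0 : 0 < u.im := hη.trans_le hu
    calc _ ≤ ‖green A u k k‖ / u.im := sum_norm_green_sq_le hA hu0 k
      _ ≤ (1 / u.im) / u.im := by gcongr; exact norm_green_le_inv hA hu0 k k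
      _ = (1 / u.im) ^ 2 := by ring
      _ ≤ _ := by gcongr
  have h := congrFun (congrFun (green_sub_green hA hz0.ne' hw0.ne') k) l
  rw [Matrix.sub_apply, Matrix.smul_apply, Matrix.mul_apply] at h
  rw [h, norm_smul, div_eq_mul_one_div]
  gcongr
  have hcs := Finset.sum_mul_sq_le_sq_mul_sq Finset.univ (fun j => ‖green A z k j‖)
    (fun j => ‖green A w j l‖)
  have h2 : ∑ j, ‖green A w j l‖ ^ 2 ≤ (1 / η) ^ 2 := by
    simp_rw [green_symm hA w _ l]
    exact hsq hw l
  calc _ ≤ ∑ j, ‖green A z k j‖ * ‖green A w j l‖ := by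
        refine norm_sum_le_of_le _ fun j _ => (norm_mul _ _).le
    _ ≤ 1 / η ^ 2 := by
      refine le_of_sq_le_sq (hcs.trans ?_) (by positivity)
      calc _ ≤ (1 / η) ^ 2 * (1 / η) ^ 2 := by
            gcongr
            exact hsq hz k
        _ = _ := by ring

/-- The matrix `A` with row and column `i` set to zero. -/
def minor (i : Fin N) (A : Matrix (Fin N) (Fin N) ℝ) : Matrix (Fin N) (Fin N) ℝ :=
  fun k l => if k = i ∨ l = i then 0 else A k l

theorem minor_isSymm {A : Matrix (Fin N) (Fin N) ℝ} (hA : A.IsSymm) (i : Fin N) :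
    (minor i A).IsSymm := by
  ext k l
  simp only [Matrix.transpose_apply, minor, or_comm, hA.apply]

/-- The Green function of the minor, with row and column `i` set to zero. -/
def greenMinor (i : Fin N) (A : Matrix (Fin N) (Fin N) ℝ) (z : ℂ) : Fin N → Fin N → ℂ :=
  fun k l => if k = i ∨ l = i then 0 else green (minor i A) z k l

theorem greenMinor_symm {A : Matrix (Fin N) (Fin N) ℝ} (hA : A.IsSymm) (i : Fin N) (z : ℂ)
    (k l : Fin N) : greenMinor i A z k l = greenMinor i A z l k := by
  simp only [greenMinor, or_comm, green_symm (minor_isSymm hA i) z k l]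

/-- Zeroing row and column `i` without deleting them decouples that coordinate, so the minor keeps
its size and no reindexing is needed. -/
theorem green_minor_apply_self {A : Matrix (Fin N) (Fin N) ℝ} (hA : A.IsSymm) {z : ℂ}
    (hz : 0 < z.im) {i k : Fin N} (hk : k ≠ i) : green (minor i A) z k i = 0 := by
  have h := congrFun (congrFun (green_mul_shifted (minor_isSymm hA i) hz.ne') k) i
  rw [Matrix.mul_apply, Finset.sum_eq_single i] at h
  · rw [Matrix.one_apply_ne hk] at h
    have hz0 : z ≠ 0 := fun h => by simp [h] at hz
    simpa [shifted, minor, hz0] using h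
  · intro j _ hj
    simp [shifted, minor, hj]
  · simp

/-- Resolvent expansion of `A` around its minor: for `k ≠ i`, row `k` of `G₀ * (A - minor i A)` is
supported in column `i`. -/
theorem green_apply_eq_greenMinor {A : Matrix (Fin N) (Fin N) ℝ} (hA : A.IsSymm) {z : ℂ}
    (hz : 0 < z.im) {i k : Fin N} (hk : k ≠ i) (j : Fin N) :
    green A z k j = (if j = i then 0 else green (minor i A) z k j) -
      (∑ m, greenMinor i A z k m * A m i) * green A z i j := by
  set G₀ := green (minor i A) z with hG₀
  have h1 : G₀ * shifted A z * green A z = G₀ := by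
    rw [mul_assoc, shifted_mul_green hA hz.ne', mul_one]
  have h2 : shifted A z = shifted (minor i A) z + (A - minor i A).map (fun x : ℝ => (x : ℂ)) := by
    ext a b
    simp [shifted]
  have h3 : ∀ b, (G₀ * (A - minor i A).map (fun x : ℝ => (x : ℂ))) k b =
      if b = i then ∑ m, greenMinor i A z k m * A m i else 0 := by
    intro b
    rw [Matrix.mul_apply]
    split_ifs with hb
    · subst hb
      refine Finset.sum_congr rfl fun m _ => ?_
      by_cases hm : m = b
      · subst hm
        simp [hG₀, green_minor_apply_self hA hz hk, greenMinor]
      · simp [greenMinor, hk, hm, minor, hG₀]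
    · refine Finset.sum_eq_zero fun m _ => ?_
      by_cases hm : m = i
      · subst hm
        rw [hG₀, green_minor_apply_self hA hz hk, zero_mul]
      · simp [minor, hm, hb]
  rw [h2, mul_add, green_mul_shifted (minor_isSymm hA i) hz.ne', add_mul, one_mul] at h1
  have h4 := congrFun (congrFun h1 k) j
  rw [Matrix.add_apply, Matrix.mul_apply] at h4
  simp_rw [h3, ite_mul, zero_mul] at h4
  rw [Finset.sum_ite_eq' Finset.univ i, if_pos (Finset.mem_univ i)] at h4
  have h5 : G₀ k j = if j = i then 0 else G₀ k j := by
    split_ifs with hj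
    · subst hj; exact green_minor_apply_self hA hz hk
    · rfl
  rw [← h5, ← h4]
  ring

theorem green_offDiag {A : Matrix (Fin N) (Fin N) ℝ} (hA : A.IsSymm) {z : ℂ}
    (hz : 0 < z.im) {i k : Fin N} (hk : k ≠ i) :
    green A z k i = -(∑ m, greenMinor i A z k m * A m i) * green A z i i := by
  rw [green_apply_eq_greenMinor hA hz hk]
  simp

theorem green_eq_greenMinor_add {A : Matrix (Fin N) (Fin N) ℝ} (hA : A.IsSymm) {z : ℂ}
    (hz : 0 < z.im) {i k l : Fin N} (hk : k ≠ i) (hl : l ≠ i) :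
    green A z k l = greenMinor i A z k l +
      (∑ m, greenMinor i A z k m * A m i) * (∑ m, greenMinor i A z l m * A m i) *
        green A z i i := by
  rw [green_apply_eq_greenMinor hA hz hk, if_neg hl, green_symm hA z i l, green_offDiag hA hz hl]
  simp [greenMinor, hk, hl]
  ring

/-- The Schur complement formula. -/
theorem green_diag_mul {A : Matrix (Fin N) (Fin N) ℝ} (hA : A.IsSymm) {z : ℂ}
    (hz : 0 < z.im) (i : Fin N) :
    green A z i i * (A i i - z - ∑ k, ∑ m, A i k * greenMinor i A z k m * A m i) = 1 := by
  have h := congrFun (congrFun (shifted_mul_green hA hz.ne') i) i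
  rw [Matrix.mul_apply, Matrix.one_apply_eq, ← Finset.add_sum_erase _ _ (Finset.mem_univ i)] at h
  have h1 : ∑ k ∈ Finset.univ.erase i, shifted A z i k * green A z k i =
      -(∑ k, ∑ m, A i k * greenMinor i A z k m * A m i) * green A z i i := by
    rw [← Finset.add_sum_erase Finset.univ (fun k => ∑ m, A i k * greenMinor i A z k m * A m i)
      (Finset.mem_univ i)]
    have : ∑ m, (A i i : ℂ) * greenMinor i A z i m * A m i = 0 := by simp [greenMinor]
    rw [this, zero_add, neg_mul, Finset.sum_mul, ← Finset.sum_neg_distrib]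
    refine Finset.sum_congr rfl fun k hk => ?_
    have hk' := Finset.ne_of_mem_erase hk
    rw [green_offDiag hA hz hk']
    simp only [shifted, Matrix.sub_apply, Matrix.map_apply, Matrix.smul_apply,
      Matrix.one_apply_ne hk'.symm, smul_zero, sub_zero, mul_assoc, ← Finset.mul_sum]
    ring
  rw [h1] at h
  rw [← h]
  simp [shifted]
  ring

end SparseLocalLaw

/-! ### The Stieltjes transform of the semicircle law -/

namespace SparseLocalLaw

theorem one_add_mul_ne_zero {u w : ℂ} (hu : ‖u‖ < 1) (hw : ‖w‖ ≤ 1) : 1 + u * w ≠ 0 := by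
  intro h
  have h1 : u * w = -1 := by linear_combination h
  have h2 := congrArg norm h1
  rw [norm_mul, norm_neg, norm_one] at h2
  nlinarith [norm_nonneg u, norm_nonneg w]

/-- Mean value property: `(1 + u * w)⁻¹` is holomorphic up to the closed unit disc and equals `1` at
the origin. -/
theorem integral_inv_one_add_mul_exp {u : ℂ} (hu : ‖u‖ < 1) :
    ∫ θ in (-Real.pi)..Real.pi, (1 + u * Complex.exp (θ * Complex.I))⁻¹ = 2 * Real.pi := by
  have hd : DiffContOnCl ℂ (fun w : ℂ => (1 + u * w)⁻¹) (Metric.ball 0 |(1 : ℝ)|) := by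
    rw [abs_one]
    refine DifferentiableOn.diffContOnCl fun w hw => ?_
    rw [closure_ball _ one_ne_zero, mem_closedBall_zero_iff] at hw
    have hd : DifferentiableAt ℂ (fun w : ℂ => 1 + u * w) w := by fun_prop
    exact (hd.inv (one_add_mul_ne_zero hu hw)).differentiableWithinAt
  have h := hd.circleAverage
  rw [Real.circleAverage_eq_integral_add (-Real.pi)] at h
  simp only [mul_zero, add_zero, inv_one] at h
  rw [intervalIntegral.integral_comp_add_right
    (fun θ => (1 + u * circleMap 0 1 θ)⁻¹)] at h
  have h2 : (0 + -Real.pi : ℝ) = -Real.pi := by ring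
  have h3 : (2 * Real.pi + -Real.pi : ℝ) = Real.pi := by ring
  rw [h2, h3, Complex.real_smul] at h
  simp only [circleMap, Complex.ofReal_one, one_mul, zero_add] at h
  have hpi : (Real.pi : ℂ) ≠ 0 := by exact_mod_cast Real.pi_ne_zero
  push_cast at h
  field_simp at h
  simpa using h

theorem two_cos_sub_ne_zero {z : ℂ} (hz : z.im ≠ 0) (x : ℝ) : (x : ℂ) - z ≠ 0 := by
  intro h
  have := congrArg Complex.im h
  simp at this
  exact hz this

theorem integral_inv_two_cos_sub {z u : ℂ} (hu : ‖u‖ < 1)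
    (huz : u ^ 2 + z * u + 1 = 0) :
    ∫ θ in (0 : ℝ)..Real.pi, (((2 * Real.cos θ : ℝ) : ℂ) - z)⁻¹ = Real.pi * (u / (1 - u ^ 2)) := by
  have hu0 : u ≠ 0 := by rintro rfl; simp at huz
  have hu1 : 1 - u ^ 2 ≠ 0 := by
    have := one_add_mul_ne_zero (w := -u) hu (by simpa using hu.le)
    intro h; apply this; linear_combination h
  have hcont : Continuous fun θ : ℝ => (1 + u * Complex.exp (θ * Complex.I))⁻¹ := by
    refine Continuous.inv₀ (by fun_prop) fun θ => one_add_mul_ne_zero hu ?_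
    rw [Complex.norm_exp_ofReal_mul_I]
  have hpt : ∀ θ : ℝ, (((2 * Real.cos θ : ℝ) : ℂ) - z)⁻¹ = u / (1 - u ^ 2) *
      ((1 + u * Complex.exp (θ * Complex.I))⁻¹ +
        (1 + u * Complex.exp ((-θ : ℝ) * Complex.I))⁻¹ - 1) := by
    intro θ
    set w := Complex.exp (θ * Complex.I) with hw
    have hw0 : w ≠ 0 := Complex.exp_ne_zero _
    have hwn : ‖w‖ = 1 := Complex.norm_exp_ofReal_mul_I θ
    have hwi : Complex.exp ((-θ : ℝ) * Complex.I) = w⁻¹ := by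
      rw [hw, ← Complex.exp_neg]; congr 1; push_cast; ring
    have hcos : ((2 * Real.cos θ : ℝ) : ℂ) = w + w⁻¹ := by
      rw [← hwi, hw]
      push_cast
      rw [Complex.two_cos, neg_mul]
    have h1 := one_add_mul_ne_zero hu hwn.le
    have h2 : 1 + u * w⁻¹ ≠ 0 := one_add_mul_ne_zero hu (by rw [norm_inv, hwn, inv_one])
    -- The quadratic equation for `u` factors the denominator, after which partial fractions produce
    -- one term at `θ` and one at `-θ`; together they fill the whole circle.
    have hden : w + w⁻¹ - z = (1 + u * w) * (1 + u * w⁻¹) / u := by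
      field_simp
      linear_combination (-w) * huz
    have h3 : w + u ≠ 0 := by
      intro h
      apply h2
      field_simp
      simpa using h
    rw [hwi, hcos, hden]
    field_simp
    ring
  simp_rw [hpt]
  have hi : ∀ a b : ℝ, IntervalIntegrable (fun θ : ℝ => (1 + u * Complex.exp (θ * Complex.I))⁻¹)
      volume a b := fun a b => hcont.intervalIntegrable a b
  have hi' : IntervalIntegrable (fun θ : ℝ => (1 + u * Complex.exp ((-θ : ℝ) * Complex.I))⁻¹)
      volume 0 Real.pi := (hcont.comp continuous_neg).intervalIntegrable _ _
  rw [intervalIntegral.integral_const_mul, intervalIntegral.integral_sub ((hi _ _).add hi')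
    (by simp), intervalIntegral.integral_add (hi _ _) hi',
    intervalIntegral.integral_comp_neg (fun θ : ℝ => (1 + u * Complex.exp (θ * Complex.I))⁻¹),
    add_comm (∫ θ in (0 : ℝ)..Real.pi, _), neg_zero,
    intervalIntegral.integral_add_adjacent_intervals (hi _ _) (hi _ _),
    integral_inv_one_add_mul_exp hu]
  simp
  ring

theorem semicircleStieltjes_eq_integral_cos {z : ℂ} (hz : z.im ≠ 0) :
    semicircleStieltjes z = ∫ θ in (0 : ℝ)..Real.pi,
      (1 / (2 * Real.pi) : ℂ) * ((2 * Real.sin θ) ^ 2 * (((2 * Real.cos θ : ℝ) : ℂ) - z)⁻¹) := by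
  set g : ℝ → ℂ := fun x => (semicircleDensity x : ℂ) / ((x : ℂ) - z) with hg
  have hgc : Continuous g := by
    refine Continuous.div ?_ (by fun_prop) fun x => two_cos_sub_ne_zero hz x
    unfold semicircleDensity
    fun_prop
  have h1 : ∫ x in (-2 : ℝ)..2, g x = semicircleStieltjes z := by
    rw [intervalIntegral.integral_of_le (by norm_num)]
    refine setIntegral_eq_integral_of_forall_compl_eq_zero fun x hx => ?_
    have : max (4 - x ^ 2) 0 = 0 := by
      refine max_eq_right ?_
      simp only [Set.mem_Ioc, not_and_or, not_lt, not_le] at hx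
      rcases hx with hx | hx <;> nlinarith
    simp [hg, semicircleDensity, this]
  have h2 := intervalIntegral.integral_deriv_smul_comp (a := 0) (b := Real.pi)
    (f := fun θ => 2 * Real.cos θ) (f' := fun θ => 2 * -Real.sin θ) (g := g)
    (fun θ _ => (Real.hasDerivAt_cos θ).const_mul 2) (by fun_prop) hgc
  simp only [Real.cos_zero, Real.cos_pi, mul_one] at h2
  rw [show (2 * -1 : ℝ) = -2 by norm_num, intervalIntegral.integral_symm (-2) 2, h1] at h2
  rw [← neg_eq_iff_eq_neg] at h2
  rw [← h2, ← intervalIntegral.integral_neg]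
  refine intervalIntegral.integral_congr fun θ hθ => ?_
  rw [Set.uIcc_of_le Real.pi_pos.le] at hθ
  have hs := Real.sin_nonneg_of_mem_Icc hθ
  have hsq : Real.sqrt (max (4 - (2 * Real.cos θ) ^ 2) 0) = 2 * Real.sin θ := by
    have : 4 - (2 * Real.cos θ) ^ 2 = (2 * Real.sin θ) ^ 2 := by
      nlinarith [Real.sin_sq_add_cos_sq θ]
    rw [this, max_eq_left (sq_nonneg _), Real.sqrt_sq (by linarith)]
  simp only [hg, Function.comp, semicircleDensity, hsq, Complex.real_smul]
  push_cast
  ring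

/-- After `x = 2 cos θ`, dividing `4 - x²` by `x - z` leaves an explicit linear term and a multiple
of the integral already computed. -/
theorem semicircleStieltjes_eq_of_root {z u : ℂ} (hz : z.im ≠ 0) (hu : ‖u‖ < 1)
    (huz : u ^ 2 + z * u + 1 = 0) : semicircleStieltjes z = u := by
  have hu0 : u ≠ 0 := by rintro rfl; simp at huz
  have hu1 : 1 - u ^ 2 ≠ 0 := by
    have := one_add_mul_ne_zero (w := -u) hu (by simpa using hu.le)
    intro h; apply this; linear_combination h
  rw [semicircleStieltjes_eq_integral_cos hz]
  have hpt : ∀ θ : ℝ, (2 * Real.sin θ : ℂ) ^ 2 * (((2 * Real.cos θ : ℝ) : ℂ) - z)⁻¹ =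
      -((2 * Real.cos θ : ℝ) : ℂ) - z + (4 - z ^ 2) * (((2 * Real.cos θ : ℝ) : ℂ) - z)⁻¹ := by
    intro θ
    have h1 := two_cos_sub_ne_zero hz (2 * Real.cos θ)
    have h2 : (2 * Real.sin θ : ℂ) ^ 2 = 4 - ((2 * Real.cos θ : ℝ) : ℂ) ^ 2 := by
      push_cast
      have := Complex.sin_sq_add_cos_sq (θ : ℂ)
      linear_combination 4 * this
    rw [h2]
    field_simp
    ring
  simp_rw [hpt]
  have hi1 : IntervalIntegrable (fun θ : ℝ => -((2 * Real.cos θ : ℝ) : ℂ) - z) volume 0 Real.pi :=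
    Continuous.intervalIntegrable (by fun_prop) _ _
  have hi2 : IntervalIntegrable
      (fun θ : ℝ => (4 - z ^ 2) * (((2 * Real.cos θ : ℝ) : ℂ) - z)⁻¹) volume 0 Real.pi :=
    Continuous.intervalIntegrable (continuous_const.mul (Continuous.inv₀ (by fun_prop)
      fun θ => two_cos_sub_ne_zero hz _)) _ _
  have hcos : ∫ θ in (0 : ℝ)..Real.pi, -((2 * Real.cos θ : ℝ) : ℂ) = 0 := by
    rw [intervalIntegral.integral_neg, intervalIntegral.integral_ofReal]
    simp
  rw [intervalIntegral.integral_const_mul, intervalIntegral.integral_add hi1 hi2,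
    intervalIntegral.integral_sub (Continuous.intervalIntegrable (by fun_prop) _ _) (by simp),
    hcos, intervalIntegral.integral_const_mul, integral_inv_two_cos_sub hu huz]
  have hpi : (Real.pi : ℂ) ≠ 0 := by exact_mod_cast Real.pi_ne_zero
  have hzu : z = -(u ^ 2 + 1) / u := by
    field_simp
    linear_combination huz
  rw [intervalIntegral.integral_const, sub_zero, Complex.real_smul, hzu]
  field_simp
  ring

/-- The roots have product `1`, and a root `u` on the unit circle would make `z = -(u + conj u)`
real. -/
theorem exists_root_norm_lt_one {z : ℂ} (hz : z.im ≠ 0) :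
    ∃ u : ℂ, ‖u‖ < 1 ∧ u ^ 2 + z * u + 1 = 0 := by
  obtain ⟨s, hs⟩ := IsAlgClosed.exists_pow_nat_eq (z ^ 2 - 4) (n := 2) (by norm_num)
  have h1 : ((-z + s) / 2) ^ 2 + z * ((-z + s) / 2) + 1 = 0 := by linear_combination hs / 4
  have h2 : ((-z - s) / 2) ^ 2 + z * ((-z - s) / 2) + 1 = 0 := by linear_combination hs / 4
  have hprod : ((-z + s) / 2) * ((-z - s) / 2) = 1 := by linear_combination -hs / 4
  have hne : ∀ u : ℂ, u ^ 2 + z * u + 1 = 0 → ‖u‖ ≠ 1 := by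
    intro u hu hn
    have hc : u * (starRingEnd ℂ) u = 1 := by
      rw [Complex.mul_conj, Complex.normSq_eq_norm_sq, hn]; norm_num
    have hu0 : u ≠ 0 := by rintro rfl; simp at hn
    have : z = -(u + (starRingEnd ℂ) u) := by
      apply mul_left_cancel₀ hu0
      linear_combination hu + hc
    apply hz
    rw [this]
    simp
  set a := (-z + s) / 2
  set b := (-z - s) / 2
  have hn : ‖a‖ * ‖b‖ = 1 := by rw [← norm_mul, hprod, norm_one]
  rcases lt_trichotomy ‖a‖ 1 with h | h | h
  · exact ⟨a, h, h1⟩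
  · exact absurd h (hne a h1)
  · refine ⟨b, ?_, h2⟩
    by_contra! hb
    nlinarith

theorem semicircleStieltjes_spec {z : ℂ} (hz : z.im ≠ 0) :
    ‖semicircleStieltjes z‖ < 1 ∧ semicircleStieltjes z ^ 2 + z * semicircleStieltjes z + 1 = 0 := by
  obtain ⟨u, h1, h2⟩ := exists_root_norm_lt_one hz
  rw [semicircleStieltjes_eq_of_root hz h1 h2]
  exact ⟨h1, h2⟩

/-- Multiply the equation by the conjugate of `u` and take imaginary parts: `Im u * (1 - |u|²) = Im
z * |u|²`. -/
theorem mul_norm_le_one_sub_norm_sq {z u : ℂ} (hu : ‖u‖ < 1)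
    (huz : u ^ 2 + z * u + 1 = 0) : z.im * ‖u‖ ≤ 1 - ‖u‖ ^ 2 := by
  have h1 : u * ((starRingEnd ℂ) u) = (‖u‖ ^ 2 : ℝ) := by
    rw [Complex.mul_conj, Complex.normSq_eq_norm_sq]
  have hu0 : u ≠ 0 := by rintro rfl; simp at huz
  have h2 : u * (‖u‖ ^ 2 : ℝ) + z * (‖u‖ ^ 2 : ℝ) + (starRingEnd ℂ) u = 0 := by
    rw [← h1]
    linear_combination (starRingEnd ℂ) u * huz
  have h3 := congrArg Complex.im h2
  simp only [Complex.add_im, Complex.im_mul_ofReal, Complex.conj_im, Complex.zero_im] at h3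
  have h4 : u.im * (1 - ‖u‖ ^ 2) = z.im * ‖u‖ ^ 2 := by linarith
  have h5 : u.im ≤ ‖u‖ := (le_abs_self _).trans (Complex.abs_im_le_norm u)
  have h6 : 0 < ‖u‖ := norm_pos_iff.2 hu0
  have h7 : 0 ≤ 1 - ‖u‖ ^ 2 := by nlinarith
  have h8 : z.im * ‖u‖ * ‖u‖ ≤ (1 - ‖u‖ ^ 2) * ‖u‖ := by nlinarith
  exact le_of_mul_le_mul_right h8 h6

theorem norm_semicircleStieltjes_le {z : ℂ} (hz : 0 < z.im) :
    ‖semicircleStieltjes z‖ ≤ 1 / z.im := by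
  obtain ⟨h1, h2⟩ := semicircleStieltjes_spec hz.ne'
  have := mul_norm_le_one_sub_norm_sq h1 h2
  rw [le_div_iff₀ hz]
  nlinarith [sq_nonneg ‖semicircleStieltjes z‖]

/-- Subtracting the two equations gives `(u - v) * (1 - u * v) = (z - w) * (u * v)`; the gap of
`|u|` and `|v|` below `1` bounds `|1 - u * v|` from below by `η * |u| * |v|`. -/
theorem norm_semicircleStieltjes_sub_le {z w : ℂ} {η : ℝ} (hη : 0 < η) (hz : η ≤ z.im)
    (hw : η ≤ w.im) :
    ‖semicircleStieltjes z - semicircleStieltjes w‖ ≤ ‖z - w‖ / η := by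
  obtain ⟨h1, h2⟩ := semicircleStieltjes_spec (hη.trans_le hz).ne'
  obtain ⟨h3, h4⟩ := semicircleStieltjes_spec (hη.trans_le hw).ne'
  have h5 := mul_norm_le_one_sub_norm_sq h1 h2
  have h6 := mul_norm_le_one_sub_norm_sq h3 h4
  set u := semicircleStieltjes z
  set v := semicircleStieltjes w
  have h7 : (u - v) * (1 - u * v) = (z - w) * (u * v) := by
    linear_combination (-v) * h2 + u * h4
  have h8 : ‖u - v‖ * ‖1 - u * v‖ = ‖z - w‖ * (‖u‖ * ‖v‖) := by
    rw [← norm_mul, h7, norm_mul, norm_mul]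
  have h9 : 1 - ‖u‖ * ‖v‖ ≤ ‖1 - u * v‖ := by
    have := norm_sub_norm_le (1 : ℂ) (u * v)
    rwa [norm_one, norm_mul] at this
  have hu := norm_nonneg u
  have hv := norm_nonneg v
  have h10 : η * (‖u‖ * ‖v‖) ≤ 1 - ‖u‖ * ‖v‖ := by
    have a1 : η * ‖u‖ ≤ 1 - ‖u‖ ^ 2 := le_trans (by gcongr) h5
    have a2 : η * ‖v‖ ≤ 1 - ‖v‖ ^ 2 := le_trans (by gcongr) h6
    have a3 : 2 * (‖u‖ * ‖v‖) ≤ ‖u‖ + ‖v‖ := by nlinarith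
    nlinarith [sq_nonneg (‖u‖ - ‖v‖)]
  rw [le_div_iff₀ hη]
  by_cases huv : ‖u‖ * ‖v‖ = 0
  · rw [huv] at h8 h9
    have h11 : ‖u - v‖ = 0 := by
      rcases mul_eq_zero.1 (h8.trans (mul_zero _)) with h | h
      · exact h
      · rw [h] at h9; norm_num at h9
    rw [h11, zero_mul]
    positivity
  · have hpos : 0 < ‖u‖ * ‖v‖ := lt_of_le_of_ne (by positivity) (Ne.symm huv)
    refine le_of_mul_le_mul_right ?_ hpos
    calc ‖u - v‖ * η * (‖u‖ * ‖v‖) = ‖u - v‖ * (η * (‖u‖ * ‖v‖)) := by ring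
      _ ≤ ‖u - v‖ * ‖1 - u * v‖ := by gcongr; exact h10.trans h9
      _ = _ := h8

end SparseLocalLaw

/-! ### Independence and moments of the rows of a sparse matrix -/

namespace SparseLocalLaw

/-- Conditioning on a variable independent of `X`. -/
theorem measureReal_le_of_indepFun {Ω α β : Type*} [MeasurableSpace Ω] [MeasurableSpace α]
    [MeasurableSpace β] {P : Measure Ω} [IsProbabilityMeasure P] {U : Ω → α} {X : Ω → β}
    (hind : IndepFun U X P) (hU : Measurable U) (hX : Measurable X) {S : Set (α × β)}
    (hS : MeasurableSet S) {ε : ℝ} (hε : 0 ≤ ε) (h : ∀ u, P.real {ω | (u, X ω) ∈ S} ≤ ε) :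
    P.real {ω | (U ω, X ω) ∈ S} ≤ ε := by
  have hmap := (indepFun_iff_map_prod_eq_prod_map_map hU.aemeasurable hX.aemeasurable).1 hind
  have := Measure.isProbabilityMeasure_map (μ := P) hU.aemeasurable
  have := Measure.isProbabilityMeasure_map (μ := P) hX.aemeasurable
  have h1 : P {ω | (U ω, X ω) ∈ S} = ∫⁻ u, (P.map X) (Prod.mk u ⁻¹' S) ∂(P.map U) := by
    rw [← Measure.prod_apply hS, ← hmap, Measure.map_apply (hU.prodMk hX) hS]
    rfl
  have h2 : ∀ u, (P.map X) (Prod.mk u ⁻¹' S) ≤ ENNReal.ofReal ε := by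
    intro u
    rw [Measure.map_apply hX (measurable_prodMk_left hS), ← ofReal_measureReal]
    exact ENNReal.ofReal_le_ofReal (h u)
  refine ENNReal.toReal_le_of_le_ofReal hε ?_
  rw [h1]
  calc _ ≤ ∫⁻ _, ENNReal.ofReal ε ∂(P.map U) := lintegral_mono h2
    _ = _ := by simp

theorem measureReal_lt_norm_le {Ω : Type*} [MeasurableSpace Ω] {P : Measure Ω}
    [IsProbabilityMeasure P] {Z : Ω → ℂ} {B s : ℝ} (hs : 0 < s) (m : ℕ)
    (h : Integrable (fun ω => ‖Z ω‖ ^ (2 * m)) P ∧ ∫ ω, ‖Z ω‖ ^ (2 * m) ∂P ≤ B ^ (2 * m)) :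
    P.real {ω | s < ‖Z ω‖} ≤ (B / s) ^ (2 * m) := by
  have h1 := mul_meas_ge_le_integral_of_nonneg (ae_of_all _ fun ω => by positivity) h.1 (s ^ (2 * m))
  rw [div_pow, le_div_iff₀ (by positivity), mul_comm]
  refine le_trans ?_ (h1.trans h.2)
  refine mul_le_mul_of_nonneg_left (measureReal_mono fun ω hω => ?_) (by positivity)
  have hω' : s < ‖Z ω‖ := hω
  show s ^ (2 * m) ≤ ‖Z ω‖ ^ (2 * m)
  gcongr

variable {Ω : Type*} [MeasurableSpace Ω] {P : Measure Ω} [IsProbabilityMeasure P] {N : ℕ}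
  {q K : ℝ} {H : Ω → Matrix (Fin N) (Fin N) ℝ}

/-- The index of the entry `(k, l)` or `(l, k)` on or above the diagonal. -/
def upperIndex (k l : Fin N) : {p : Fin N × Fin N // p.1 ≤ p.2} :=
  ⟨(min k l, max k l), min_le_max⟩

namespace IsSparseMatrix

theorem apply_upperIndex (hH : IsSparseMatrix P N q K H) (ω : Ω) (k l : Fin N) :
    H ω (upperIndex k l).1.1 (upperIndex k l).1.2 = H ω k l := by
  rcases le_total k l with h | h
  · simp [upperIndex, h]
  · simp [upperIndex, h, (hH.symm ω).apply]

theorem iIndepFun_row (hH : IsSparseMatrix P N q K H) (i : Fin N) :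
    iIndepFun (fun k ω => H ω i k) P := by
  have hinj : Function.Injective (upperIndex i) := by
    intro k l h
    simp only [upperIndex, Subtype.mk.injEq, Prod.mk.injEq] at h
    grind
  have := hH.indep.precomp hinj
  simp_rw [hH.apply_upperIndex] at this
  exact this

theorem integrable_pow (hH : IsSparseMatrix P N q K H) (i j : Fin N) (k : ℕ) :
    Integrable (fun ω => H ω i j ^ k) P := by
  -- Moments are only assumed integrable from order `3` on; the shift by `3` covers the low orders
  -- too.
  have h1 := (integrable_const (1 : ℝ)).add (hH.integrable (k + 3) (by omega) i j)
  refine h1.mono' ((hH.measurable i j).pow_const k).aestronglyMeasurable (ae_of_all _ fun ω => ?_)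
  rw [norm_pow, Real.norm_eq_abs]
  show |H ω i j| ^ k ≤ 1 + |H ω i j| ^ (k + 3)
  rcases le_total |H ω i j| 1 with h | h
  · have := pow_le_one₀ (abs_nonneg _) h (n := k)
    have : 0 ≤ |H ω i j| ^ (k + 3) := by positivity
    linarith
  · have := pow_le_pow_right₀ h (show k ≤ k + 3 by omega)
    linarith

theorem N_pos (hH : IsSparseMatrix P N q K H) : 0 < (N : ℝ) := by
  have h1 := hH.q_pos
  have h2 := hH.q_le
  by_contra! h
  rw [Real.sqrt_eq_zero_of_nonpos h] at h2
  linarith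

theorem q_sq_le (hH : IsSparseMatrix P N q K H) : q ^ 2 ≤ N := by
  have h := hH.q_le
  calc q ^ 2 ≤ Real.sqrt (N : ℝ) ^ 2 := by
        have := hH.q_pos
        gcongr
    _ = (N : ℝ) := Real.sq_sqrt hH.N_pos.le

/-- The sparse moment bound is exactly `c * τ ^ k` with `c = q ^ 2 / N` and `τ = 1 / q`; off the
diagonal the variance fits the same form with `k = 2`. -/
theorem integral_abs_pow_le (hH : IsSparseMatrix P N q K H) {i j : Fin N} (hij : i ≠ j) {k : ℕ}
    (hk : 2 ≤ k) : ∫ ω, |H ω i j| ^ k ∂P ≤ q ^ 2 / N * (1 / q) ^ k := by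
  have hq := hH.q_pos
  have hN := hH.N_pos
  have heq : (1 : ℝ) / (N * q ^ (k - 2)) = q ^ 2 / N * (1 / q) ^ k := by
    obtain ⟨j, rfl⟩ := Nat.exists_eq_add_of_le hk
    rw [Nat.add_sub_cancel_left, one_div_pow, pow_add]
    field_simp
  rw [← heq]
  rcases hk.eq_or_lt with h | h
  · subst h
    simp only [sq_abs]
    rw [hH.variance_offDiag i j hij]
    simp
  · exact hH.moment k h i j

/-- Row `i` of the matrix with the diagonal entry set to zero. -/
theorem centeredFamily_row (hH : IsSparseMatrix P N q K H) (i : Fin N) :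
    CenteredFamily P (fun k ω => if k = i then 0 else H ω i k) (q ^ 2 / N) (1 / q) where
  c_nonneg := by have := hH.N_pos; positivity
  τ_nonneg := by have := hH.q_pos; positivity
  indep := by
    refine ((hH.iIndepFun_row i).comp (fun k x => if k = i then 0 else x) fun k => ?_)
    split_ifs <;> fun_prop
  measurable k := by
    have := hH.measurable i k
    split_ifs <;> fun_prop
  integrable_pow k n := by
    by_cases h : k = i
    · simp [h]
    · simpa [h] using hH.integrable_pow i k n
  mean k := by
    by_cases h : k = i
    · simp [h]
    · simpa [h] using hH.mean i k
  moment k n hn := by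
    have hN := hH.N_pos
    have hq := hH.q_pos
    by_cases h : k = i
    · simp only [h, if_true, zero_pow (show n ≠ 0 by omega), integral_zero, abs_zero]
      positivity
    · simp only [h, if_false]
      refine (abs_integral_le_integral_abs).trans ?_
      simp_rw [abs_pow]
      exact hH.integral_abs_pow_le (Ne.symm h) hn

/-- Nonnegativity avoids the usual factor `2 ^ n`, so that `τ` stays unchanged for the squared
entries. -/
theorem abs_sub_pow_le {a b : ℝ} (ha : 0 ≤ a) (hb : 0 ≤ b) (n : ℕ) :
    |a - b| ^ n ≤ a ^ n + b ^ n := by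
  have h1 : 0 ≤ a ^ n := by positivity
  have h2 : 0 ≤ b ^ n := by positivity
  rcases le_total a b with h | h
  · rw [abs_sub_comm, abs_of_nonneg (by linarith)]
    have : (b - a) ^ n ≤ b ^ n := pow_le_pow_left₀ (by linarith) (by linarith) n
    linarith
  · rw [abs_of_nonneg (by linarith)]
    have : (a - b) ^ n ≤ a ^ n := pow_le_pow_left₀ (by linarith) (by linarith) n
    linarith

/-- Moments of order `2 * n` of the entries give `τ = 1 / q ^ 2`; the centring term has the same
size because `q ^ 2 ≤ N`, which doubles `c`. -/
theorem centeredFamily_row_sq (hH : IsSparseMatrix P N q K H) (i : Fin N) :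
    CenteredFamily P (fun k ω => if k = i then 0 else H ω i k ^ 2 - 1 / N)
      (2 * q ^ 2 / N) (1 / q ^ 2) where
  c_nonneg := by have := hH.N_pos; positivity
  τ_nonneg := by have := hH.q_pos; positivity
  indep := by
    refine ((hH.iIndepFun_row i).comp (fun k x => if k = i then 0 else x ^ 2 - 1 / N) fun k => ?_)
    split_ifs <;> fun_prop
  measurable k := by
    have := hH.measurable i k
    split_ifs <;> fun_prop
  integrable_pow k n := by
    by_cases h : k = i
    · simp [h]
    · simp only [h, if_false]
      have h1 := (hH.integrable_pow i k (2 * n)).add (integrable_const ((1 / (N : ℝ)) ^ n))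
      have hm := hH.measurable i k
      refine h1.mono' (by fun_prop) (ae_of_all _ fun ω => ?_)
      rw [norm_pow, Real.norm_eq_abs]
      refine (abs_sub_pow_le (sq_nonneg _) (by positivity) n).trans (le_of_eq ?_)
      simp [pow_mul]
  mean k := by
    by_cases h : k = i
    · simp [h]
    · simp only [h, if_false]
      rw [integral_sub (hH.integrable_pow i k 2) (integrable_const _),
        hH.variance_offDiag i k (Ne.symm h)]
      simp
  moment k n hn := by
    have hN := hH.N_pos
    have hq := hH.q_pos
    by_cases h : k = i
    · simp only [h, if_true, zero_pow (show n ≠ 0 by omega), integral_zero, abs_zero]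
      positivity
    · simp only [h, if_false]
      refine (abs_integral_le_integral_abs).trans ?_
      have hmono : ∀ ω, |(H ω i k ^ 2 - 1 / N) ^ n| ≤ |H ω i k| ^ (2 * n) + (1 / (N : ℝ)) ^ n := by
        intro ω
        rw [abs_pow, pow_mul, sq_abs]
        exact abs_sub_pow_le (sq_nonneg _) (by positivity) n
      have hi : Integrable (fun ω => |H ω i k| ^ (2 * n)) P := hH.integrable _ (by omega) i k
      have hi2 := hi.add (integrable_const ((1 / (N : ℝ)) ^ n))
      refine (integral_mono_of_nonneg (ae_of_all _ fun ω => abs_nonneg _) hi2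
        (ae_of_all _ hmono)).trans ?_
      rw [integral_add' hi (integrable_const _)]
      have h2 := hH.integral_abs_pow_le (Ne.symm h) (show 2 ≤ 2 * n by omega)
      have h3 : (1 / (N : ℝ)) ^ n ≤ q ^ 2 / N * (1 / q) ^ (2 * n) := by
        obtain ⟨j, rfl⟩ := Nat.exists_eq_add_of_le (show 1 ≤ n by omega)
        have h4 : q ^ 2 / N * (1 / q) ^ (2 * (1 + j)) = 1 / N * (1 / q ^ 2) ^ j := by
          rw [pow_mul, pow_add, div_pow]
          field_simp
        rw [h4, pow_add, pow_one]
        gcongr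
        exact hH.q_sq_le
      simp only [integral_const, probReal_univ, one_smul]
      calc _ ≤ q ^ 2 / N * (1 / q) ^ (2 * n) + q ^ 2 / N * (1 / q) ^ (2 * n) := add_le_add h2 h3
        _ = _ := by rw [pow_mul, one_div_pow]; ring

end IsSparseMatrix

theorem measurable_det {α : Type*} [MeasurableSpace α] {M : α → Matrix (Fin N) (Fin N) ℂ}
    (hM : ∀ i j, Measurable fun u => M u i j) : Measurable fun u => (M u).det := by
  simp_rw [Matrix.det_apply]
  refine Finset.measurable_fun_sum _ fun σ _ => Measurable.const_smul
    (Finset.measurable_fun_prod _ fun i _ => hM _ _) _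

/-- By Cramer's rule the entries are quotients of polynomials in the matrix entries. -/
theorem measurable_green {α : Type*} [MeasurableSpace α] {A : α → Matrix (Fin N) (Fin N) ℝ}
    (hA : ∀ i j, Measurable fun u => A u i j) (z : ℂ) (i j : Fin N) :
    Measurable fun u => green (A u) z i j := by
  have hM : ∀ i j, Measurable fun u => shifted (A u) z i j := by
    intro i j
    have := hA i j
    simp only [shifted, Matrix.sub_apply, Matrix.map_apply, Matrix.smul_apply]
    fun_prop
  simp_rw [green_eq, Matrix.inv_def, Matrix.smul_apply, Ring.inverse_eq_inv', smul_eq_mul,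
    Matrix.adjugate_apply]
  refine (measurable_det hM).inv.mul (measurable_det fun k l => ?_)
  simp_rw [Matrix.updateRow_apply]
  split_ifs
  · fun_prop
  · exact hM k l

theorem measurable_greenMinor {α : Type*} [MeasurableSpace α] {A : α → Matrix (Fin N) (Fin N) ℝ}
    (i : Fin N) (hA : ∀ k l, k ≠ i → l ≠ i → Measurable fun u => A u k l) (z : ℂ) (k l : Fin N) :
    Measurable fun u => greenMinor i (A u) z k l := by
  simp only [greenMinor]
  split_ifs
  · fun_prop
  · refine measurable_green (fun k l => ?_) z k l
    simp only [minor]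
    split_ifs with h
    · fun_prop
    · push Not at h
      exact hA k l h.1 h.2

theorem greenMinor_congr {A B : Matrix (Fin N) (Fin N) ℝ} {i : Fin N} (z : ℂ)
    (h : ∀ k l, k ≠ i → l ≠ i → A k l = B k l) : greenMinor i A z = greenMinor i B z := by
  have : minor i A = minor i B := by
    ext k l
    simp only [minor]
    split_ifs with h'
    · rfl
    · push Not at h'
      exact h k l h'.1 h'.2
  unfold greenMinor
  rw [this]

theorem adjacency_apply (f : ℝ) (A : Matrix (Fin N) (Fin N) ℝ) (k l : Fin N) :
    adjacency f A k l = A k l + f / N := by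
  simp only [adjacency, Matrix.add_apply, Matrix.smul_apply, Matrix.vecMulVec_apply, flatVector,
    smul_eq_mul, div_mul_div_comm, one_mul, Real.mul_self_sqrt (Nat.cast_nonneg N)]
  ring

theorem adjacency_isSymm {A : Matrix (Fin N) (Fin N) ℝ} (hA : A.IsSymm) (f : ℝ) :
    (adjacency f A).IsSymm := by
  ext k l
  rw [Matrix.transpose_apply, adjacency_apply, adjacency_apply, hA.apply]

/-- The minor is a function of the upper-triangular entries avoiding index `i`, the row a function
of those meeting `i`; these two groups are independent. -/
theorem IsSparseMatrix.indepFun_greenMinor_row (hH : IsSparseMatrix P N q K H) (f : ℝ) (z : ℂ)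
    (i : Fin N) :
    IndepFun (fun ω => greenMinor i (adjacency f (H ω)) z)
      (fun ω k => if k = i then 0 else H ω i k) P := by
  classical
  set T : Finset {p : Fin N × Fin N // p.1 ≤ p.2} :=
    Finset.univ.filter fun p => p.1.1 = i ∨ p.1.2 = i with hT
  have hind := hH.indep.indepFun_finset Tᶜ T disjoint_compl_left
    (fun p => hH.measurable p.1.1 p.1.2)
  have hS : ∀ k l, k ≠ i ∧ l ≠ i → upperIndex k l ∈ Tᶜ := by
    intro k l h
    simp only [hT, upperIndex, Finset.mem_compl, Finset.mem_filter, Finset.mem_univ, true_and]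
    grind
  have hS' : ∀ k, upperIndex i k ∈ T := by
    intro k
    simp only [hT, upperIndex, Finset.mem_filter, Finset.mem_univ, true_and]
    grind
  let B : ((Tᶜ : Finset _) → ℝ) → Matrix (Fin N) (Fin N) ℝ := fun x k l =>
    if h : k ≠ i ∧ l ≠ i then x ⟨upperIndex k l, hS k l h⟩ else 0
  have hBdef : ∀ x {k l} (hk : k ≠ i) (hl : l ≠ i),
      B x k l = x ⟨upperIndex k l, hS k l ⟨hk, hl⟩⟩ := fun x k l hk hl => dif_pos ⟨hk, hl⟩
  have hcomp := hind.comp (φ := fun x => greenMinor i (adjacency f (B x)) z)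
    (ψ := fun x (k : Fin N) => if k = i then (0 : ℝ) else x ⟨upperIndex i k, hS' k⟩)
    (by
      refine measurable_pi_lambda _ fun k => measurable_pi_lambda _ fun l => ?_
      refine measurable_greenMinor i (fun k l hk hl => ?_) z k l
      have hB : (fun x => adjacency f (B x) k l) = fun x : (Tᶜ : Finset _) → ℝ =>
          x ⟨upperIndex k l, hS k l ⟨hk, hl⟩⟩ + adjacency f 0 k l := by
        funext x
        rw [adjacency_apply, adjacency_apply, hBdef x hk hl]
        simp
      rw [hB]
      exact (measurable_pi_apply _).add_const _)
    (by
      refine measurable_pi_lambda _ fun k => ?_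
      split_ifs <;> fun_prop)
  convert hcomp using 1
  · funext ω
    refine greenMinor_congr z fun k l hk hl => ?_
    rw [adjacency_apply, adjacency_apply]
    congr 1
    exact (hH.apply_upperIndex ω k l).symm.trans
      (hBdef (fun p => H ω p.1.1.1 p.1.1.2) hk hl).symm
  · funext ω k
    simp [hH.apply_upperIndex]

end SparseLocalLaw

/-! ### Large deviation bounds for one row -/

namespace SparseLocalLaw

variable {Ω : Type*} [MeasurableSpace Ω] {P : Measure Ω} [IsProbabilityMeasure P] {N : ℕ}
  {q K : ℝ} {H : Ω → Matrix (Fin N) (Fin N) ℝ}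

/-- Arrays with bounded entries and rows and columns of small `ℓ²` norm. -/
def boundedArrays (N : ℕ) (η : ℝ) : Set (Fin N → Fin N → ℂ) :=
  {g | (∀ k l, ‖g k l‖ ≤ 3) ∧ (∀ k, ∑ l, ‖g k l‖ ^ 2 ≤ 3 / η) ∧ ∀ l, ∑ k, ‖g k l‖ ^ 2 ≤ 3 / η}

theorem measurableSet_boundedArrays (N : ℕ) (η : ℝ) : MeasurableSet (boundedArrays N η) := by
  have h : boundedArrays N η = (⋂ k, ⋂ l, {g | ‖g k l‖ ≤ 3}) ∩
      ((⋂ k, {g | ∑ l, ‖g k l‖ ^ 2 ≤ 3 / η}) ∩ ⋂ l, {g | ∑ k, ‖g k l‖ ^ 2 ≤ 3 / η}) := by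
    ext g
    simp [boundedArrays]
  rw [h]
  refine MeasurableSet.inter ?_ (MeasurableSet.inter ?_ ?_)
  · exact MeasurableSet.iInter fun k => MeasurableSet.iInter fun l =>
      measurableSet_le (by fun_prop) measurable_const
  · exact MeasurableSet.iInter fun k => measurableSet_le (by fun_prop) measurable_const
  · exact MeasurableSet.iInter fun k => measurableSet_le (by fun_prop) measurable_const

/-- The Ward identity for the minor turns the entrywise bound into the `ℓ²` bounds. -/
theorem greenMinor_mem_boundedArrays {A : Matrix (Fin N) (Fin N) ℝ} (hA : A.IsSymm) {z : ℂ}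
    {η : ℝ} (hη : 0 < η) (hz : η ≤ z.im) {i : Fin N} (h : ∀ k l, ‖greenMinor i A z k l‖ ≤ 3) :
    greenMinor i A z ∈ boundedArrays N η := by
  have hrow : ∀ k, ∑ l, ‖greenMinor i A z k l‖ ^ 2 ≤ 3 / η := by
    intro k
    by_cases hk : k = i
    · simp only [greenMinor, hk, true_or, if_true, norm_zero]
      simp
      positivity
    · have hz0 : 0 < z.im := hη.trans_le hz
      have h1 : ‖green (minor i A) z k k‖ ≤ 3 := by simpa [greenMinor, hk] using h k k
      calc ∑ l, ‖greenMinor i A z k l‖ ^ 2 ≤ ∑ l, ‖green (minor i A) z k l‖ ^ 2 := by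
            refine Finset.sum_le_sum fun l _ => ?_
            simp only [greenMinor]
            split_ifs
            · simp
            · rfl
        _ ≤ ‖green (minor i A) z k k‖ / z.im := sum_norm_green_sq_le (minor_isSymm hA i) hz0 k
        _ ≤ 3 / η := by gcongr
  refine ⟨h, hrow, fun l => ?_⟩
  simp_rw [greenMinor_symm hA i z _ l]
  exact hrow l

namespace IsSparseMatrix

theorem measurable_greenMinor_adjacency (hH : IsSparseMatrix P N q K H) (f : ℝ) (w : ℂ)
    (i : Fin N) : Measurable fun ω => greenMinor i (adjacency f (H ω)) w := by
  refine measurable_pi_lambda _ fun k => measurable_pi_lambda _ fun l => ?_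
  refine measurable_greenMinor i (fun k l _ _ => ?_) w k l
  simp_rw [adjacency_apply]
  exact (hH.measurable k l).add_const _

/-- Conditioning on the Green function of the minor reduces everything to deterministic
coefficients. The a priori bound is kept inside the event, since it need not hold almost surely. -/
theorem measureReal_bounded_and_lt_le (hH : IsSparseMatrix P N q K H) (f : ℝ) (w : ℂ) (i : Fin N)
    {F : (Fin N → Fin N → ℂ) → (Fin N → ℝ) → ℂ} (hF : Measurable (Function.uncurry F))
    {η s ε : ℝ} (hε : 0 ≤ ε)
    (h : ∀ g ∈ boundedArrays N η,
      P.real {ω | s < ‖F g (fun k => if k = i then 0 else H ω i k)‖} ≤ ε) :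
    P.real {ω | greenMinor i (adjacency f (H ω)) w ∈ boundedArrays N η ∧
      s < ‖F (greenMinor i (adjacency f (H ω)) w) (fun k => if k = i then 0 else H ω i k)‖} ≤ ε := by
  have hS : MeasurableSet {p : (Fin N → Fin N → ℂ) × (Fin N → ℝ) |
      p.1 ∈ boundedArrays N η ∧ s < ‖F p.1 p.2‖} :=
    (measurable_fst (measurableSet_boundedArrays N η)).inter
      (measurableSet_lt measurable_const hF.norm)
  have hX : Measurable fun ω (k : Fin N) => if k = i then (0 : ℝ) else H ω i k :=
    measurable_pi_lambda _ fun k => (hH.centeredFamily_row i).measurable k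
  refine measureReal_le_of_indepFun (hH.indepFun_greenMinor_row f w i)
    (hH.measurable_greenMinor_adjacency f w i) hX hS hε fun g => ?_
  by_cases hg : g ∈ boundedArrays N η
  · simpa [hg] using h g hg
  · simpa [hg] using hε

variable {η R s f : ℝ} {m : ℕ}

/-- Here `A = 3` and `y = 1 / η`, so `c * y = q ^ 2 / (N * η)`. The hypothesis uses the larger `q ^
2 / √(N * η)`, so that one `R` serves the quadratic form as well. -/
theorem measureReal_linear_le (hH : IsSparseMatrix P N q K H) (hη : 0 < η) (hη1 : 1 ≤ N * η)
    (hR : 0 < R) (hs : 0 < s)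
    (hxR : q ^ 2 / Real.sqrt (N * η) * (Real.exp ((2 * m : ℕ) / R) - 1) ≤ R)
    (f : ℝ) (w : ℂ) (i j : Fin N) :
    P.real {ω | greenMinor i (adjacency f (H ω)) w ∈ boundedArrays N η ∧
      s < ‖∑ k, greenMinor i (adjacency f (H ω)) w j k * ((if k = i then 0 else H ω i k : ℝ) : ℂ)‖} ≤
      (3 * (1 / q) * R / s) ^ (2 * m) := by
  have hN := hH.N_pos
  have hq := hH.q_pos
  refine hH.measureReal_bounded_and_lt_le f w i (F := fun g x => ∑ k, g j k * (x k : ℂ))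
    (by unfold Function.uncurry; fun_prop) (by positivity) fun g hg => ?_
  refine measureReal_lt_norm_le hs m ((hH.centeredFamily_row i).integral_norm_pow_linear_le
    (A := 3) (y := 1 / η) (by norm_num) (by positivity) hR m ?_ (fun k => g j k)
    (fun k => hg.1 j k) ((hg.2.1 j).trans ?_))
  · refine le_trans ?_ hxR
    have h1 : (0 : ℝ) ≤ Real.exp ((2 * m : ℕ) / R) - 1 := by
      rw [sub_nonneg]; exact Real.one_le_exp (by positivity)
    refine mul_le_mul_of_nonneg_right ?_ h1
    rw [div_mul_div_comm, mul_one]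
    gcongr
    rw [Real.sqrt_le_left (by positivity)]
    nlinarith
  · rw [mul_one_div]
    gcongr
    norm_num

/-- With `u = 1 / √(N * η)` the `ℓ²` gain is `N * u ^ 2 = 1 / η`, and the condition on `R` involves
`q ^ 2 / √(N * η)`. -/
theorem measureReal_quadratic_le (hH : IsSparseMatrix P N q K H) (hη : 0 < η)
    (hR : 0 < R) (hs : 0 < s) (hm : 0 < m)
    (hxR : q ^ 2 / Real.sqrt (N * η) * (Real.exp ((2 * m : ℕ) / R) - 1) ≤ R)
    (f : ℝ) (w : ℂ) (i : Fin N) :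
    P.real {ω | greenMinor i (adjacency f (H ω)) w ∈ boundedArrays N η ∧
      s < ‖∑ k, ∑ l, (if k = l then 0 else greenMinor i (adjacency f (H ω)) w k l) *
        ((if k = i then 0 else H ω i k : ℝ) : ℂ) * ((if l = i then 0 else H ω i l : ℝ) : ℂ)‖} ≤
      (4 * 3 * (1 / q) ^ 2 * R ^ 2 / s) ^ (2 * m) := by
  have hN := hH.N_pos
  have hq := hH.q_pos
  have hm1 : ∀ k l : Fin N, Measurable fun p : (Fin N → Fin N → ℂ) × (Fin N → ℝ) =>
      if k = l then 0 else p.1 k l := by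
    intro k l
    split_ifs <;> fun_prop
  refine hH.measureReal_bounded_and_lt_le f w i
    (F := fun g x => ∑ k, ∑ l, (if k = l then 0 else g k l) * (x k : ℂ) * (x l : ℂ))
    (by unfold Function.uncurry; fun_prop) (by positivity) fun g hg => ?_
  have hle : ∀ k l : Fin N, ‖if k = l then 0 else g k l‖ ≤ ‖g k l‖ := by
    intro k l
    split_ifs <;> simp
  have hu : (Fintype.card (Fin N) : ℝ) * (1 / Real.sqrt (N * η)) ^ 2 = 1 / η := by
    rw [Fintype.card_fin, one_div_pow, Real.sq_sqrt (by positivity)]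
    field_simp
  have hη9 : 3 / η ≤ 3 ^ 2 * (Fintype.card (Fin N) * (1 / Real.sqrt (N * η)) ^ 2) := by
    rw [hu, mul_one_div]
    gcongr
    norm_num
  refine measureReal_lt_norm_le hs m ((hH.centeredFamily_row i).integral_norm_pow_quadratic_le
    (A := 3) (u := 1 / Real.sqrt (N * η)) (by norm_num) (by positivity) hR hm ?_
    (fun k l => if k = l then 0 else g k l) (by simp) (fun k l => (hle k l).trans (hg.1 k l))
    (fun k => ?_) (fun l => ?_))
  · convert hxR using 2
    rw [Fintype.card_fin]
    field_simp
  · refine le_trans (Finset.sum_le_sum fun l _ => ?_) ((hg.2.1 k).trans hη9)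
    gcongr
    exact hle k l
  · refine le_trans (Finset.sum_le_sum fun k _ => ?_) ((hg.2.2 l).trans hη9)
    gcongr
    exact hle k l

/-- The diagonal coefficients have no `ℓ²` gain: `y = N`, hence `c * y = 2 * q ^ 2`. -/
theorem measureReal_diagonal_le (hH : IsSparseMatrix P N q K H)
    (hR : 0 < R) (hs : 0 < s)
    (hxR : 2 * q ^ 2 * (Real.exp ((2 * m : ℕ) / R) - 1) ≤ R)
    (η f : ℝ) (w : ℂ) (i : Fin N) :
    P.real {ω | greenMinor i (adjacency f (H ω)) w ∈ boundedArrays N η ∧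
      s < ‖∑ k, greenMinor i (adjacency f (H ω)) w k k *
        ((if k = i then 0 else (if k = i then 0 else H ω i k) ^ 2 - 1 / (N : ℝ) : ℝ) : ℂ)‖} ≤
      (3 * (1 / q ^ 2) * R / s) ^ (2 * m) := by
  have hN := hH.N_pos
  have hq := hH.q_pos
  have hm1 : ∀ k : Fin N, Measurable fun p : (Fin N → Fin N → ℂ) × (Fin N → ℝ) =>
      if k = i then 0 else p.2 k ^ 2 - 1 / (N : ℝ) := by
    intro k
    split_ifs <;> fun_prop
  refine hH.measureReal_bounded_and_lt_le f w i
    (F := fun g x => ∑ k, g k k * ((if k = i then 0 else x k ^ 2 - 1 / (N : ℝ) : ℝ) : ℂ))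
    (by unfold Function.uncurry; fun_prop) (by positivity) fun g hg => ?_
  have h := measureReal_lt_norm_le hs m
    ((hH.centeredFamily_row_sq i).integral_norm_pow_linear_le
    (A := 3) (y := N) (by norm_num) (by positivity) hR m ?_ (fun k => g k k)
    (fun k => hg.1 k k) ?_)
  · refine le_trans (le_of_eq ?_) h
    congr 2
    ext ω
    have : ∀ k : Fin N, (if k = i then 0 else (if k = i then 0 else H ω i k) ^ 2 - 1 / (N : ℝ)) =
        if k = i then 0 else H ω i k ^ 2 - 1 / (N : ℝ) := by
      intro k; split_ifs <;> rfl
    simp_rw [this]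
  · convert hxR using 2
    field_simp
  · calc ∑ k, ‖g k k‖ ^ 2 ≤ ∑ _k : Fin N, (3 : ℝ) ^ 2 := by
          gcongr with k
          exact hg.1 k k
      _ = _ := by simp; ring

theorem norm_sum_row_le {g : Fin N → Fin N → ℂ} (hg : g ∈ boundedArrays N η) (k : Fin N) :
    ‖∑ l, g k l‖ ≤ Real.sqrt (3 * N / η) := by
  refine Real.le_sqrt_of_sq_le ?_
  have h1 : ‖∑ l, g k l‖ ≤ ∑ l, ‖g k l‖ := norm_sum_le _ _
  have h2 := sq_sum_le_card_mul_sum_sq (s := Finset.univ) (f := fun l => ‖g k l‖)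
  rw [Finset.card_univ, Fintype.card_fin] at h2
  calc ‖∑ l, g k l‖ ^ 2 ≤ (∑ l, ‖g k l‖) ^ 2 := by gcongr
    _ ≤ N * (3 / η) := h2.trans (by gcongr; exact hg.2.1 k)
    _ = _ := by ring

/-- Coefficients are bounded by Cauchy–Schwarz on the rows, and `y = N`. The true value of `c * y`
is `q ^ 2`; the factor `2` lets the diagonal sum share its `R`. -/
theorem measureReal_cross_le (hH : IsSparseMatrix P N q K H) (hη : 0 < η) (hf : 0 ≤ f)
    (hR : 0 < R) (hs : 0 < s)
    (hxR : 2 * q ^ 2 * (Real.exp ((2 * m : ℕ) / R) - 1) ≤ R)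
    (w : ℂ) (i : Fin N) :
    P.real {ω | greenMinor i (adjacency f (H ω)) w ∈ boundedArrays N η ∧
      s < ‖∑ k, ((2 * f / N : ℝ) * ∑ l, greenMinor i (adjacency f (H ω)) w k l) *
        ((if k = i then 0 else H ω i k : ℝ) : ℂ)‖} ≤
      (2 * f / N * Real.sqrt (3 * N / η) * (1 / q) * R / s) ^ (2 * m) := by
  have hN := hH.N_pos
  have hq := hH.q_pos
  refine hH.measureReal_bounded_and_lt_le f w i
    (F := fun g x => ∑ k, ((2 * f / N : ℝ) * ∑ l, g k l) * (x k : ℂ))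
    (by unfold Function.uncurry; fun_prop) (by positivity) fun g hg => ?_
  have hle : ∀ k, ‖(2 * f / N : ℝ) * ∑ l, g k l‖ ≤ 2 * f / N * Real.sqrt (3 * N / η) := by
    intro k
    rw [norm_mul, Complex.norm_real, Real.norm_of_nonneg (by positivity)]
    gcongr
    exact norm_sum_row_le hg k
  refine measureReal_lt_norm_le hs m ((hH.centeredFamily_row i).integral_norm_pow_linear_le
    (y := N) (by positivity) (by positivity) hR m ?_
    (fun k => (2 * f / N : ℝ) * ∑ l, g k l) hle ?_)
  · refine le_trans ?_ hxR
    have h1 : (0 : ℝ) ≤ Real.exp ((2 * m : ℕ) / R) - 1 := by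
      rw [sub_nonneg]; exact Real.one_le_exp (by positivity)
    refine mul_le_mul_of_nonneg_right ?_ h1
    rw [div_mul_cancel₀ _ hN.ne']
    nlinarith
  · calc ∑ k, ‖(2 * f / N : ℝ) * ∑ l, g k l‖ ^ 2 ≤
          ∑ _k : Fin N, (2 * f / N * Real.sqrt (3 * N / η)) ^ 2 := by
          gcongr with k
          exact hle k
      _ = _ := by simp; ring

theorem measureReal_diagonal_entry_le (hH : IsSparseMatrix P N q K H) (hq1 : 1 ≤ q) (hs : 0 < s)
    (hm : 2 ≤ m) (i : Fin N) : P.real {ω | s < |H ω i i|} ≤ (1 / q / s) ^ (2 * m) := by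
  have hN := hH.N_pos
  have hq := hH.q_pos
  have h := measureReal_lt_norm_le (P := P) (Z := fun ω => (H ω i i : ℂ)) (B := 1 / q) hs m
    ⟨by simpa using hH.integrable (2 * m) (by omega) i i, by
      simp only [Complex.norm_real, Real.norm_eq_abs]
      refine (hH.moment (2 * m) (by omega) i i).trans ?_
      rw [one_div_pow]
      refine one_div_le_one_div_of_le (by positivity) ?_
      calc q ^ (2 * m) = q ^ 2 * q ^ (2 * m - 2) := by rw [← pow_add]; congr 1; omega
        _ ≤ N * q ^ (2 * m - 2) := by
          gcongr
          exact hH.q_sq_le⟩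
  simpa using h

end IsSparseMatrix

end SparseLocalLaw

/-! ### The self-consistent equation and its stability -/

namespace SparseLocalLaw

variable {N : ℕ}

/-- The normalized trace of the Green function. -/
def normalizedTrace (A : Matrix (Fin N) (Fin N) ℝ) (z : ℂ) : ℂ := (∑ k, green A z k k) / N

/-- The discriminant `m - 1 / m` of the self-consistent equation. -/
def stieltjesGap (z : ℂ) : ℂ := 2 * semicircleStieltjes z + z

/-- Bounds on the fluctuations of the linear and quadratic forms in row `i` of `H`. -/
structure RowBounds (H : Matrix (Fin N) (Fin N) ℝ) (f : ℝ) (z : ℂ) (T : ℝ) (i : Fin N) : Prop where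
  linear : ∀ j, ‖∑ k, greenMinor i (adjacency f H) z j k *
    ((if k = i then 0 else H i k : ℝ) : ℂ)‖ ≤ T / 8
  quadratic : ‖∑ k, ∑ l, (if k = l then 0 else greenMinor i (adjacency f H) z k l) *
    ((if k = i then 0 else H i k : ℝ) : ℂ) * ((if l = i then 0 else H i l : ℝ) : ℂ)‖ ≤ T ^ 2 / 800
  diagonal : ‖∑ k, greenMinor i (adjacency f H) z k k *
    ((if k = i then 0 else (if k = i then 0 else H i k) ^ 2 - 1 / (N : ℝ) : ℝ) : ℂ)‖ ≤
      T ^ 2 / 10000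
  cross : ‖∑ k, ((2 * f / N : ℝ) * ∑ l, greenMinor i (adjacency f H) z k l) *
    ((if k = i then 0 else H i k : ℝ) : ℂ)‖ ≤ T ^ 2 / 10000
  entry : |H i i| ≤ T ^ 2 / 10000

theorem sum_row_mul_greenMinor {H : Matrix (Fin N) (Fin N) ℝ} (hH : H.IsSymm) (f : ℝ) (z : ℂ)
    (i j : Fin N) :
    ∑ m, greenMinor i (adjacency f H) z j m * adjacency f H m i =
      (∑ m, greenMinor i (adjacency f H) z j m * ((if m = i then 0 else H i m : ℝ) : ℂ)) +
        ((f / N : ℝ) : ℂ) * ∑ m, greenMinor i (adjacency f H) z j m := by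
  rw [Finset.mul_sum, ← Finset.sum_add_distrib]
  refine Finset.sum_congr rfl fun m _ => ?_
  by_cases hm : m = i
  · simp [greenMinor, hm]
  · rw [adjacency_apply, if_neg hm, hH.apply i m]
    push_cast
    ring

/-- The quadratic form in the Schur formula splits into off-diagonal fluctuation, diagonal
fluctuation, two equal cross terms with the rank-one part, the pure rank-one term, and the trace of
the minor. -/
theorem sum_quadratic_row {H : Matrix (Fin N) (Fin N) ℝ} (hH : H.IsSymm) (f : ℝ) (z : ℂ)
    (i : Fin N) :
    ∑ k, ∑ m, adjacency f H i k * greenMinor i (adjacency f H) z k m * adjacency f H m i =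
      (∑ k, ∑ l, (if k = l then 0 else greenMinor i (adjacency f H) z k l) *
        ((if k = i then 0 else H i k : ℝ) : ℂ) * ((if l = i then 0 else H i l : ℝ) : ℂ)) +
      (∑ k, greenMinor i (adjacency f H) z k k *
        ((if k = i then 0 else (if k = i then 0 else H i k) ^ 2 - 1 / (N : ℝ) : ℝ) : ℂ)) +
      (∑ k, ((2 * f / N : ℝ) * ∑ l, greenMinor i (adjacency f H) z k l) *
        ((if k = i then 0 else H i k : ℝ) : ℂ)) +
      ((f / N : ℝ) : ℂ) ^ 2 * (∑ k, ∑ l, greenMinor i (adjacency f H) z k l) +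
      (∑ k, greenMinor i (adjacency f H) z k k) / N := by
  set g := greenMinor i (adjacency f H) z with hg
  set X : Fin N → ℂ := fun k => ((if k = i then 0 else H i k : ℝ) : ℂ) with hX
  set φ : ℂ := ((f / N : ℝ) : ℂ) with hφ
  have hsymm : ∀ k l, g k l = g l k := greenMinor_symm (adjacency_isSymm hH f) i z
  have h0 : ∀ k, g k i = 0 := fun k => by simp [hg, greenMinor]
  have h0' : ∀ k, g i k = 0 := fun k => by simp [hg, greenMinor]
  have hterm : ∀ k m, (adjacency f H i k : ℂ) * g k m * adjacency f H m i =
      (if k = m then 0 else g k m) * X k * X m + (if k = m then g k k * X k ^ 2 else 0) +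
        φ * g k m * X k + φ * g m k * X m + φ ^ 2 * g k m := by
    intro k m
    by_cases hk : k = i
    · subst hk; simp [h0, h0']
    by_cases hm : m = i
    · subst hm; simp [h0, h0', hk]
    rw [adjacency_apply, adjacency_apply, hH.apply i m, hsymm m k]
    simp only [hX, if_neg hk, if_neg hm, hφ]
    split_ifs with hkm
    · subst hkm; push_cast; ring
    · push_cast; ring
  have hdiag : ∀ k, g k k * X k ^ 2 =
      g k k * ((if k = i then 0 else (if k = i then 0 else H i k) ^ 2 - 1 / (N : ℝ) : ℝ) : ℂ) +
        g k k / N := by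
    intro k
    by_cases hk : k = i
    · subst hk; simp [h0]
    · simp only [hX, if_neg hk]
      push_cast
      ring
  simp_rw [hterm, Finset.sum_add_distrib]
  have e1 : ∑ k, ∑ m, (if k = m then g k k * X k ^ 2 else 0) = ∑ k, g k k * X k ^ 2 := by simp
  have e2 : ∑ k, ∑ m, φ * g m k * X m = ∑ k, ∑ m, φ * g k m * X k := Finset.sum_comm
  rw [e1, e2]
  simp_rw [hdiag, Finset.sum_add_distrib, ← Finset.sum_div]
  have e3 : ∑ k, ((2 * f / N : ℝ) * ∑ l, g k l) * X k = 2 * ∑ k, ∑ m, φ * g k m * X k := by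
    rw [Finset.mul_sum]
    refine Finset.sum_congr rfl fun k _ => ?_
    rw [← Finset.sum_mul, ← Finset.mul_sum, hφ]
    push_cast
    ring
  have e4 : ∑ k, ∑ l, φ ^ 2 * g k l = φ ^ 2 * ∑ k, ∑ l, g k l := by simp_rw [Finset.mul_sum]
  rw [e3, e4]
  simp only [hX]
  ring

/-- Multiplying by `G i i` turns the rank-one correction between matrix and minor into squares of
entries of `G`, which the Ward identity controls. -/
theorem green_diag_mul_trace_sub {A : Matrix (Fin N) (Fin N) ℝ} (hA : A.IsSymm) {z : ℂ}
    (hz : 0 < z.im) (i : Fin N) :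
    green A z i i * (normalizedTrace A z - (∑ k, greenMinor i A z k k) / N) =
      (∑ k, green A z k i ^ 2) / N := by
  rw [normalizedTrace, ← sub_div, ← Finset.sum_sub_distrib, mul_div_assoc', Finset.mul_sum]
  congr 1
  refine Finset.sum_congr rfl fun k _ => ?_
  by_cases hk : k = i
  · subst hk
    simp [greenMinor]
    ring
  · rw [green_eq_greenMinor_add hA hz hk hk, green_offDiag hA hz hk]
    ring

/-- The approximate self-consistent equation. -/
theorem norm_one_add_green_mul_le {H : Matrix (Fin N) (Fin N) ℝ} (hH : H.IsSymm) {f η T : ℝ}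
    {z : ℂ} (hN : 0 < (N : ℝ)) (hη : 0 < η) (hz : η ≤ z.im) (hf : 0 ≤ f) {i : Fin N}
    (hG : ‖green (adjacency f H) z i i‖ ≤ 3)
    (hg : greenMinor i (adjacency f H) z ∈ boundedArrays N η)
    (hrow : RowBounds H f z T i)
    (hsmall : f / N + f ^ 2 / N * Real.sqrt (3 * N / η) + 1 / (N * η) ≤ T ^ 2 / 2600) :
    ‖1 + green (adjacency f H) z i i * (z + normalizedTrace (adjacency f H) z)‖ ≤ (T / 13) ^ 2 := by
  have hz0 : 0 < z.im := hη.trans_le hz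
  have hA := adjacency_isSymm hH f
  have h1 := green_diag_mul hA hz0 i
  have h2 := green_diag_mul_trace_sub hA hz0 i
  rw [sum_quadratic_row hH, adjacency_apply] at h1
  set A := adjacency f H with hAdef
  set g := greenMinor i A z with hgdef
  have hb1 := hrow.quadratic
  have hb2 := hrow.diagonal
  have hb3 := hrow.cross
  have hb4 := hrow.entry
  rw [← hAdef, ← hgdef] at hb1 hb2 hb3
  set Q := ∑ k, ∑ l, (if k = l then 0 else g k l) *
        ((if k = i then 0 else H i k : ℝ) : ℂ) * ((if l = i then 0 else H i l : ℝ) : ℂ)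
  set D := ∑ k, g k k *
        ((if k = i then 0 else (if k = i then 0 else H i k) ^ 2 - 1 / (N : ℝ) : ℝ) : ℂ)
  set C := ∑ k, ((2 * f / N : ℝ) * ∑ l, g k l) * ((if k = i then 0 else H i k : ℝ) : ℂ)
  set F := ((f / N : ℝ) : ℂ) ^ 2 * (∑ k, ∑ l, g k l) with hF
  set S := (∑ k, g k k) / (N : ℂ)
  set W := (∑ k, green A z k i ^ 2) / (N : ℂ) with hW
  have hFle : ‖F‖ ≤ f ^ 2 / N * Real.sqrt (3 * N / η) := by
    rw [hF, norm_mul, norm_pow, Complex.norm_real, Real.norm_of_nonneg (by positivity)]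
    have : ‖∑ k, ∑ l, g k l‖ ≤ N * Real.sqrt (3 * N / η) := by
      refine (norm_sum_le_of_le _ fun k _ => IsSparseMatrix.norm_sum_row_le hg k).trans ?_
      simp
    calc _ ≤ (f / N) ^ 2 * (N * Real.sqrt (3 * N / η)) := by gcongr
      _ = _ := by field_simp
  have hWle : ‖W‖ ≤ 3 * (1 / (N * η)) := by
    rw [hW, norm_div, Complex.norm_natCast, div_le_iff₀ hN]
    have h3 : ‖∑ k, green A z k i ^ 2‖ ≤ ∑ k, ‖green A z i k‖ ^ 2 :=
      norm_sum_le_of_le _ fun k _ => by rw [norm_pow, green_symm hA z k i]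
    calc _ ≤ ‖green A z i i‖ / z.im := h3.trans (sum_norm_green_sq_le hA hz0 i)
      _ ≤ 3 / η := by gcongr
      _ = _ := by field_simp
  have key : 1 + green A z i i * (z + normalizedTrace A z) =
      green A z i i * ((((H i i + f / N : ℝ) : ℂ)) - Q - D - C - F) + W := by
    linear_combination (-1) * h1 + h2
  have hE : ‖((H i i + f / N : ℝ) : ℂ)‖ ≤ T ^ 2 / 10000 + f / N := by
    rw [Complex.norm_real]
    refine (norm_add_le _ _).trans ?_
    rw [Real.norm_eq_abs, Real.norm_of_nonneg (show 0 ≤ f / N by positivity)]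
    linarith
  have hsum : ‖(((H i i + f / N : ℝ) : ℂ)) - Q - D - C - F‖ ≤
      T ^ 2 / 10000 + f / N + T ^ 2 / 800 + T ^ 2 / 10000 + T ^ 2 / 10000 +
        f ^ 2 / N * Real.sqrt (3 * N / η) := by
    refine (norm_sub_le _ _).trans (add_le_add ((norm_sub_le _ _).trans (add_le_add
      ((norm_sub_le _ _).trans (add_le_add ((norm_sub_le _ _).trans (add_le_add hE hb1)) hb2))
      hb3)) hFle)
  rw [key]
  have hT := sq_nonneg T
  calc _ ≤ 3 * (T ^ 2 / 10000 + f / N + T ^ 2 / 800 + T ^ 2 / 10000 + T ^ 2 / 10000 +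
        f ^ 2 / N * Real.sqrt (3 * N / η)) + 3 * (1 / (N * η)) := by
        refine (norm_add_le _ _).trans (add_le_add ?_ hWle)
        rw [norm_mul]
        gcongr
    -- The budget closes because `3 * (1/800 + 3/10000 + 1/2600) < 1/169`.
    _ ≤ _ := by rw [div_pow]; linarith

theorem stieltjesGap_sq {z : ℂ} (hz : z.im ≠ 0) : ‖stieltjesGap z‖ ^ 2 = ‖z - 2‖ * ‖z + 2‖ := by
  rw [← norm_pow, ← norm_mul]
  congr 1
  rw [stieltjesGap]
  linear_combination 4 * (semicircleStieltjes_spec hz).2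

/-- Stability of the self-consistent equation. -/
theorem stability {z s : ℂ} {δ : ℝ} (hz : z.im ≠ 0) (hδ : 0 < δ)
    (hs : ‖s ^ 2 + z * s + 1‖ ≤ δ ^ 2)
    (hroot : 3 * δ < ‖stieltjesGap z‖ → ‖s - semicircleStieltjes z‖ ≤ ‖stieltjesGap z‖ / 2) :
    ‖s - semicircleStieltjes z‖ ≤ 4 * δ ∧
      (3 * δ < ‖stieltjesGap z‖ → ‖s - semicircleStieltjes z‖ ≤ δ) := by
  have hm := (semicircleStieltjes_spec hz).2
  set m := semicircleStieltjes z
  have hfac : s ^ 2 + z * s + 1 = (s - m) * ((s - m) + stieltjesGap z) := by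
    rw [stieltjesGap]
    linear_combination hm
  rw [hfac, norm_mul] at hs
  have htri : ‖stieltjesGap z‖ ≤ ‖s - m‖ + ‖(s - m) + stieltjesGap z‖ := by
    have := norm_sub_le ((s - m) + stieltjesGap z) (s - m)
    rw [add_sub_cancel_left] at this
    linarith
  have htri' : ‖s - m‖ ≤ ‖stieltjesGap z‖ + ‖(s - m) + stieltjesGap z‖ := by
    have := norm_sub_le ((s - m) + stieltjesGap z) (stieltjesGap z)
    rw [add_sub_cancel_right] at this
    linarith
  -- Well separated roots: `hroot` places `s` nearer to `m` than to the other root, so the second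
  -- factor exceeds `3 * δ / 2`.
  have hlarge : 3 * δ < ‖stieltjesGap z‖ → ‖s - m‖ ≤ δ := by
    intro h
    have h1 := hroot h
    by_contra! h2
    nlinarith [norm_nonneg (s - m)]
  refine ⟨?_, hlarge⟩
  by_cases h : 3 * δ < ‖stieltjesGap z‖
  · linarith [hlarge h]
  -- Nearly merged roots: if `|s - m| > 4 * δ`, the second factor exceeds `δ`, and the product would
  -- be too large whichever root is closer.
  · by_contra! h2
    push Not at h
    nlinarith [norm_nonneg (s - m)]

/-- The a priori bounds at one spectral parameter. -/
structure AprioriBounds (A : Matrix (Fin N) (Fin N) ℝ) (z : ℂ) (δ : ℝ) : Prop where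
  green_le : ∀ k l, ‖green A z k l‖ ≤ 3
  minor_le : ∀ i k l, ‖greenMinor i A z k l‖ ≤ 3
  trace : 3 * δ < ‖stieltjesGap z‖ →
    ‖normalizedTrace A z - semicircleStieltjes z‖ ≤ ‖stieltjesGap z‖ / 2

/-- The improved bounds at one spectral parameter. -/
structure ImprovedBounds (A : Matrix (Fin N) (Fin N) ℝ) (z : ℂ) (T δ : ℝ) : Prop where
  green_sub_le : ∀ k l, ‖green A z k l - semicircleStieltjes z * (if k = l then 1 else 0)‖ ≤ T
  minor_le : ∀ i k l, ‖greenMinor i A z k l‖ ≤ 5 / 2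
  trace : 3 * δ < ‖stieltjesGap z‖ → ‖normalizedTrace A z - semicircleStieltjes z‖ ≤ δ

theorem norm_green_le_two {A : Matrix (Fin N) (Fin N) ℝ} {z : ℂ} {T : ℝ} (hz : z.im ≠ 0)
    (hT1 : T ≤ 1)
    (h : ∀ k l, ‖green A z k l - semicircleStieltjes z * (if k = l then 1 else 0)‖ ≤ T)
    (k l : Fin N) : ‖green A z k l‖ ≤ 2 := by
  have h1 := h k l
  have h2 : ‖semicircleStieltjes z * (if k = l then 1 else 0)‖ ≤ 1 := by
    have := (semicircleStieltjes_spec hz).1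
    split_ifs <;> simp [this.le]
  have h3 := norm_add_le (green A z k l - semicircleStieltjes z * (if k = l then 1 else 0))
    (semicircleStieltjes z * (if k = l then 1 else 0))
  rw [sub_add_cancel] at h3
  linarith

/-- The a priori bounds put the minors in the range of the row bounds. Averaging the self-consistent
equation and stability then control the trace, the same equation the diagonal, and the linear forms
the off-diagonal entries and the minors. -/
theorem improve_bounds {H : Matrix (Fin N) (Fin N) ℝ} (hH : H.IsSymm) {f η T : ℝ}
    {z : ℂ} (hN : 0 < (N : ℝ)) (hη : 0 < η) (hz : η ≤ z.im) (hf : 0 ≤ f) (hT : 0 < T) (hT1 : T ≤ 1)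
    (hap : AprioriBounds (adjacency f H) z (T / 13)) (hrow : ∀ i, RowBounds H f z T i)
    (hsmall : f / N + f ^ 2 / N * Real.sqrt (3 * N / η) + 1 / (N * η) ≤ T ^ 2 / 2600)
    (hsmall' : f / N * Real.sqrt (3 * N / η) ≤ T / 100) :
    ImprovedBounds (adjacency f H) z T (T / 13) := by
  have hz0 : 0 < z.im := hη.trans_le hz
  have hA := adjacency_isSymm hH f
  have hbd : ∀ i, greenMinor i (adjacency f H) z ∈ boundedArrays N η := fun i =>
    greenMinor_mem_boundedArrays hA hη hz (hap.minor_le i)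
  have hself : ∀ i, _ := fun i =>
    norm_one_add_green_mul_le hH hN hη hz hf (hap.green_le i i) (hbd i) (hrow i) hsmall
  have hlin : ∀ i j, ‖∑ m, greenMinor i (adjacency f H) z j m * adjacency f H m i‖ ≤
      T / 8 + T / 100 := by
    intro i j
    rw [sum_row_mul_greenMinor hH]
    refine (norm_add_le _ _).trans (add_le_add ((hrow i).linear j) ?_)
    rw [norm_mul, Complex.norm_real, Real.norm_of_nonneg (by positivity)]
    refine le_trans ?_ hsmall'
    gcongr
    exact IsSparseMatrix.norm_sum_row_le (hbd i) j
  set A := adjacency f H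
  set s := normalizedTrace A z with hs
  obtain ⟨hm1, hm⟩ := semicircleStieltjes_spec hz0.ne'
  set m := semicircleStieltjes z with hmdef
  set δ := T / 13 with hδ
  have hδ0 : 0 < δ := by positivity
  have htr : ‖s ^ 2 + z * s + 1‖ ≤ δ ^ 2 := by
    have hN' : (N : ℂ) ≠ 0 := by exact_mod_cast hN.ne'
    have : s ^ 2 + z * s + 1 = (∑ i, (1 + green A z i i * (z + s))) / N := by
      rw [Finset.sum_add_distrib, ← Finset.sum_mul]
      have h1 : ∑ k, green A z k k = s * N := by
        rw [hs, normalizedTrace, div_mul_cancel₀ _ hN']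
      rw [h1]
      simp
      field_simp
      ring
    rw [this, norm_div, Complex.norm_natCast, div_le_iff₀ hN]
    refine (norm_sum_le_of_le _ fun i _ => hself i).trans ?_
    simp [mul_comm]
  obtain ⟨hst, hst'⟩ := stability hz0.ne' hδ0 htr hap.trace
  rw [← hmdef] at hst hst'
  have hdiag : ∀ i, ‖green A z i i - m‖ ≤ T := by
    intro i
    -- The two terms are at most `12 * δ` and `δ ^ 2`, which explains `δ = T / 13`.
    have : green A z i i - m =
        m * (green A z i i * (s - m)) - m * (1 + green A z i i * (z + s)) := by
      linear_combination green A z i i * hm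
    rw [this]
    have h1 : ‖m * (green A z i i * (s - m))‖ ≤ 1 * (3 * (4 * δ)) := by
      rw [norm_mul, norm_mul]
      gcongr
      exact hap.green_le i i
    have h2 : ‖m * (1 + green A z i i * (z + s))‖ ≤ 1 * δ ^ 2 := by
      rw [norm_mul]
      gcongr
      exact hself i
    refine (norm_sub_le _ _).trans ((add_le_add h1 h2).trans ?_)
    rw [hδ]
    nlinarith
  have hoff : ∀ k i, k ≠ i → ‖green A z k i‖ ≤ T := by
    intro k i hki
    rw [green_offDiag hA hz0 hki, norm_mul, norm_neg]
    calc _ ≤ (T / 8 + T / 100) * 3 := by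
          gcongr
          · exact hlin i k
          · exact hap.green_le i i
      _ ≤ T := by linarith
  have hgs : ∀ k l, ‖green A z k l - m * (if k = l then 1 else 0)‖ ≤ T := by
    intro k l
    by_cases hkl : k = l
    · subst hkl
      simpa using hdiag k
    · simpa [hkl] using hoff k l hkl
  refine ⟨hgs, fun i k l => ?_, hst'⟩
  by_cases hk : k = i
  · simp [greenMinor, hk]; norm_num
  by_cases hl : l = i
  · simp [greenMinor, hl]; norm_num
  have h1 := green_eq_greenMinor_add hA hz0 hk hl
  have h2 : greenMinor i A z k l = green A z k l -
      (∑ m, greenMinor i A z k m * A m i) * (∑ m, greenMinor i A z l m * A m i) *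
        green A z i i := by rw [h1]; ring
  have h3 := norm_green_le_two hz0.ne' hT1 hgs k l
  rw [h2]
  refine (norm_sub_le _ _).trans ?_
  rw [norm_mul, norm_mul]
  have h4 : ‖∑ m, greenMinor i A z k m * A m i‖ * ‖∑ m, greenMinor i A z l m * A m i‖ *
      ‖green A z i i‖ ≤ (T / 8 + T / 100) * (T / 8 + T / 100) * 3 := by
    gcongr
    · exact hlin i k
    · exact hlin i l
    · exact hap.green_le i i
  nlinarith

end SparseLocalLaw

/-! ### Bootstrap from large to small imaginary part -/

namespace SparseLocalLaw

variable {N : ℕ}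

theorem norm_greenMinor_sub_le {A : Matrix (Fin N) (Fin N) ℝ} (hA : A.IsSymm) {z w : ℂ} {η : ℝ}
    (hη : 0 < η) (hz : η ≤ z.im) (hw : η ≤ w.im) (i k l : Fin N) :
    ‖greenMinor i A z k l - greenMinor i A w k l‖ ≤ ‖z - w‖ / η ^ 2 := by
  simp only [greenMinor]
  split_ifs
  · simp; positivity
  · exact norm_green_sub_green_le (minor_isSymm hA i) hη hz hw k l

theorem norm_normalizedTrace_sub_le {A : Matrix (Fin N) (Fin N) ℝ} (hA : A.IsSymm) {z w : ℂ}
    {η : ℝ} (hN : 0 < (N : ℝ)) (hη : 0 < η) (hz : η ≤ z.im) (hw : η ≤ w.im) :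
    ‖normalizedTrace A z - normalizedTrace A w‖ ≤ ‖z - w‖ / η ^ 2 := by
  rw [normalizedTrace, normalizedTrace, ← sub_div, ← Finset.sum_sub_distrib, norm_div,
    Complex.norm_natCast, div_le_iff₀ hN]
  refine (norm_sum_le_of_le _ fun k _ => norm_green_sub_green_le hA hη hz hw k k).trans ?_
  simp [mul_comm]

theorem norm_normalizedTrace_le {A : Matrix (Fin N) (Fin N) ℝ} (hA : A.IsSymm) {z : ℂ}
    (hN : 0 < (N : ℝ)) (hz : 0 < z.im) : ‖normalizedTrace A z‖ ≤ 1 / z.im := by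
  rw [normalizedTrace, norm_div, Complex.norm_natCast, div_le_iff₀ hN]
  refine (norm_sum_le_of_le _ fun k _ => norm_green_le_inv hA hz k k).trans ?_
  simp [mul_comm]

/-- `|gap|² = |z - 2| * |z + 2|`, and both distances grow with the height. Going down, separated
roots at the new point were therefore separated before. -/
theorem norm_stieltjesGap_mono {z w : ℂ} (hre : z.re = w.re) (hz : 0 < z.im) (h : z.im ≤ w.im) :
    ‖stieltjesGap z‖ ≤ ‖stieltjesGap w‖ := by
  have key : ∀ a : ℂ, a.im = 0 → ‖z - a‖ ≤ ‖w - a‖ := by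
    intro a ha
    refine le_of_sq_le_sq ?_ (norm_nonneg _)
    rw [← Complex.normSq_eq_norm_sq, ← Complex.normSq_eq_norm_sq, Complex.normSq_apply,
      Complex.normSq_apply]
    simp only [Complex.sub_re, Complex.sub_im, hre, ha, sub_zero]
    nlinarith
  refine le_of_sq_le_sq ?_ (norm_nonneg _)
  rw [stieltjesGap_sq hz.ne', stieltjesGap_sq (hz.trans_le h).ne']
  have h1 := key 2 (by simp)
  have h2 := key (-2) (by simp)
  rw [sub_neg_eq_add, sub_neg_eq_add] at h2
  gcongr

/-- Continuity costs at most `κ` for each quantity. For the trace, `2 * κ + T / 13 ≤ (3/2) * (T /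
13)`, below half the gap; this fixes the threshold `T / 52`. -/
theorem ImprovedBounds.step {A : Matrix (Fin N) (Fin N) ℝ} (hA : A.IsSymm) {w w' : ℂ} {η T κ : ℝ}
    (hN : 0 < (N : ℝ)) (h : ImprovedBounds A w T (T / 13)) (hη : 0 < η) (hη1 : η ≤ 1)
    (hre : w'.re = w.re) (hw' : η ≤ w'.im) (hle : w'.im ≤ w.im) (hT1 : T ≤ 1)
    (hκ : ‖w' - w‖ / η ^ 2 ≤ κ) (hκ' : κ ≤ T / 52) : AprioriBounds A w' (T / 13) := by
  have hw : η ≤ w.im := hw'.trans hle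
  have hm := (norm_semicircleStieltjes_sub_le hη hw' hw).trans
    (show ‖w' - w‖ / η ≤ ‖w' - w‖ / η ^ 2 by
      gcongr
      nlinarith)
  refine ⟨fun k l => ?_, fun i k l => ?_, fun hgap => ?_⟩
  · have h1 := norm_green_le_two (hη.trans_le hw).ne' hT1 h.green_sub_le k l
    have h2 := norm_green_sub_green_le hA hη hw' hw k l
    have h3 := norm_add_le (green A w' k l - green A w k l) (green A w k l)
    rw [sub_add_cancel] at h3
    linarith
  · have h1 := h.minor_le i k l
    have h2 := norm_greenMinor_sub_le hA hη hw' hw i k l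
    have h3 := norm_add_le (greenMinor i A w' k l - greenMinor i A w k l) (greenMinor i A w k l)
    rw [sub_add_cancel] at h3
    linarith
  · have h0 := norm_stieltjesGap_mono hre (hη.trans_le hw') hle
    have h1 := h.trace (hgap.trans_le h0)
    have h2 := norm_normalizedTrace_sub_le hA hN hη hw' hw
    have h3 := norm_add_le (normalizedTrace A w' - normalizedTrace A w)
      (normalizedTrace A w - semicircleStieltjes w)
    have h4 := norm_sub_le (normalizedTrace A w' - normalizedTrace A w +
      (normalizedTrace A w - semicircleStieltjes w)) (semicircleStieltjes w' - semicircleStieltjes w)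
    have h5 : normalizedTrace A w' - normalizedTrace A w +
      (normalizedTrace A w - semicircleStieltjes w) - (semicircleStieltjes w' - semicircleStieltjes w)
        = normalizedTrace A w' - semicircleStieltjes w' := by ring
    rw [h5] at h4
    linarith

/-- At height `3` all Green functions and `m` are at most `1/3` in norm, while the gap is at least
`3 - 2/3`, so the correct root is selected for every `δ`. -/
theorem aprioriBounds_of_im_eq_three {A : Matrix (Fin N) (Fin N) ℝ} (hA : A.IsSymm) {z : ℂ}
    (hN : 0 < (N : ℝ)) (hz : z.im = 3) (δ : ℝ) : AprioriBounds A z δ := by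
  have hz0 : 0 < z.im := by rw [hz]; norm_num
  have h13 : 1 / z.im = 1 / 3 := by rw [hz]
  refine ⟨fun k l => (norm_green_le_inv hA hz0 k l).trans (by rw [h13]; norm_num),
    fun i k l => ?_, fun _ => ?_⟩
  · simp only [greenMinor]
    split_ifs
    · simp
    · exact (norm_green_le_inv (minor_isSymm hA i) hz0 k l).trans (by rw [h13]; norm_num)
  · have h1 := norm_normalizedTrace_le hA hN hz0
    have h2 := norm_semicircleStieltjes_le hz0
    rw [h13] at h1 h2
    have h3 := norm_sub_le (normalizedTrace A z) (semicircleStieltjes z)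
    have h4 : 3 ≤ ‖z‖ := by
      have := Complex.abs_im_le_norm z
      rw [hz] at this
      exact le_trans (le_abs_self _) this
    have h5 : ‖z‖ ≤ ‖stieltjesGap z‖ + 2 * ‖semicircleStieltjes z‖ := by
      have := norm_sub_le (stieltjesGap z) (2 * semicircleStieltjes z)
      rw [norm_mul, Complex.norm_ofNat] at this
      rw [stieltjesGap] at this ⊢
      rwa [add_sub_cancel_left] at this
    linarith

/-- The point with index `l` of a grid of spectral parameters from `E + 3 * i` down to `z`. -/
def gridPoint (z : ℂ) (M l : ℕ) : ℂ := ⟨z.re, 3 - l * ((3 - z.im) / M)⟩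

theorem le_im_gridPoint {z : ℂ} (hz : z.im ≤ 1) {M l : ℕ} (hl : l ≤ M) :
    z.im ≤ (gridPoint z M l).im := by
  rcases Nat.eq_zero_or_pos M with hM | hM
  · subst hM
    simp [gridPoint]
    linarith
  · have hM' : (0 : ℝ) < M := by exact_mod_cast hM
    have hl' : (l : ℝ) ≤ M := by exact_mod_cast hl
    have h1 : (l : ℝ) * ((3 - z.im) / M) ≤ M * ((3 - z.im) / M) :=
      mul_le_mul_of_nonneg_right hl' (div_nonneg (by linarith) hM'.le)
    rw [mul_div_cancel₀ _ hM'.ne'] at h1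
    simp only [gridPoint]
    linarith

theorem gridPoint_self (z : ℂ) {M : ℕ} (hM : M ≠ 0) : gridPoint z M M = z := by
  have hM' : (M : ℝ) ≠ 0 := by exact_mod_cast hM
  apply Complex.ext
  · rfl
  · simp only [gridPoint]
    rw [mul_div_cancel₀ _ hM']
    ring

theorem norm_gridPoint_succ_sub {z : ℂ} (hz : z.im ≤ 1) (M l : ℕ) :
    ‖gridPoint z M (l + 1) - gridPoint z M l‖ = (3 - z.im) / M := by
  have : gridPoint z M (l + 1) - gridPoint z M l = ((-((3 - z.im) / M) : ℝ) : ℂ) * Complex.I := by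
    apply Complex.ext
    · simp [gridPoint]
    · rw [Complex.im_ofReal_mul]
      simp only [gridPoint, Complex.sub_im, Complex.I_im]
      push_cast
      ring
  rw [this, norm_mul, Complex.norm_I, mul_one, Complex.norm_real, norm_neg, Real.norm_of_nonneg]
  have : 0 ≤ 3 - z.im := by linarith
  positivity

/-- The bootstrap: row bounds on a fine grid imply the local law. -/
theorem local_law_of_rowBounds {H : Matrix (Fin N) (Fin N) ℝ} (hH : H.IsSymm) {f T : ℝ}
    {z : ℂ} (hN : 0 < (N : ℝ)) (hz : 0 < z.im) (hz1 : z.im ≤ 1) (hf : 0 ≤ f) (hT : 0 < T)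
    (hT1 : T ≤ 1)
    (hrow : ∀ l ≤ N ^ 2, ∀ i,
      greenMinor i (adjacency f H) (gridPoint z (N ^ 2) l) ∈ boundedArrays N z.im →
        RowBounds H f (gridPoint z (N ^ 2) l) T i)
    (hsmall : f / N + f ^ 2 / N * Real.sqrt (3 * N / z.im) + 1 / (N * z.im) ≤ T ^ 2 / 2600)
    (hsmall' : f / N * Real.sqrt (3 * N / z.im) ≤ T / 100) (k l : Fin N) :
    ‖green (adjacency f H) z k l - semicircleStieltjes z * (if k = l then 1 else 0)‖ ≤ T := by
  have hA := adjacency_isSymm hH f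
  have himp : ∀ l ≤ N ^ 2, AprioriBounds (adjacency f H) (gridPoint z (N ^ 2) l) (T / 13) →
      ImprovedBounds (adjacency f H) (gridPoint z (N ^ 2) l) T (T / 13) := by
    intro l hl hap
    have him := le_im_gridPoint hz1 hl
    exact improve_bounds hH hN hz him hf hT hT1 hap (fun i => hrow l hl i
      (greenMinor_mem_boundedArrays hA hz him (hap.minor_le i))) hsmall hsmall'
  have hn : 1 / (N * z.im) ≤ T ^ 2 / 2600 := by
    have h1 : 0 ≤ f / N := by positivity
    have h2 : 0 ≤ f ^ 2 / N * Real.sqrt (3 * N / z.im) := by positivity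
    linarith
  have hall : ∀ l ≤ N ^ 2, ImprovedBounds (adjacency f H) (gridPoint z (N ^ 2) l) T (T / 13) := by
    intro l
    induction l with
    | zero =>
      intro h0
      exact himp 0 h0 (aprioriBounds_of_im_eq_three hA hN (by simp [gridPoint]) _)
    | succ l ih =>
      intro hl
      have hl' : l ≤ N ^ 2 := by omega
      -- The grid spacing is at most `3 / N ^ 2`, and the Lipschitz factor `1 / η ^ 2` gives this
      -- `κ`.
      refine himp (l + 1) hl ((ih hl').step hA hN hz hz1 (κ := 3 * (1 / (N * z.im)) ^ 2) rfl
        (le_im_gridPoint hz1 hl) ?_ hT1 ?_ ?_)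
      · simp only [gridPoint]
        have : 0 ≤ (3 - z.im) / ((N ^ 2 : ℕ) : ℝ) := div_nonneg (by linarith) (by positivity)
        push_cast at this ⊢
        linarith
      · rw [norm_gridPoint_succ_sub hz1]
        push_cast
        rw [div_div, one_div_pow, mul_pow, mul_one_div]
        gcongr
        linarith
      · have h0 : 0 ≤ 1 / (N * z.im) := by positivity
        have h1 : T ^ 2 ≤ T := by nlinarith
        have h2 : 1 / (N * z.im) ≤ T / 2600 := hn.trans (by linarith)
        nlinarith
  have hfin := (hall (N ^ 2) le_rfl).green_sub_le k l
  have hN2 : N ^ 2 ≠ 0 := by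
    have : N ≠ 0 := by rintro rfl; simp at hN
    positivity
  rwa [gridPoint_self z hN2] at hfin

end SparseLocalLaw

/-! ### Choice of scales and failure probability of the row bounds -/

namespace SparseLocalLaw

/-- With `v ^ 12 = N * η`, a solution `R` of the moment condition is found in three regimes of `q`
against powers of `v`, always below a multiple of `q * ζ`. -/
theorem exists_poisson_scale {q r p v ζ : ℝ} (hq : 0 < q) (hv : 1 < v) (hr : 10 ≤ r) (hrp : r ≤ p)
    (hp : p ≤ 1.2 * r) (hb : r / v ^ 2 ≤ ζ) (hc : r / (12 * Real.log v * q) ≤ ζ) :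
    ∃ R, 0 < R ∧ q ^ 2 / v ^ 6 * (Real.exp (p / R) - 1) ≤ R ∧ R ≤ 9.6 * q * ζ := by
  have hv0 : 0 < v := by linarith
  have hp0 : 0 < p := by linarith
  have hL : 0 < Real.log v := Real.log_pos hv
  rcases le_or_gt q (v ^ 2) with hqv | hqv
  -- Poisson regime: this choice makes `exp (p / R) = v ^ (3/2)`, beaten by `q ^ 2 / v ^ 6 ≤ v ^
  -- (-2)`. The constant `9.6` is `8 * 1.2`.
  · refine ⟨8 * p / (12 * Real.log v), by positivity, ?_, ?_⟩
    · have h1 : p / (8 * p / (12 * Real.log v)) = Real.log v * (3 / 2) := by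
        field_simp
        norm_num
      rw [h1, Real.exp_mul, Real.exp_log hv0]
      have h2 : Real.log v ≤ 2 * v ^ (1 / 2 : ℝ) := by
        have := Real.log_le_sub_one_of_pos (show 0 < v ^ (1 / 2 : ℝ) by positivity)
        rw [Real.log_rpow hv0] at this
        linarith
      have h3 : v ^ (3 / 2 : ℝ) * v ^ (1 / 2 : ℝ) = v ^ 2 := by
        rw [← Real.rpow_add hv0, ← Real.rpow_natCast]
        norm_num
      have hw : 0 < v ^ (1 / 2 : ℝ) := by positivity
      have hw3 : 0 < v ^ (3 / 2 : ℝ) := by positivity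
      have h4 : q ^ 2 / v ^ 6 ≤ 1 / v ^ 2 := by
        rw [div_le_div_iff₀ (by positivity) (by positivity)]
        calc q ^ 2 * v ^ 2 ≤ (v ^ 2) ^ 2 * v ^ 2 := by gcongr
          _ = 1 * v ^ 6 := by ring
      calc q ^ 2 / v ^ 6 * (v ^ (3 / 2 : ℝ) - 1) ≤ q ^ 2 / v ^ 6 * v ^ (3 / 2 : ℝ) := by
            gcongr
            linarith
        _ ≤ 1 / v ^ 2 * v ^ (3 / 2 : ℝ) := by gcongr
        _ ≤ 8 * p / (12 * Real.log v) := by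
            rw [← h3, div_mul_eq_mul_div, one_mul, div_mul_cancel_left₀ hw3.ne', inv_eq_one_div,
              div_le_div_iff₀ hw (by positivity)]
            nlinarith
    · calc 8 * p / (12 * Real.log v) ≤ 8 * (1.2 * r) / (12 * Real.log v) := by gcongr
        _ = 9.6 * q * (r / (12 * Real.log v * q)) := by
          field_simp
          norm_num
        _ ≤ 9.6 * q * ζ := by gcongr
  · have hbq : r ≤ q * ζ := by
      calc r = v ^ 2 * (r / v ^ 2) := by field_simp
        _ ≤ q * ζ := by gcongr
    rcases le_or_gt (q ^ 2 / v ^ 6) 1 with hX | hX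
    · refine ⟨p, hp0, ?_, ?_⟩
      · rw [div_self hp0.ne']
        have h1 := Real.exp_one_lt_d9
        have h2 : 0 ≤ Real.exp 1 - 1 := by linarith [Real.add_one_le_exp (1 : ℝ)]
        calc q ^ 2 / v ^ 6 * (Real.exp 1 - 1) ≤ 1 * (Real.exp 1 - 1) := by gcongr
          _ ≤ p := by linarith
      · linarith
    · have hqv3 : v ^ 3 < q := by
        rw [one_lt_div (by positivity)] at hX
        have : (v ^ 3) ^ 2 < q ^ 2 := by
          calc (v ^ 3) ^ 2 = v ^ 6 := by ring
            _ < _ := hX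
        exact lt_of_pow_lt_pow_left₀ 2 hq.le this
      -- Large `q ^ 2 / v ^ 6`: now `p / R = v ^ 3 / q ≤ 1`, so the exponential can be linearized.
      refine ⟨p * (q / v ^ 3), by positivity, ?_, ?_⟩
      · have h1 : p / (p * (q / v ^ 3)) = v ^ 3 / q := by field_simp
        rw [h1]
        have h0 : 0 ≤ v ^ 3 / q := by positivity
        have h2 : v ^ 3 / q ≤ 1 := by rw [div_le_one hq]; exact hqv3.le
        have h3 := Real.abs_exp_sub_one_le (x := v ^ 3 / q) (by rwa [abs_of_nonneg h0])
        rw [abs_of_nonneg h0] at h3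
        have h4 := (le_abs_self _).trans h3
        calc q ^ 2 / v ^ 6 * (Real.exp (v ^ 3 / q) - 1) ≤ q ^ 2 / v ^ 6 * (2 * (v ^ 3 / q)) := by
              gcongr
          _ = 2 * (q / v ^ 3) := by field_simp
          _ ≤ p * (q / v ^ 3) := by
              gcongr
              linarith
      · have h5 : q / v ^ 3 ≤ q / v ^ 2 := by
          gcongr
          · exact hv.le
          · norm_num
        calc p * (q / v ^ 3) ≤ (1.2 * r) * (q / v ^ 2) := by gcongr
          _ = 1.2 * q * (r / v ^ 2) := by ring
          _ ≤ 1.2 * q * ζ := by gcongr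
          _ ≤ _ := by
            have : 0 ≤ q * ζ := by linarith
            linarith

/-- The condition `√p ≤ q` keeps `p / R` at most `1`, and then `exp x - 1 ≤ 2 * x` gives the bound.
-/
theorem gaussian_scale {q p : ℝ} (hp : 0 < p) (hq : Real.sqrt p ≤ q) :
    2 * q ^ 2 * (Real.exp (p / (2 * Real.sqrt p * q)) - 1) ≤ 2 * Real.sqrt p * q := by
  have hs : 0 < Real.sqrt p := Real.sqrt_pos.2 hp
  have hq0 : 0 < q := hs.trans_le hq
  have h1 : p / (2 * Real.sqrt p * q) = Real.sqrt p / (2 * q) := by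
    rw [div_eq_div_iff (by positivity) (by positivity)]
    have := Real.mul_self_sqrt hp.le
    linear_combination (-2 * q) * this
  rw [h1]
  have h0 : 0 ≤ Real.sqrt p / (2 * q) := by positivity
  have h2 : Real.sqrt p / (2 * q) ≤ 1 := by
    rw [div_le_one (by positivity)]
    linarith
  have h3 := Real.abs_exp_sub_one_le (x := Real.sqrt p / (2 * q)) (by rwa [abs_of_nonneg h0])
  rw [abs_of_nonneg h0] at h3
  have h4 := (le_abs_self _).trans h3
  calc _ ≤ 2 * q ^ 2 * (2 * (Real.sqrt p / (2 * q))) := by gcongr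
    _ = _ := by field_simp

theorem linear_rate_le {q t ζ R : ℝ} (hq : 0 < q) (ht : 1000 < t) (hζ : 0 < ζ)
    (hR : R ≤ 9.6 * q * ζ) : 3 * (1 / q) * R / (t * ζ / 8) ≤ 1000 / t := by
  have ht0 : 0 < t := by linarith
  rw [div_le_div_iff₀ (by positivity) ht0]
  have h1 : 3 * (1 / q) * R ≤ 3 * (1 / q) * (9.6 * q * ζ) := by gcongr
  have h2 : 3 * (1 / q) * (9.6 * q * ζ) = 28.8 * ζ := by field_simp; norm_num
  rw [h2] at h1
  have h3 : 0 < ζ * t := by positivity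
  have h4 := mul_le_mul_of_nonneg_right h1 ht0.le
  linarith

/-- The raw rate is of order `1 / t ^ 2`; one factor of `t` is given up, using `t > 1000`, to match
the linear rate. -/
theorem quadratic_rate_le {q t ζ R : ℝ} (hq : 0 < q) (ht : 1000 < t) (hζ : 0 < ζ) (hR0 : 0 < R)
    (hR : R ≤ 9.6 * q * ζ) :
    4 * 3 * (1 / q) ^ 2 * R ^ 2 / ((t * ζ) ^ 2 / 800) ≤ 1000 / t := by
  have ht0 : 0 < t := by linarith
  rw [div_le_div_iff₀ (by positivity) ht0]
  have h1 : 4 * 3 * (1 / q) ^ 2 * R ^ 2 ≤ 4 * 3 * (1 / q) ^ 2 * (9.6 * q * ζ) ^ 2 := by gcongr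
  have h2 : 4 * 3 * (1 / q) ^ 2 * (9.6 * q * ζ) ^ 2 = 1105.92 * ζ ^ 2 := by field_simp; norm_num
  rw [h2] at h1
  have h3 : 0 < ζ ^ 2 * t := by positivity
  have h4 := mul_le_mul_of_nonneg_right h1 ht0.le
  have h5 : 1000 * ((t * ζ) ^ 2 / 800) = 1.25 * (ζ ^ 2 * t) * t := by ring
  rw [h5]
  have h6 := mul_lt_mul_of_pos_left ht h3
  linarith

theorem div_sq_le_of_le {t ζ x : ℝ} (ht : 1000 < t) (hζ : 0 < ζ) (hx : x ≤ 20 * ζ ^ 2) :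
    x / ((t * ζ) ^ 2 / 10000) ≤ 1000 / t := by
  have ht0 : 0 < t := by linarith
  rw [div_le_div_iff₀ (by positivity) ht0]
  have h1 := mul_le_mul_of_nonneg_right hx ht0.le
  have h2 : 1000 * ((t * ζ) ^ 2 / 10000) = 0.1 * (ζ ^ 2 * t) * t := by ring
  have h3 : 0 < ζ ^ 2 * t := by positivity
  have h4 := mul_lt_mul_of_pos_left ht h3
  linarith

theorem diagonal_rate_le {q t ζ s : ℝ} (hq : 0 < q) (ht : 1000 < t) (hζ : 0 < ζ)
    (hs : s ≤ 1.2 * (q * ζ ^ 2)) :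
    3 * (1 / q ^ 2) * (2 * s * q) / ((t * ζ) ^ 2 / 10000) ≤ 1000 / t := by
  refine div_sq_le_of_le ht hζ ?_
  have h1 : 3 * (1 / q ^ 2) * (2 * s * q) = 6 * s / q := by field_simp; ring
  rw [h1, div_le_iff₀ hq]
  have : 0 < q * ζ ^ 2 := by positivity
  linarith

theorem cross_rate_le {N q t ζ s f v x r : ℝ} (hN : 0 < N) (hq : 0 < q) (ht : 1000 < t) (hζ : 0 < ζ)
    (hf : 0 ≤ f) (hv : 1 < v) (hs0 : 0 ≤ s) (hr : 0 ≤ r)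
    (hx : x ≤ 1.8 * (N / v ^ 6)) (hs : s ≤ 1.2 * r) (hb : r / v ^ 2 ≤ ζ) (hd : f / v ^ 3 ≤ ζ) :
    2 * f / N * x * (1 / q) * (2 * s * q) / ((t * ζ) ^ 2 / 10000) ≤ 1000 / t := by
  refine div_sq_le_of_le ht hζ ?_
  have hv0 : 0 < v := by linarith
  have hv3 : r / v ^ 3 ≤ r / v ^ 2 := by
    gcongr
    · exact hv.le
    · norm_num
  calc _ ≤ 2 * f / N * (1.8 * (N / v ^ 6)) * (1 / q) * (2 * (1.2 * r) * q) := by gcongr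
    _ = 8.64 * ((f / v ^ 3) * (r / v ^ 3)) := by
      field_simp
      ring
    _ ≤ 8.64 * (ζ * ζ) := by
      gcongr
      exact hv3.trans hb
    _ ≤ _ := by nlinarith [sq_nonneg ζ]

variable {Ω : Type*} [MeasurableSpace Ω] {P : Measure Ω} [IsProbabilityMeasure P] {N : ℕ}
  {q K : ℝ} {H : Ω → Matrix (Fin N) (Fin N) ℝ}

theorem measureReal_le_of_subset_union {S S₂ S₃ S₄ S₅ : Set Ω} {S₁ : Fin N → Set Ω} {ε : ℝ}
    (h₁ : ∀ j, P.real (S₁ j) ≤ ε) (h₂ : P.real S₂ ≤ ε) (h₃ : P.real S₃ ≤ ε) (h₄ : P.real S₄ ≤ ε)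
    (h₅ : P.real S₅ ≤ ε)
    (hS : ∀ ω ∈ S, (∃ j, ω ∈ S₁ j) ∨ ω ∈ S₂ ∨ ω ∈ S₃ ∨ ω ∈ S₄ ∨ ω ∈ S₅) :
    P.real S ≤ (N + 4) * ε := by
  have hsub : S ⊆ (⋃ j ∈ (Finset.univ : Finset (Fin N)), S₁ j) ∪ (S₂ ∪ (S₃ ∪ (S₄ ∪ S₅))) := by
    intro ω hω
    rcases hS ω hω with ⟨j, h⟩ | h
    · exact Or.inl (Set.mem_biUnion (Finset.mem_coe.2 (Finset.mem_univ j)) h)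
    · exact Or.inr h
  have e1 := measureReal_mono (μ := P) hsub
  have e2 := measureReal_union_le (μ := P) (⋃ j ∈ (Finset.univ : Finset (Fin N)), S₁ j)
    (S₂ ∪ (S₃ ∪ (S₄ ∪ S₅)))
  have e3 := measureReal_union_le (μ := P) S₂ (S₃ ∪ (S₄ ∪ S₅))
  have e4 := measureReal_union_le (μ := P) S₃ (S₄ ∪ S₅)
  have e5 := measureReal_union_le (μ := P) S₄ S₅
  have e6 : P.real (⋃ j ∈ (Finset.univ : Finset (Fin N)), S₁ j) ≤ N * ε := by
    refine (measureReal_biUnion_finset_le _ _).trans ?_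
    refine (Finset.sum_le_sum fun j _ => h₁ j).trans ?_
    simp
  linarith

/-- `R` serves the linear and off-diagonal forms, which profit from the `ℓ²` gain; `R'` serves the
diagonal and cross terms, which do not. The factor `N + 4` counts `N` linear forms and four further
events. -/
theorem IsSparseMatrix.measureReal_not_rowBounds_le_of (hH : IsSparseMatrix P N q K H)
    {f T η R R' ε : ℝ} {m : ℕ} (hf : 0 ≤ f) (hq1 : 1 ≤ q) (hη : 0 < η) (hNη : 1 ≤ N * η)
    (hm : 2 ≤ m) (hT : 0 < T) (hR : 0 < R) (hR' : 0 < R')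
    (hxR : q ^ 2 / Real.sqrt (N * η) * (Real.exp ((2 * m : ℕ) / R) - 1) ≤ R)
    (hxR' : 2 * q ^ 2 * (Real.exp ((2 * m : ℕ) / R') - 1) ≤ R')
    (b₁ : 3 * (1 / q) * R / (T / 8) ≤ ε) (b₂ : 4 * 3 * (1 / q) ^ 2 * R ^ 2 / (T ^ 2 / 800) ≤ ε)
    (b₃ : 3 * (1 / q ^ 2) * R' / (T ^ 2 / 10000) ≤ ε)
    (b₄ : 2 * f / N * Real.sqrt (3 * N / η) * (1 / q) * R' / (T ^ 2 / 10000) ≤ ε)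
    (b₅ : 1 / q / (T ^ 2 / 10000) ≤ ε) (w : ℂ) (i : Fin N) :
    P.real {ω | ¬ (greenMinor i (adjacency f (H ω)) w ∈ boundedArrays N η →
      RowBounds (H ω) f w T i)} ≤ (N + 4) * ε ^ (2 * m) := by
  have hN := hH.N_pos
  have hq : 0 < q := hH.q_pos
  have hs1 : 0 < T / 8 := by positivity
  have hs2 : 0 < T ^ 2 / 800 := by positivity
  have hs3 : 0 < T ^ 2 / 10000 := by positivity
  have hpow : ∀ {x : ℝ}, 0 ≤ x → x ≤ ε → x ^ (2 * m) ≤ ε ^ (2 * m) :=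
    fun h0 h1 => pow_le_pow_left₀ h0 h1 _
  refine measureReal_le_of_subset_union
    (fun j => (hH.measureReal_linear_le hη hNη hR hs1 hxR f w i j).trans (hpow (by positivity) b₁))
    ((hH.measureReal_quadratic_le hη hR hs2 (by omega) hxR f w i).trans (hpow (by positivity) b₂))
    ((hH.measureReal_diagonal_le hR' hs3 hxR' η f w i).trans (hpow (by positivity) b₃))
    ((hH.measureReal_cross_le hη hf hR' hs3 hxR' w i).trans (hpow (by positivity) b₄))
    ((hH.measureReal_diagonal_entry_le hq1 hs3 hm i).trans (hpow (by positivity) b₅)) ?_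
  intro ω hω
  by_contra hnot
  push Not at hnot
  obtain ⟨n1, n2, n3, n4, n5⟩ := hnot
  exact hω fun hgood => ⟨fun j => not_lt.1 fun h => n1 j ⟨hgood, h⟩,
    not_lt.1 fun h => n2 ⟨hgood, h⟩, not_lt.1 fun h => n3 ⟨hgood, h⟩,
    not_lt.1 fun h => n4 ⟨hgood, h⟩, not_lt.1 fun h => n5 h⟩

/-- The row bounds fail at `w` with small probability. -/
theorem IsSparseMatrix.measureReal_not_rowBounds_le (hH : IsSparseMatrix P N q K H)
    {f r t ζ v η : ℝ} {m : ℕ} (hf : 0 ≤ f) (hq1 : 1 ≤ q) (hη : 0 < η) (hv : 1 < v)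
    (hNη : N * η = v ^ 12)
    (hr : 10 ≤ r) (hrm : r ≤ (2 * m : ℕ)) (hmr : (2 * m : ℕ) ≤ 1.2 * r) (ht : 1000 < t)
    (hζ : 0 < ζ) (ha : Real.sqrt r / q ≤ ζ ^ 2) (hb : r / v ^ 2 ≤ ζ)
    (hc : r / (12 * Real.log v * q) ≤ ζ) (hd : f / v ^ 3 ≤ ζ) (hT1 : t * ζ ≤ 1) (w : ℂ)
    (i : Fin N) :
    P.real {ω | ¬ (greenMinor i (adjacency f (H ω)) w ∈ boundedArrays N η →
      RowBounds (H ω) f w (t * ζ) i)} ≤ (N + 4) * (1000 / t) ^ (2 * m) := by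
  have hN := hH.N_pos
  have hq : 0 < q := hH.q_pos
  have hv0 : 0 < v := by linarith
  have ht0 : 0 < t := by linarith
  have hT : 0 < t * ζ := by positivity
  set p : ℝ := ((2 * m : ℕ) : ℝ) with hp
  have hp0 : 0 < p := by linarith
  have hm2 : 2 ≤ m := by
    by_contra! h
    have h1 : ((2 * m : ℕ) : ℝ) ≤ 2 := by exact_mod_cast (by omega : 2 * m ≤ 2)
    linarith
  have hsqrt : Real.sqrt (N * η) = v ^ 6 := by
    rw [hNη, show v ^ 12 = (v ^ 6) ^ 2 by ring, Real.sqrt_sq (by positivity)]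
  have hsqrt3 : Real.sqrt (3 * N / η) ≤ 1.8 * (N / v ^ 6) := by
    rw [Real.sqrt_le_left (by positivity)]
    have : η = v ^ 12 / N := by rw [eq_div_iff hN.ne']; linarith
    rw [this]
    have h1 : 3 * (N : ℝ) / (v ^ 12 / N) = 3 * (N / v ^ 6) ^ 2 := by
      field_simp
    rw [h1, mul_pow]
    gcongr
    norm_num
  obtain ⟨R, hR, hxR, hRle⟩ := exists_poisson_scale hq hv hr hrm hmr hb hc
  rw [← hsqrt] at hxR
  have hζ1 : ζ ≤ 1 / 1000 := by
    rw [le_div_iff₀ (by norm_num)]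
    nlinarith
  have hsp : Real.sqrt p ≤ 1.2 * Real.sqrt r := by
    rw [Real.sqrt_le_left (by positivity), mul_pow, Real.sq_sqrt (by linarith)]
    linarith
  have hsr : Real.sqrt r ≤ q * ζ ^ 2 := by
    rw [div_le_iff₀ hq] at ha
    linarith
  have hspq : Real.sqrt p ≤ 1.2 * (q * ζ ^ 2) := hsp.trans (by gcongr)
  have hspq' : Real.sqrt p ≤ q := by
    have : ζ ^ 2 ≤ 1 / 1000 := by nlinarith
    nlinarith
  have hR' : 0 < 2 * Real.sqrt p * q := by
    have := Real.sqrt_pos.2 hp0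
    positivity
  have hxR' := gaussian_scale hp0 hspq'
  have hps : Real.sqrt p ≤ 1.2 * r := by
    refine le_trans ?_ hmr
    rw [Real.sqrt_le_left hp0.le]
    nlinarith
  have hq' : 1 / q ≤ ζ ^ 2 := by
    have : 1 ≤ Real.sqrt r := by rw [Real.one_le_sqrt]; linarith
    calc 1 / q ≤ Real.sqrt r / q := by gcongr
      _ ≤ ζ ^ 2 := ha
  exact hH.measureReal_not_rowBounds_le_of hf hq1 hη (by rw [hNη]; exact one_le_pow₀ hv.le) hm2 hT
    hR hR' hxR hxR' (linear_rate_le hq ht hζ hRle) (quadratic_rate_le hq ht hζ hR hRle)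
    (diagonal_rate_le hq ht hζ hspq)
    (cross_rate_le hN hq ht hζ hf hv (Real.sqrt_nonneg _) (by linarith)
      hsqrt3 hps hb hd)
    (div_sq_le_of_le ht hζ (hq'.trans (by nlinarith [sq_nonneg ζ]))) w i

end SparseLocalLaw

/-! ### The tail bound for general `r` and `t` -/

namespace SparseLocalLaw

variable {Ω : Type*} [MeasurableSpace Ω] {P : Measure Ω} [IsProbabilityMeasure P] {N : ℕ}
  {q K : ℝ} {H : Ω → Matrix (Fin N) (Fin N) ℝ}

/-- The deterministic errors are products of two of the quantities `f / v ^ 3` and `1 / v ^ 2`, each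
at most `ζ`; the large constants are absorbed by `t > 1000`. -/
theorem local_law_smallness {N η f v ζ t : ℝ} (hN : 0 < N) (hη1 : η ≤ 1)
    (hNη : N * η = v ^ 12) (hv : 1 < v) (hf : 0 ≤ f) (ht : 1000 < t) (hζ : 0 < ζ)
    (hb : 10 / v ^ 2 ≤ ζ) (hd : f / v ^ 3 ≤ ζ) :
    f / N + f ^ 2 / N * √(3 * N / η) + 1 / (N * η) ≤ (t * ζ) ^ 2 / 2600 ∧
      f / N * √(3 * N / η) ≤ t * ζ / 100 := by
  have hv0 : 0 < v := by linarith
  have hx : √(3 * N / η) ≤ 2 * (N / v ^ 6) := by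
    rw [Real.sqrt_le_left (by positivity)]
    have h0 : η = v ^ 12 / N := by rw [eq_div_iff hN.ne']; linarith
    have h1 : 3 * N / (v ^ 12 / N) = 3 * (N / v ^ 6) ^ 2 := by field_simp
    rw [h0, h1, mul_pow]
    gcongr
    norm_num
  have hvN : v ^ 12 ≤ N := by
    rw [← hNη]
    exact mul_le_of_le_one_right hN.le hη1
  have hv2 : 1 / v ^ 2 ≤ ζ := by
    refine le_trans ?_ hb
    gcongr
    norm_num
  have hd0 : 0 ≤ f / v ^ 3 := by positivity
  have ht2 : 2600 * (4 * ζ ^ 2) ≤ (t * ζ) ^ 2 := by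
    rw [mul_pow]
    have h1 : (1000 : ℝ) ^ 2 ≤ t ^ 2 := by gcongr
    have h2 : 0 < ζ ^ 2 := by positivity
    have h3 := mul_le_mul_of_nonneg_right h1 h2.le
    linarith
  have e1 : f / N ≤ ζ * ζ := by
    calc f / N ≤ f / v ^ 12 := by gcongr
      _ ≤ f / v ^ 5 := by
        gcongr
        · exact hv.le
        · norm_num
      _ = f / v ^ 3 * (1 / v ^ 2) := by field_simp
      _ ≤ ζ * ζ := by gcongr
  have e2 : f ^ 2 / N * √(3 * N / η) ≤ 2 * (ζ * ζ) := by
    calc f ^ 2 / N * √(3 * N / η) ≤ f ^ 2 / N * (2 * (N / v ^ 6)) := by gcongr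
      _ = 2 * (f / v ^ 3 * (f / v ^ 3)) := by field_simp
      _ ≤ _ := by gcongr
  have e3 : 1 / (N * η) ≤ ζ * ζ := by
    rw [hNη]
    calc 1 / v ^ 12 ≤ 1 / v ^ 4 := by
          gcongr
          · exact hv.le
          · norm_num
      _ = 1 / v ^ 2 * (1 / v ^ 2) := by field_simp
      _ ≤ _ := by gcongr
  have e4 : f / N * √(3 * N / η) ≤ 2 * ζ := by
    calc f / N * √(3 * N / η) ≤ f / N * (2 * (N / v ^ 6)) := by gcongr
      _ = 2 * (f / v ^ 6) := by field_simp
      _ ≤ 2 * (f / v ^ 3) := by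
        gcongr
        · exact hv.le
        · norm_num
      _ ≤ _ := by gcongr
  constructor
  · rw [le_div_iff₀ (by norm_num)]
    linarith [sq ζ]
  · rw [le_div_iff₀ (by norm_num)]
    have := mul_lt_mul_of_pos_right ht hζ
    linarith

theorem maxError_le [NeZero N] {A : Matrix (Fin N) (Fin N) ℝ} {z : ℂ} {T : ℝ}
    (h : ∀ k l, ‖green A z k l - semicircleStieltjes z * (if k = l then 1 else 0)‖ ≤ T) :
    maxError A z ≤ T :=
  ciSup_le fun p => h p.1 p.2

/-- Union bound over the grid points and rows, using that the bootstrap is deterministic once every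
row bound holds. -/
theorem IsSparseMatrix.measureReal_maxError_gt_le (hH : IsSparseMatrix P N q K H)
    {f r t ζ v : ℝ} {z : ℂ} {m : ℕ} (hz : 0 < z.im) (hz1 : z.im ≤ 1) (hf : 0 ≤ f) (hq1 : 1 ≤ q)
    (hv : 1 < v) (hNη : N * z.im = v ^ 12) (hr : 10 ≤ r) (hrm : r ≤ (2 * m : ℕ))
    (hmr : (2 * m : ℕ) ≤ 1.2 * r) (ht : 1000 < t) (hζ : 0 < ζ) (ha : Real.sqrt r / q ≤ ζ ^ 2)
    (hb : r / v ^ 2 ≤ ζ) (hc : r / (12 * Real.log v * q) ≤ ζ) (hd : f / v ^ 3 ≤ ζ)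
    (hT1 : t * ζ ≤ 1) :
    P.real {ω | maxError (adjacency f (H ω)) z > t * ζ} ≤
      ((N : ℝ) ^ 2 + 1) * N * (N + 4) * (1000 / t) ^ (2 * m) := by
  have hN := hH.N_pos
  have : NeZero N := ⟨by rintro rfl; simp at hN⟩
  have hT : 0 < t * ζ := by positivity
  obtain ⟨hs, hs'⟩ := local_law_smallness hN hz1 hNη hv hf ht hζ
    (le_trans (by gcongr) hb) hd
  have hsub : {ω | maxError (adjacency f (H ω)) z > t * ζ} ⊆
      ⋃ p ∈ (Finset.range (N ^ 2 + 1) ×ˢ (Finset.univ : Finset (Fin N))),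
        {ω | ¬ (greenMinor p.2 (adjacency f (H ω)) (gridPoint z (N ^ 2) p.1) ∈
          boundedArrays N z.im → RowBounds (H ω) f (gridPoint z (N ^ 2) p.1) (t * ζ) p.2)} := by
    intro ω hω
    by_contra hnot
    refine absurd (maxError_le (local_law_of_rowBounds (hH.symm ω) hN hz hz1 hf hT hT1 ?_ hs hs'))
      (not_le.2 hω)
    intro l hl i
    by_contra h
    exact hnot (Set.mem_biUnion (x := (l, i)) (by simp; omega) h)
  refine (measureReal_mono hsub (measure_ne_top P _)).trans ((measureReal_biUnion_finset_le _ _).trans ?_)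
  refine (Finset.sum_le_sum fun p _ => hH.measureReal_not_rowBounds_le hf hq1 hz hv hNη hr hrm
    hmr ht hζ ha hb hc hd hT1 (gridPoint z (N ^ 2) p.1) p.2).trans ?_
  simp [Finset.card_product]
  ring_nf
  rfl

/-- The twelfth root makes the exponents `1/6` and `1/4` integral. -/
theorem zeta_pow_twelve {r q f η v : ℝ} (hN : 0 < (N : ℝ)) (hη : 0 < η) (hv : 0 < v)
    (hNη : N * η = v ^ 12) :
    zeta N r q η f = (r / q ^ 2) ^ (1 / 4 : ℝ) + r / v ^ 2 + r / (12 * Real.log v * q)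
      + f / v ^ 3 := by
  have h1 : Real.log η + Real.log N = 12 * Real.log v := by
    rw [add_comm, ← Real.log_mul hN.ne' hη.ne', hNη, Real.log_pow]
    norm_num
  have h2 : (v ^ 12) ^ (1 / 6 : ℝ) = v ^ 2 := by
    rw [← Real.rpow_natCast, ← Real.rpow_mul hv.le, ← Real.rpow_natCast]
    norm_num
  have h3 : (v ^ 12) ^ (1 / 4 : ℝ) = v ^ 3 := by
    rw [← Real.rpow_natCast, ← Real.rpow_mul hv.le, ← Real.rpow_natCast]
    norm_num
  rw [zeta, h1, hNη, h2, h3]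

theorem IsSparseMatrix.local_law (hH : IsSparseMatrix P N q K H) {f r t : ℝ} {z : ℂ}
    (hf : 0 ≤ f) (hz : z ∈ spectralDomain N) (hr : 10 ≤ r) (hq1 : 1 ≤ q) (ht : 0 < t)
    (hT : t * zeta N r q z.im f ≤ 1) :
    P.real {ω | maxError (adjacency f (H ω)) z > t * zeta N r q z.im f} ≤
      (N : ℝ) ^ 5 * (Cstar / t) ^ r := by
  have hN := hH.N_pos
  have hN1 : (1 : ℝ) ≤ N := by exact_mod_cast (by exact_mod_cast hN : 0 < N)
  rcases le_or_gt t 1000 with ht' | ht'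
  · refine measureReal_le_one.trans ?_
    have h1 : 1 ≤ Cstar / t := by rw [Cstar, one_le_div ht]; exact ht'
    exact one_le_mul_of_one_le_of_one_le (one_le_pow₀ hN1)
      (Real.one_le_rpow h1 (by linarith))
  obtain ⟨hz0, hz1⟩ := hz
  have hη : 0 < z.im := (inv_pos.2 hN).trans hz0
  have hn : 1 < N * z.im := by
    rwa [inv_lt_iff_one_lt_mul₀' hN] at hz0
  obtain ⟨v, hv, hNη⟩ : ∃ v : ℝ, 1 < v ∧ N * z.im = v ^ 12 := by
    refine ⟨(N * z.im) ^ (1 / 12 : ℝ), Real.one_lt_rpow hn (by norm_num), ?_⟩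
    rw [← Real.rpow_natCast, ← Real.rpow_mul (by linarith)]
    norm_num
  have hv0 : 0 < v := by linarith
  have hq : 0 < q := by linarith
  have hlog : 0 < Real.log v := Real.log_pos hv
  have hr0 : 0 < r := by linarith
  have hz := zeta_pow_twelve (r := r) (q := q) (f := f) hN hη hv0 hNη
  generalize zeta N r q z.im f = ζ at hT hz ⊢
  have ha : 0 < (r / q ^ 2) ^ (1 / 4 : ℝ) := by positivity
  have hb : 0 < r / v ^ 2 := by positivity
  have hc : 0 < r / (12 * Real.log v * q) := by positivity
  have hd : 0 ≤ f / v ^ 3 := by positivity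
  have hζ : 0 < ζ := by linarith
  have ha2 : Real.sqrt r / q ≤ ζ ^ 2 := by
    have h1 : Real.sqrt r / q = ((r / q ^ 2) ^ (1 / 4 : ℝ)) ^ 2 := by
      rw [← Real.rpow_natCast, ← Real.rpow_mul (by positivity)]
      norm_num
      rw [← Real.sqrt_eq_rpow, Real.sqrt_div' _ (by positivity), Real.sqrt_sq hq.le]
    rw [h1]
    exact pow_le_pow_left₀ ha.le (by linarith) 2
  have hb2 : r / v ^ 2 ≤ ζ := by linarith
  -- An even moment order is needed; rounding up costs less than `2`, at most `0.2 * r` because `r ≥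
  -- 10`.
  have hm : r ≤ (2 * ⌈r / 2⌉₊ : ℕ) ∧ (2 * ⌈r / 2⌉₊ : ℕ) ≤ 1.2 * r := by
    have h1 := Nat.le_ceil (r / 2)
    have h2 := Nat.ceil_lt_add_one (show 0 ≤ r / 2 by positivity)
    push_cast
    constructor <;> linarith
  obtain ⟨hm1, hm2⟩ := hm
  generalize ⌈r / 2⌉₊ = m at hm1 hm2
  refine (hH.measureReal_maxError_gt_le hη hz1 hf hq1 hv hNη hr hm1 hm2 ht' hζ ha2 hb2
    (by linarith) (by linarith) hT).trans ?_
  -- Since `ζ ≤ 1` forces `v ^ 2 ≥ r ≥ 10`, `N` is large enough for the factor `4 * N ^ 4` of the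
  -- union bound to be absorbed in `N ^ 5`.
  have hN10 : (10 : ℝ) ≤ N := by
    have h1 : 10 ≤ v ^ 2 := by
      rw [div_le_iff₀ (by positivity)] at hb2
      have h3 : ζ ≤ 1 := by nlinarith
      have h4 := mul_le_mul_of_nonneg_right h3 (sq_nonneg v)
      linarith
    have h2 : v ^ 2 ≤ v ^ 12 := pow_le_pow_right₀ hv.le (by norm_num)
    have h3 : (N : ℝ) * z.im ≤ N := mul_le_of_le_one_right hN.le hz1
    linarith
  have h1 : (1000 / t) ^ (2 * m) ≤ (Cstar / t) ^ r := by
    rw [← Real.rpow_natCast, Cstar]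
    exact Real.rpow_le_rpow_of_exponent_ge (by positivity) ((div_le_one ht).2 ht'.le) hm1
  have h2 : ((N : ℝ) ^ 2 + 1) * N * (N + 4) ≤ (N : ℝ) ^ 5 := by
    have e1 : (N : ℝ) ^ 2 + 1 ≤ 2 * N ^ 2 := by nlinarith
    have e2 : (N : ℝ) + 4 ≤ 2 * N := by linarith
    calc ((N : ℝ) ^ 2 + 1) * N * (N + 4) ≤ (2 * N ^ 2) * N * (2 * N) := by gcongr
      _ = 4 * (N : ℝ) ^ 4 := by ring
      _ ≤ N * (N : ℝ) ^ 4 := by gcongr; linarith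
      _ = _ := by ring
  gcongr

end SparseLocalLaw

/-! ### The high-probability statement -/

namespace SparseLocalLaw

/-- The tangent of the logarithm at `exp 10` gives `20 * log x ≤ 200 * x / exp 10`, and `exp 10 >
1600`. -/
theorem pow_twenty_le_exp {x : ℝ} (hx : Real.exp 10 ≤ x) : x ^ 20 ≤ Real.exp (x / 8) := by
  have he : (2.7 : ℝ) ≤ Real.exp 1 := by linarith [Real.exp_one_gt_d9]
  have h10 : Real.exp 10 = Real.exp 1 ^ 10 := by rw [← Real.exp_nat_mul]; norm_num
  have hx0 : 0 < x := (Real.exp_pos _).trans_le hx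
  set c : ℝ := Real.exp 10 with hc
  have hc0 : 0 < c := Real.exp_pos _
  have hcb : (2.7 : ℝ) ^ 10 ≤ c := by rw [h10]; gcongr
  have hlog : Real.log x ≤ 10 + x / c - 1 := by
    have h1 := Real.log_le_sub_one_of_pos (show 0 < x / c by positivity)
    rw [Real.log_div hx0.ne' hc0.ne', hc, Real.log_exp] at h1
    linarith
  rw [← Real.exp_log (show 0 < x ^ 20 by positivity), Real.log_pow]
  apply Real.exp_le_exp.2
  have h2 : 1 ≤ x / c := (one_le_div hc0).2 hx
  have h3 : x = x / c * c := by field_simp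
  have h4 : x / c * 2.7 ^ 10 ≤ x / c * c := by gcongr
  push_cast
  norm_num at h4
  linarith

/-- With `y = √(log N)` each of the four terms is at most `1 / c`: the size of `q` handles the
first, `N * η ≥ exp y` the second and fourth, and both together the third. -/
theorem zeta_le_of_large {N : ℕ} {q f η y c : ℝ} (hη : 0 < η) (hc : 1 ≤ c)
    (hy : Real.exp 10 ≤ y) (hcy : Real.log c ≤ y / 24) (hyN : Real.log N = y ^ 2) (hf : 0 ≤ f)
    (hfy : f ≤ y ^ 20) (hq : c ^ 2 * y ≤ q) (hNη : Real.exp y ≤ N * η) :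
    zeta N (Real.log N) q η f ≤ 4 / c := by
  have hy0 : 0 < y := (Real.exp_pos _).trans_le hy
  have hy1 : 1 ≤ y := (Real.one_le_exp (by norm_num)).trans hy
  have hc0 : 0 < c := by linarith
  have hq0 : 0 < q := lt_of_lt_of_le (by positivity) hq
  have hn0 : 0 < N * η := (Real.exp_pos _).trans_le hNη
  have hN : (N : ℝ) ≠ 0 := by rintro h; simp [h] at hn0
  have hexp : ∀ s : ℝ, 0 < s → Real.exp (y * s) ≤ (N * η) ^ s := fun s hs => by
    rw [Real.exp_mul]
    exact Real.rpow_le_rpow (Real.exp_pos _).le hNη hs.le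
  -- The exponent budget is `1/8 + 1/24 = 1/6`: polynomial growth up to `y ^ 20` and the factor `c`
  -- are both paid for by the weakest power of `N * η`.
  have hbig : ∀ x s : ℝ, 0 ≤ x → x ≤ y ^ 20 → 1 / 6 ≤ s → x / (N * η) ^ s ≤ 1 / c := by
    intro x s hx0 hx hs
    have h1 : x ≤ Real.exp (y / 8) := hx.trans (pow_twenty_le_exp hy)
    have h2 : c ≤ Real.exp (y / 24) := by
      rw [← Real.exp_log hc0]
      exact Real.exp_le_exp.2 hcy
    rw [div_le_div_iff₀ (by positivity) hc0, one_mul]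
    calc x * c ≤ Real.exp (y / 8) * Real.exp (y / 24) := by gcongr
      _ = Real.exp (y * (1 / 6)) := by rw [← Real.exp_add]; ring_nf
      _ ≤ Real.exp (y * s) := by gcongr
      _ ≤ _ := hexp s (by linarith)
  have e1 : (y ^ 2 / q ^ 2) ^ (1 / 4 : ℝ) ≤ 1 / c := by
    have h1 : y ^ 2 / q ^ 2 ≤ (1 / c) ^ 4 := by
      rw [div_pow, one_pow, div_le_div_iff₀ (by positivity) (by positivity)]
      calc y ^ 2 * c ^ 4 = (c ^ 2 * y) ^ 2 := by ring
        _ ≤ q ^ 2 := by gcongr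
        _ = _ := by ring
    calc (y ^ 2 / q ^ 2) ^ (1 / 4 : ℝ) ≤ ((1 / c) ^ 4) ^ (1 / 4 : ℝ) := by gcongr
      _ = 1 / c := by
        rw [← Real.rpow_natCast, ← Real.rpow_mul (by positivity)]
        norm_num
  have e2 : y ^ 2 / (N * η) ^ (1 / 6 : ℝ) ≤ 1 / c :=
    hbig _ _ (by positivity) (pow_le_pow_right₀ hy1 (by norm_num)) le_rfl
  have e3 : y ^ 2 / ((Real.log η + y ^ 2) * q) ≤ 1 / c := by
    have h1 : y ≤ Real.log η + y ^ 2 := by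
      rw [← hyN, add_comm, ← Real.log_mul hN hη.ne']
      exact (Real.le_log_iff_exp_le hn0).2 hNη
    have h2 := hy0.le.trans h1
    calc y ^ 2 / ((Real.log η + y ^ 2) * q) ≤ y ^ 2 / (y * (c ^ 2 * y)) := by gcongr
      _ = 1 / c ^ 2 := by field_simp
      _ ≤ 1 / c := by
        gcongr
        exact le_self_pow₀ hc (by norm_num)
  have e4 : f / (N * η) ^ (1 / 4 : ℝ) ≤ 1 / c := hbig _ _ hf hfy (by norm_num)
  have e5 : 4 / c = 1 / c + 1 / c + 1 / c + 1 / c := by ring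
  rw [zeta, hyN, e5]
  gcongr

theorem IsSparseMatrix.local_law_high_probability {Ω : Type*} [MeasurableSpace Ω] {P : Measure Ω}
    [IsProbabilityMeasure P] {N : ℕ} {q K : ℝ} {H : Ω → Matrix (Fin N) (Fin N) ℝ}
    (hH : IsSparseMatrix P N q K H) {f D δ : ℝ} {z : ℂ} (hf : 0 ≤ f) (hfq : f ≤ q)
    (hz : z ∈ spectralDomain N) (hD : 0 < D) (hδ : 0 < δ) (hδ1 : δ < 1)
    (hq : constC δ D * Real.sqrt (Real.log N) ≤ q) (hqN : q ≤ Real.log N ^ 10)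
    (hN0 : constN0 δ D ≤ N) (hη : (N : ℝ) ^ (-1 + Real.log N ^ (-1 / 2 : ℝ)) ≤ z.im) :
    1 - (N : ℝ) ^ (-D) ≤ P.real {ω | maxError (adjacency f (H ω)) z ≤ δ} := by
  have hN := hH.N_pos
  rw [constC] at hq
  rw [constN0] at hN0
  have htδ : Cstar * Real.exp (5 + D) = 4 * Cstar * Real.exp (5 + D) / δ * δ / 4 := by
    field_simp
  have hc : Real.exp 1 ≤ 4 * Cstar * Real.exp (5 + D) / δ := by
    rw [le_div_iff₀ hδ, Cstar]
    have h1 : Real.exp 1 ≤ Real.exp (5 + D) := Real.exp_le_exp.2 (by linarith)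
    calc Real.exp 1 * δ ≤ Real.exp 1 * 1 := by gcongr
      _ ≤ 4 * 1000 * Real.exp (5 + D) := by linarith [Real.exp_pos 1]
  generalize 4 * Cstar * Real.exp (5 + D) / δ = c at hq hN0 htδ hc
  have hc1 : 1 ≤ c := (Real.one_le_exp (by norm_num)).trans hc
  have hc0 : 0 < c := by linarith
  have hlogc : 1 ≤ Real.log c := (Real.le_log_iff_exp_le hc0).2 hc
  have he : (24 : ℝ) ≤ Real.exp 10 := by
    have h1 : (2 : ℝ) ≤ Real.exp 1 := by linarith [Real.exp_one_gt_d9]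
    have h2 : Real.exp 10 = Real.exp 1 ^ 10 := by rw [← Real.exp_nat_mul]; norm_num
    have h3 : (2 : ℝ) ^ 10 ≤ Real.exp 1 ^ 10 := by gcongr
    linarith
  have hlogN : (Real.exp 10 * Real.log c) ^ 2 ≤ Real.log N := (Real.le_log_iff_exp_le hN).2 hN0
  have hlog0 : 0 ≤ Real.log N := (sq_nonneg _).trans hlogN
  obtain ⟨y, hy0, hyN⟩ : ∃ y : ℝ, 0 ≤ y ∧ Real.log N = y ^ 2 :=
    ⟨Real.sqrt (Real.log N), Real.sqrt_nonneg _, (Real.sq_sqrt hlog0).symm⟩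
  have hcy : Real.exp 10 * Real.log c ≤ y := by
    rw [hyN] at hlogN
    exact le_of_sq_le_sq hlogN hy0
  have hy : Real.exp 10 ≤ y := le_trans (le_mul_of_one_le_right (Real.exp_pos _).le hlogc) hcy
  have hcy' : Real.log c ≤ y / 24 := by
    rw [le_div_iff₀ (by norm_num)]
    nlinarith
  have hy' : 0 < y := by linarith
  have hNη : Real.exp y ≤ N * z.im := by
    have h1 : (N : ℝ) ^ (-1 + Real.log N ^ (-1 / 2 : ℝ)) = Real.exp (-y ^ 2 + y) := by
      rw [Real.rpow_def_of_pos hN, hyN]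
      have h2 : (y ^ 2) ^ (-1 / 2 : ℝ) = y⁻¹ := by
        rw [← Real.rpow_natCast, ← Real.rpow_mul hy0, ← Real.rpow_neg_one]
        norm_num
      rw [h2]
      congr 1
      field_simp
    rw [h1] at hη
    have h3 : (N : ℝ) = Real.exp (y ^ 2) := by rw [← hyN, Real.exp_log hN]
    calc Real.exp y = Real.exp (y ^ 2) * Real.exp (-y ^ 2 + y) := by
          rw [← Real.exp_add]
          ring_nf
      _ ≤ N * z.im := by rw [h3]; gcongr
  have hqy : c ^ 2 * y ≤ q := by rwa [hyN, Real.sqrt_sq hy0] at hq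
  have hfy : f ≤ y ^ 20 := by
    calc f ≤ Real.log N ^ 10 := hfq.trans hqN
      _ = y ^ 20 := by rw [hyN]; ring
  have hη0 : 0 < z.im := (inv_pos.2 hN).trans hz.1
  have hζ := zeta_le_of_large hη0 hc1 hy hcy' hyN hf hfy hqy hNη
  have hr : 10 ≤ Real.log N := by
    rw [hyN]
    nlinarith
  have hq1 : 1 ≤ q := by nlinarith [one_le_pow₀ hc1 (n := 2)]
  have hC : 0 < Cstar := by norm_num [Cstar]
  have ht : 0 < Cstar * Real.exp (5 + D) := by positivity
  have hT : Cstar * Real.exp (5 + D) * zeta N (Real.log N) q z.im f ≤ δ := by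
    calc _ ≤ Cstar * Real.exp (5 + D) * (4 / c) := by gcongr
      _ = δ := by rw [htδ]; field_simp
  have hprob := hH.local_law hf hz hr hq1 ht (hT.trans hδ1.le)
  -- With `r = log N` the factor `exp (-(5 + D)) ^ r` is `N ^ (-5 - D)`, which cancels the
  -- union-bound loss.
  have hrate : (N : ℝ) ^ 5 * (Cstar / (Cstar * Real.exp (5 + D))) ^ Real.log N =
      (N : ℝ) ^ (-D) := by
    rw [div_mul_cancel_left₀ hC.ne', ← Real.exp_neg, ← Real.exp_mul, ← Real.rpow_natCast,
      Real.rpow_def_of_pos hN, Real.rpow_def_of_pos hN, ← Real.exp_add]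
    congr 1
    push_cast
    ring
  rw [hrate] at hprob
  have hcover : (Set.univ : Set Ω) ⊆ {ω | maxError (adjacency f (H ω)) z ≤ δ} ∪
      {ω | maxError (adjacency f (H ω)) z >
        Cstar * Real.exp (5 + D) * zeta N (Real.log N) q z.im f} := by
    intro ω _
    rcases le_or_gt (maxError (adjacency f (H ω)) z) δ with h | h
    · exact Or.inl h
    · exact Or.inr (hT.trans_lt h)
  have h1 := (measureReal_mono (μ := P) hcover).trans (measureReal_union_le _ _)
  rw [probReal_univ] at h1
  linarith

end SparseLocalLaw

end

theorem theorem2p2 {Ω : Type*} [MeasurableSpace Ω] (P : Measure Ω) [IsProbabilityMeasure P]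
    (N : ℕ) (q f K : ℝ) (H : Ω → Matrix (Fin N) (Fin N) ℝ)
    (hH : SparseLocalLaw.IsSparseMatrix P N q K H) (hf0 : 0 ≤ f) (hfq : f ≤ q)
    (z : ℂ) (hz : z ∈ SparseLocalLaw.spectralDomain N) :
    (∀ r t : ℝ, 10 ≤ r → 1 ≤ q → q ≤ (N : ℝ) ^ (1 / 2 : ℝ) → 0 < t →
      t * SparseLocalLaw.zeta N r q z.im f ≤ 1 →
      P.real {ω | SparseLocalLaw.maxError (SparseLocalLaw.adjacency f (H ω)) z
          > t * SparseLocalLaw.zeta N r q z.im f}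
        ≤ (N : ℝ) ^ 5 * (SparseLocalLaw.Cstar / t) ^ r) ∧
    (∀ D δ : ℝ, 0 < D → 0 < δ → δ < 1 →
      SparseLocalLaw.constC δ D * Real.sqrt (Real.log N) ≤ q → q ≤ Real.log N ^ 10 →
      SparseLocalLaw.constN0 δ D ≤ N →
      (N : ℝ) ^ (-1 + Real.log N ^ (-1 / 2 : ℝ)) ≤ z.im →
      P.real {ω | SparseLocalLaw.maxError (SparseLocalLaw.adjacency f (H ω)) z ≤ δ}
        ≥ 1 - (N : ℝ) ^ (-D)) :=
  ⟨fun _ _ hr hq1 _ ht hT => hH.local_law hf0 hz hr hq1 ht hT,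
    fun _ _ hD hδ hδ1 hq hqN hN0 hη =>
      hH.local_law_high_probability hf0 hfq hz hD hδ hδ1 hq hqN hN0 hη⟩
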